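/- Throughout, a strict partition is a finite (possibly empty) sequence $\lambda=(\lambda_1>\lambda_2>\dots>\lambda_{\ell(\lambda)}>0)$ of integers, with $\lambda_i:=0$ for $i>\ell(\lambda)$. Its shifted diagram is $\mathsf{SD}_\lambda=\{(i,j): 1\le i\le j<i+\lambda_i\}$ ($i$ is the row and $j$ the column), and $|\lambda|=|\mathsf{SD}_\lambda|$. Write $\mu\subseteq\lambda$ if $\mu_i\le\lambda_i$ for all $i$. In that case put $\mathsf{SD}_{\lambda/\mu}=\mathsf{SD}_\lambda\setminus\mathsf{SD}_\mu$, let $|\lambda/\mu|=|\mathsf{SD}_{\lambda/\mu}|$, and let $\mathsf{cols}(\lambda/\mu)$ be the number of distinct columns that meet $\mathsf{SD}_{\lambda/\mu}$. The set $\mathsf{SD}_{\lambda/\mu}$ is a vertical strip if it has at most one position in each row. Write $i'=i-\tfrac12$. Let $GQ_\lambda=\sum_T\beta^{|T|-|\lambda|}x^T\in\mathbb Z[\beta][[x_1,x_2,\dots]]$, where $T$ runs over all fillings of $\mathsf{SD}_\lambda$ by nonempty finite subsets of $\{1'<1<2'<2<\cdots\}$ such that rows and columns are weakly increasing (for boxes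 $a$ before $b$ in a row or column, $\max T_a\le\min T_b$), no unprimed number occurs more than once in a column, and no primed number occurs more than once in a row. Here $|T|$ is the sum of the sizes of the entries of $T$, and $x^T=\prod_i x_i^{m_i}$ with $m_i$ the number of times that $i$ or $i'$ occurs in $T$. Let $GP_\lambda$ be the same sum restricted to those $T$ that have no primed number in a diagonal box $(j,j)$. Put $\overline{x}=\frac{-x}{1+\beta x}$. Then there are unique families $(gp_\lambda)$ and $(gq_\lambda)$ of elements of $\mathbb Z[\beta][[x_1,x_2,\dots]]$, indexed by all strict partitions $\lambda$, such that $$\sum_\lambda GQ_\lambda(x)\,gp_\lambda(y)=\sum_\lambda GP_\lambda(x)\,gq_\lambda(y)=\prod_{i,j\ge1}\frac{1-\overline{x_i}\,y_j}{1-x_iy_j},$$ where the sums are over all strict partitions (the infinite sums and product being formal, i.e. coefficientwise convergent). These families, the dual $K$-theoretic Schur $P$- and $Q$-functions, satisfy, for every strict partition $\lambda$, $$gq_\lambda=2^{\ell(\lambda)}\sum_{\mu}(-1)^{\mathsf{cols}(\lambda/\mu)}\left(-\beta/2\right)^{|\lambda/\mu|}gp_\mu ,$$ where the sum is over all strict partitions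 $\mu\subseteq\lambda$ with $\ell(\mu)=\ell(\lambda)$ such that $\mathsf{SD}_{\lambda/\mu}$ is a vertical strip. -/

import Mathlib

open Polynomial
open scoped MvPowerSeries.WithPiTopology

/-- A strict partition: a finite strictly decreasing sequence of positive integers
(possibly empty). -/
structure StrictPartition where
  parts : List ℕ
  decreasing : parts.Pairwise (fun a b => b < a)
  positive : ∀ a ∈ parts, 0 < a

namespace StrictPartition

/-- The `i`-th part, with rows indexed from `0`, and `0` beyond the length. -/
def part (lam : StrictPartition) (i : ℕ) : ℕ := lam.parts.getD i 0

/-- The number `ℓ(λ)` of parts. -/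
def length (lam : StrictPartition) : ℕ := lam.parts.length

/-- The shifted diagram of `λ`.  Rows and columns are indexed from `0`, so the boxes are the
pairs `(i, j)` (row, column) with `i ≤ j < i + λ_i`. -/
def diagram (lam : StrictPartition) : Finset (ℕ × ℕ) :=
  (Finset.range lam.length).biUnion fun i =>
    (Finset.Ico i (i + lam.part i)).image fun j => (i, j)

/-- `|λ|`, the number of boxes of the shifted diagram. -/
def size (lam : StrictPartition) : ℕ := lam.diagram.card

/-- Containment `μ ⊆ λ` of strict partitions: `μ_i ≤ λ_i` for all `i`. -/
def Sub (mu lam : StrictPartition) : Prop := ∀ i, mu.part i ≤ lam.part i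

/-- The boxes of the skew shape `λ/μ`. -/
def skew (lam mu : StrictPartition) : Finset (ℕ × ℕ) := lam.diagram \ mu.diagram

/-- The number of distinct columns occupied by `λ/μ`. -/
def cols (lam mu : StrictPartition) : ℕ := ((skew lam mu).image Prod.snd).card

/-- `λ/μ` is a vertical strip: it has at most one box in each row. -/
def IsVerticalStrip (lam mu : StrictPartition) : Prop :=
  ∀ p ∈ skew lam mu, ∀ q ∈ skew lam mu, p.1 = q.1 → p = q

theorem part_pos_iff (lam : StrictPartition) (i : ℕ) : 0 < lam.part i ↔ i < lam.length := by
  unfold part length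
  constructor
  · intro h
    by_contra hn
    rw [List.getD_eq_default _ _ (not_lt.mp hn)] at h
    exact lt_irrefl _ h
  · intro h
    rw [List.getD_eq_getElem _ _ h]
    exact lam.positive _ (List.getElem_mem h)

theorem mem_diagram (lam : StrictPartition) (p : ℕ × ℕ) :
    p ∈ lam.diagram ↔ p.1 ≤ p.2 ∧ p.2 < p.1 + lam.part p.1 := by
  obtain ⟨i, j⟩ := p
  have h := lam.part_pos_iff i
  simp only [diagram, Finset.mem_biUnion, Finset.mem_range, Finset.mem_image, Finset.mem_Ico,
    Prod.mk.injEq]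
  constructor
  · rintro ⟨a, _, b, hb, rfl, rfl⟩
    exact hb
  · intro hb
    exact ⟨i, h.mp (by omega), j, hb, rfl, rfl⟩

theorem diagram_injective : Function.Injective diagram := by
  intro lam mu h
  have hp : ∀ i, lam.part i = mu.part i := by
    intro i
    have key : ∀ k, k < lam.part i ↔ k < mu.part i := by
      intro k
      have := congrArg (fun s => (i, i + k) ∈ s) h
      simpa [mem_diagram] using this
    have h1 := key (lam.part i)
    have h2 := key (mu.part i)
    omega
  have hl : lam.length = mu.length := by
    have h1 := lam.part_pos_iff mu.length
    have h2 := mu.part_pos_iff mu.length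
    have h3 := lam.part_pos_iff lam.length
    have h4 := mu.part_pos_iff lam.length
    rw [hp] at h1 h3
    omega
  cases lam with
  | mk l _ _ =>
    cases mu with
    | mk m _ _ =>
      have : l = m := by
        apply List.ext_getElem hl
        intro i h1 h2
        have := hp i
        unfold part at this
        rwa [List.getD_eq_getElem _ _ h1, List.getD_eq_getElem _ _ h2] at this
      subst this
      rfl

theorem finite_sub (lam : StrictPartition) : {mu : StrictPartition | mu.Sub lam}.Finite := by
  apply Set.Finite.of_finite_image (f := diagram) _ diagram_injective.injOn
  apply (Finset.finite_toSet lam.diagram.powerset).subset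
  rintro _ ⟨mu, hmu, rfl⟩
  simp only [Finset.coe_powerset, Set.mem_preimage, Set.mem_powerset_iff, Finset.coe_subset]
  intro p hp
  rw [mem_diagram] at hp ⊢
  have := hmu p.1
  omega

/-- The finite set of strict partitions `μ ⊆ λ` with `ℓ(μ) = ℓ(λ)` such that `λ/μ` is a
vertical strip. -/
noncomputable def verticalStrips (lam : StrictPartition) : Finset StrictPartition :=
  (lam.finite_sub.subset (t := {mu : StrictPartition |
    mu.Sub lam ∧ mu.length = lam.length ∧ IsVerticalStrip lam mu}) (fun _ h => h.1)).toFinset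

end StrictPartition

/-- A filling of the boxes of the shifted diagram by finite sets of letters.  The letter `k : ℕ`
stands for the half-integer `(k + 1) / 2`: writing `i' = i - 1/2`, the even number `2 * m` is the
primed letter `(m + 1)'` and the odd number `2 * m + 1` is the unprimed letter `m + 1`, so that
the order `1' < 1 < 2' < 2 < ⋯` is the usual order on `ℕ`. -/
abbrev Filling (lam : StrictPartition) := lam.diagram → Finset ℕ

namespace Filling

/-- Semistandard set-valued (`Q`-)shifted tableaux. -/
structure IsSemistandard {lam : StrictPartition} (T : Filling lam) : Prop where
  nonempty : ∀ a, (T a).Nonempty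
  row_weak : ∀ a b : lam.diagram, a.1.1 = b.1.1 → a.1.2 < b.1.2 →
    ∀ k ∈ T a, ∀ l ∈ T b, k ≤ l
  col_weak : ∀ a b : lam.diagram, a.1.2 = b.1.2 → a.1.1 < b.1.1 →
    ∀ k ∈ T a, ∀ l ∈ T b, k ≤ l
  /-- no unprimed letter occurs more than once in a column -/
  col_unprimed : ∀ a b : lam.diagram, a.1.2 = b.1.2 → ∀ k, Odd k → k ∈ T a → k ∈ T b → a = b
  /-- no primed letter occurs more than once in a row -/
  row_primed : ∀ a b : lam.diagram, a.1.1 = b.1.1 → ∀ k, Even k → k ∈ T a → k ∈ T b → a = b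

/-- No primed letter occurs in a diagonal box. -/
def DiagonalUnprimed {lam : StrictPartition} (T : Filling lam) : Prop :=
  ∀ a : lam.diagram, a.1.1 = a.1.2 → ∀ k ∈ T a, Odd k

/-- The exponent vector of `x^T`: the letters `2 * m` and `2 * m + 1` contribute the variable
`x_m` (the variables are indexed from `0`). -/
noncomputable def weight {lam : StrictPartition} (T : Filling lam) : ℕ →₀ ℕ :=
  ∑ a, ∑ k ∈ T a, Finsupp.single (k / 2) 1

/-- `|T|`, the total number of letters in `T`. -/
def totalCard {lam : StrictPartition} (T : Filling lam) : ℕ := ∑ a, (T a).card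

theorem finite_weight (lam : StrictPartition) (d : ℕ →₀ ℕ) :
    {T : Filling lam | T.weight = d}.Finite := by
  have hfin : (Set.univ.pi fun _ : lam.diagram =>
      {s : Finset ℕ | s ⊆ Finset.range (2 * (d.support.sup id + 1))}).Finite := by
    apply Set.Finite.pi
    intro _
    refine (Finset.finite_toSet (Finset.range (2 * (d.support.sup id + 1))).powerset).subset ?_
    intro s hs
    exact Finset.mem_coe.mpr (Finset.mem_powerset.mpr hs)
  refine hfin.subset ?_
  rintro T rfl a - k hk
  have hpos : weight T (k / 2) ≠ 0 := by
    unfold weight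
    rw [Finsupp.finsetSum_apply]
    intro h0
    have h1 := (Finset.sum_eq_zero_iff.mp h0) a (Finset.mem_univ a)
    rw [Finsupp.finsetSum_apply] at h1
    have h2 := (Finset.sum_eq_zero_iff.mp h1) k hk
    simp at h2
  have hle : k / 2 ≤ (weight T).support.sup id :=
    Finset.le_sup (f := id) (Finsupp.mem_support_iff.mpr hpos)
  rw [Finset.mem_range]
  omega

end Filling

/-- The ring `ℤ[β][[x_0, x_1, …]]`; the polynomial variable is `β`. -/
abbrev BetaSeries := MvPowerSeries ℕ ℤ[X]

/-- The generating function `∑ β^(|T| - |λ|) x^T` over all fillings `T` of the shifted diagram of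
`λ` by nonempty sets that satisfy the condition `P`. -/
noncomputable def tableauSeries (lam : StrictPartition) (P : Filling lam → Prop) : BetaSeries :=
  fun d => ∑ T ∈ ((Filling.finite_weight lam d).subset
    (t := {T : Filling lam | T.weight = d ∧ P T}) (fun _ h => h.1)).toFinset,
      (X : ℤ[X]) ^ (T.totalCard - lam.size)

/-- The `K`-theoretic Schur `Q`-function. -/
noncomputable def GQ (lam : StrictPartition) : BetaSeries :=
  tableauSeries lam fun T => T.IsSemistandard

/-- The `K`-theoretic Schur `P`-function. -/
noncomputable def GP (lam : StrictPartition) : BetaSeries :=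
  tableauSeries lam fun T => T.IsSemistandard ∧ T.DiagonalUnprimed

/-- Power series over `ℤ[β]` in the two alphabets `x_i` (`Sum.inl i`) and `y_j` (`Sum.inr j`). -/
abbrev BetaSeries₂ := MvPowerSeries (ℕ ⊕ ℕ) ℤ[X]

/-- `f(x)` as a power series in the two alphabets. -/
noncomputable def inX (f : BetaSeries) : BetaSeries₂ :=
  MvPowerSeries.rename (Function.Embedding.inl : ℕ ↪ ℕ ⊕ ℕ) f

/-- `f(y)` as a power series in the two alphabets. -/
noncomputable def inY (f : BetaSeries) : BetaSeries₂ :=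
  MvPowerSeries.rename (Function.Embedding.inr : ℕ ↪ ℕ ⊕ ℕ) f

/-- The variable `x_i`. -/
noncomputable def xVar (i : ℕ) : BetaSeries₂ := MvPowerSeries.X (Sum.inl i)

/-- The variable `y_j`. -/
noncomputable def yVar (j : ℕ) : BetaSeries₂ := MvPowerSeries.X (Sum.inr j)

/-- The K-theoretic negative `-x_i / (1 + β x_i)` of `x_i`.  (`MvPowerSeries.invOfUnit f 1` is
the inverse of a power series `f` with constant coefficient `1`.) -/
noncomputable def xBar (i : ℕ) : BetaSeries₂ :=
  -xVar i * MvPowerSeries.invOfUnit (1 + MvPowerSeries.C (X : ℤ[X]) * xVar i) 1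

/-- The factor `(1 - x̄_i y_j) / (1 - x_i y_j)` of the Cauchy kernel. -/
noncomputable def cauchyFactor (p : ℕ × ℕ) : BetaSeries₂ :=
  (1 - xBar p.1 * yVar p.2) * MvPowerSeries.invOfUnit (1 - xVar p.1 * yVar p.2) 1

/-- The Cauchy identity `∑_λ G_λ(x) g_λ(y) = ∏_{i,j} (1 - x̄_i y_j) / (1 - x_i y_j)`, where the
sum is over all strict partitions `λ`.  The infinite sum and the infinite product are formal:
they converge coefficientwise, the coefficient ring `ℤ[β]` being discrete. -/
def CauchyIdentity (G g : StrictPartition → BetaSeries) : Prop :=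
  letI : TopologicalSpace ℤ[X] := ⊥
  ∃ K : BetaSeries₂, HasProd cauchyFactor K ∧ HasSum (fun lam => inX (G lam) * inY (g lam)) K

/-- Extension of scalars from `ℤ[β]` to `ℚ[β]`. -/
noncomputable def toRat : BetaSeries →+* MvPowerSeries ℕ ℚ[X] :=
  MvPowerSeries.map (Polynomial.mapRingHom (Int.castRingHom ℚ))

/-!
Strict partitions are encoded by the finite sets of their parts, a part `p` being a particle at the
site `p - 1`, and functions of strict partitions carry an action of the degenerate Hecke algebra of
type B with relations `u_i ^ 2 = β u_i` (`heckeRelations_uOp`): the operator `u_c` removes or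
repeats the box of content `c`.  Reading the letters of a set-valued shifted tableau in increasing
order adds them one pair (letter, content) at a time, and each pair acts by `h_c(x) = 1 + x u_c`
(`tableauSum_insert`).  In finitely many variables, the functions `GQ` and `GP` are therefore the
values of `T(x_{n-1}) ⋯ T(x_0)` at the vacuum, with the transfer operators
`⋯ h_2 h_1 h_0 h_0 h_1 h_2 ⋯` and `⋯ h_2 h_1 h_0 h_1 h_2 ⋯` (`tableauFun_pairsQ`,
`tableauFun_pairsP`).

*Change of basis.*  Put `x ⊕ y = x + y + βxy` and `z = -2/β`, so that `z ⊕ z = 0`.  The operator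
`h_1(z) h_2(z) ⋯`, followed by the shift of all parts by one and by multiplication by `(-β) ^ ℓ`,
intertwines the two kinds of transfer operators (`intertwiner_mul_transferP`); the only place where
they differ is a two-site identity at the boundary.  Its matrix entries are the signed coefficients
of vertical strips (`scale_ascProd_shift`), and so `GQ_λ` is the sum over the `μ ⊇ λ` of the same
length with `μ/λ` a vertical strip of
`2 ^ ℓ(λ) (-1) ^ cols(μ/λ) (-β/2) ^ |μ/λ| GP_μ` (`coeff_GQ_eq_sum`).

*Uniqueness and the formula.*  The coefficients of `GQ_μ` and `GP_μ` at the monomials `x^λ` form a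
triangular matrix with diagonal entries `2 ^ ℓ(λ)` and `1` (`isTriangular_GQ`, `isTriangular_GP`),
so a Cauchy identity determines the dual family (`CauchyIdentity.unique`).  Substituting the
expansion of `GQ` into the Cauchy identity for `gp` shows that the transposed combinations of the
`gp_μ` satisfy the Cauchy identity for `gq` (`CauchyIdentity.dualExpansion`), which gives both the
existence of `gq` and the formula.

*Existence.*  It remains to find `gp` over `ℤ[β]`, where the diagonal entries `2 ^ ℓ(λ)` are not
invertible.  The reflection equation makes the transfer operators commute, and
`T(x) T(y) ≡ 1` modulo `x ⊕ y`, `T(x) ≡ 1` modulo `x ⊕ x` (`HeckeRelations.transferQ_comm`,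
`HeckeRelations.exists_transferQ_mul`, `HeckeRelations.exists_transferQ_eq`).  Hence `GQ` is
symmetric, is unchanged up to a multiple of `x ⊕ y` when the variables `x` and `y` are dropped, and
its part involving `x_0, …, x_{n-1}` is divisible by `∏ (x_i ⊕ x_i)` (`isQSeries_inX_GQ`).  The
Cauchy kernel has the same properties (`exists_hasProd_cauchyFactor`).  A series with these
properties is determined by its coefficients at the monomials `x^λ`
(`IsQSeries.coeff_eq_zero`), and in its lowest degree the coefficient at `x^λ` is divisible by
`2 ^ ℓ(λ)` (`IsQSeries.two_pow_length_dvd`).  So the triangular elimination that expands the kernel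
in the functions `GQ` only involves exact divisions (`coeff_eq_sum_kernelDual`).
-/

/-! ### One-variable transfer operators in the degenerate Hecke algebra of type B -/

/-- The formal group law `x ⊕ y = x + y + βxy`. -/
def kadd {R : Type*} [CommRing R] (β x y : R) : R := x + y + β * x * y

/-- The relations of the degenerate Hecke algebra of type B with parameter `β`, on generators
`u 0, u 1, …`, the double bond of the Coxeter diagram joining `u 0` and `u 1`. -/
structure HeckeRelations {R A : Type*} [CommRing R] [Ring A] [Algebra R A]
    (β : R) (u : ℕ → A) : Prop where
  sq : ∀ i, u i * u i = β • u i
  comm : ∀ i j, i + 2 ≤ j → u i * u j = u j * u i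
  braid : ∀ i, u (i + 1) * u (i + 2) * u (i + 1) = u (i + 2) * u (i + 1) * u (i + 2)
  braid_zero : u 0 * u 1 * u 0 * u 1 = u 1 * u 0 * u 1 * u 0

section Hecke

variable {R A : Type*} [CommRing R] [Ring A] [Algebra R A] {β : R} {u : ℕ → A}

/-- The factor `h_i(x) = 1 + x u_i`. -/
def hOp (u : ℕ → A) (i : ℕ) (x : R) : A := 1 + x • u i

/-- The product `h_N(x) ⋯ h_2(x) h_1(x)`. -/
def descProd (u : ℕ → A) : ℕ → R → A
  | 0, _ => 1
  | N + 1, x => hOp u (N + 1) x * descProd u N x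

/-- The product `h_1(x) h_2(x) ⋯ h_N(x)`. -/
def ascProd (u : ℕ → A) : ℕ → R → A
  | 0, _ => 1
  | N + 1, x => ascProd u N x * hOp u (N + 1) x

/-- The one-variable transfer operator of the functions `GQ`: the factors of `ascProd` account for
the primed letter `i'` in boxes off the diagonal, those of `descProd` for the letter `i`, and the
two factors `h_0` for the letters `i'` and `i` on the diagonal. -/
def transferQ (u : ℕ → A) (N : ℕ) (x : R) : A :=
  descProd u N x * (hOp u 0 x * hOp u 0 x) * ascProd u N x

/-- The one-variable transfer operator of the functions `GP`, where diagonal boxes only contain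
unprimed letters. -/
def transferP (u : ℕ → A) (N : ℕ) (x : R) : A :=
  descProd u N x * hOp u 0 x * ascProd u N x

namespace HeckeRelations

theorem hOp_mul (H : HeckeRelations β u) (i : ℕ) (x y : R) :
    hOp u i x * hOp u i y = hOp u i (kadd β x y) := by
  simp only [hOp, mul_add, add_mul, one_mul, mul_one, smul_mul_assoc, mul_smul_comm, H.sq, kadd]
  module

theorem hOp_comm (H : HeckeRelations β u) {i j : ℕ} (h : i + 2 ≤ j) (x y : R) :
    hOp u i x * hOp u j y = hOp u j y * hOp u i x := by
  simp only [hOp, mul_add, add_mul, one_mul, mul_one, smul_mul_assoc, mul_smul_comm, H.comm i j h]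
  module

theorem yangBaxter (H : HeckeRelations β u) (i : ℕ) (x y : R) :
    hOp u (i + 1) x * hOp u (i + 2) (kadd β x y) * hOp u (i + 1) y =
      hOp u (i + 2) y * hOp u (i + 1) (kadd β x y) * hOp u (i + 2) x := by
  have h1 := H.sq (i + 1)
  have h2 := H.sq (i + 2)
  have h3 := H.braid i
  simp only [hOp, mul_add, add_mul, one_mul, mul_one, smul_mul_assoc, mul_smul_comm, h1, h2, h3,
    kadd]
  module

theorem reflection_zero (H : HeckeRelations β u) (x m : R) :
    (hOp u 0 x * hOp u 0 x) * hOp u 1 (kadd β x (kadd β x m)) *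
      (hOp u 0 (kadd β x m) * hOp u 0 (kadd β x m)) * hOp u 1 m =
    hOp u 1 m * (hOp u 0 (kadd β x m) * hOp u 0 (kadd β x m)) *
      hOp u 1 (kadd β x (kadd β x m)) * (hOp u 0 x * hOp u 0 x) := by
  rw [H.hOp_mul, H.hOp_mul]
  have h1 := H.sq 0
  have h2 := H.sq 1
  have h3 := H.braid_zero
  simp only [mul_assoc] at h3
  simp only [hOp, mul_add, add_mul, one_mul, mul_one, smul_mul_assoc, mul_smul_comm, mul_assoc,
    h1, h2, h3, smul_add, smul_smul, kadd]
  match_scalars <;> ring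

theorem hOp_comm_descProd (H : HeckeRelations β u) {N j : ℕ} (h : N + 2 ≤ j) (x y : R) :
    hOp u j y * descProd u N x = descProd u N x * hOp u j y := by
  induction N with
  | zero => simp [descProd]
  | succ N ih =>
    rw [descProd, ← mul_assoc, ← H.hOp_comm (by omega : N + 1 + 2 ≤ j), mul_assoc, ih (by omega),
      mul_assoc]

theorem hOp_comm_ascProd (H : HeckeRelations β u) {N j : ℕ} (h : N + 2 ≤ j) (x y : R) :
    hOp u j y * ascProd u N x = ascProd u N x * hOp u j y := by
  induction N with
  | zero => simp [ascProd]
  | succ N ih =>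
    rw [ascProd, ← mul_assoc, ih (by omega), mul_assoc, ← H.hOp_comm (by omega : N + 1 + 2 ≤ j),
      mul_assoc]

theorem transferQ_succ (u : ℕ → A) (N : ℕ) (x : R) :
    transferQ u (N + 1) x = hOp u (N + 1) x * transferQ u N x * hOp u (N + 1) x := by
  simp only [transferQ, descProd, ascProd, mul_assoc]

theorem hOp_comm_transferQ (H : HeckeRelations β u) {N j : ℕ} (h : N + 2 ≤ j) (x y : R) :
    hOp u j y * transferQ u N x = transferQ u N x * hOp u j y := by
  have h0 := H.hOp_comm (by omega : 0 + 2 ≤ j) x y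
  have hA := H.hOp_comm_descProd h x y
  have hB := H.hOp_comm_ascProd h x y
  unfold transferQ
  calc _ = (hOp u j y * descProd u N x) * hOp u 0 x * hOp u 0 x * ascProd u N x := by
        simp only [mul_assoc]
    _ = descProd u N x * (hOp u j y * hOp u 0 x) * hOp u 0 x * ascProd u N x := by
        rw [hA]; simp only [mul_assoc]
    _ = descProd u N x * hOp u 0 x * (hOp u j y * hOp u 0 x) * ascProd u N x := by
        nth_rw 1 [← h0]; simp only [mul_assoc]
    _ = descProd u N x * hOp u 0 x * hOp u 0 x * (hOp u j y * ascProd u N x) := by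
        nth_rw 1 [← h0]; simp only [mul_assoc]
    _ = _ := by rw [hB]; simp only [mul_assoc]

theorem kadd_comm (β x y : R) : kadd β x y = kadd β y x := by unfold kadd; ring

/-- The reflection equation satisfied by the transfer operators, with `y = x ⊕ m`; as
`T_{N+1}(x) = h_{N+1}(x) T_N(x) h_{N+1}(x)`, it implies that `T_{N+1}(x)` and `T_{N+1}(y)`
commute. -/
theorem reflection (H : HeckeRelations β u) (N : ℕ) (x m : R) :
    transferQ u N x * hOp u (N + 1) (kadd β x (kadd β x m)) * transferQ u N (kadd β x m) *
      hOp u (N + 1) m =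
    hOp u (N + 1) m * transferQ u N (kadd β x m) * hOp u (N + 1) (kadd β x (kadd β x m)) *
      transferQ u N x := by
  induction N with
  | zero => simpa [transferQ, descProd, ascProd] using H.reflection_zero x m
  | succ N ih =>
    set y := kadd β x m with hy
    set p := kadd β x y with hp
    have hp' : kadd β y x = p := kadd_comm _ _ _
    have hy' : kadd β m x = y := kadd_comm _ _ _
    have y1 : hOp u (N+1) x * hOp u (N+2) p * hOp u (N+1) y =
      hOp u (N+2) y * hOp u (N+1) p * hOp u (N+2) x := H.yangBaxter N x y
    have y2 : hOp u (N+2) x * hOp u (N+1) y * hOp u (N+2) m =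
      hOp u (N+1) m * hOp u (N+2) y * hOp u (N+1) x := by
      have := H.yangBaxter N m x; rw [hy'] at this; exact this.symm
    have y3 : hOp u (N+1) x * hOp u (N+2) y * hOp u (N+1) m =
      hOp u (N+2) m * hOp u (N+1) y * hOp u (N+2) x := H.yangBaxter N x m
    have y4 : hOp u (N+2) x * hOp u (N+1) p * hOp u (N+2) y =
      hOp u (N+1) y * hOp u (N+2) p * hOp u (N+1) x := by
      have := H.yangBaxter N y x; rw [hp'] at this; exact this.symm
    rw [transferQ_succ, transferQ_succ]
    have cx (z : R) : hOp u (N+2) z * transferQ u N x = transferQ u N x * hOp u (N+2) z :=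
      H.hOp_comm_transferQ le_rfl x z
    have cy (z : R) : hOp u (N+2) z * transferQ u N y = transferQ u N y * hOp u (N+2) z :=
      H.hOp_comm_transferQ le_rfl y z
    generalize transferQ u N x = Tx at *
    generalize transferQ u N y = Ty at *
    calc hOp u (N+1) x * Tx * hOp u (N+1) x * hOp u (N+2) p * (hOp u (N+1) y * Ty * hOp u (N+1) y)
          * hOp u (N+2) m
        = hOp u (N+1) x * Tx * (hOp u (N+1) x * hOp u (N+2) p * hOp u (N+1) y) * Ty * hOp u (N+1) y
          * hOp u (N+2) m := by simp only [mul_assoc]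
      _ = hOp u (N+1) x * (Tx * hOp u (N+2) y) * hOp u (N+1) p * (hOp u (N+2) x * Ty)
          * hOp u (N+1) y * hOp u (N+2) m := by rw [y1]; simp only [mul_assoc]
      _ = hOp u (N+1) x * hOp u (N+2) y * Tx * hOp u (N+1) p * Ty *
          (hOp u (N+2) x * hOp u (N+1) y * hOp u (N+2) m) := by
          rw [← cx, cy]; simp only [mul_assoc]
      _ = hOp u (N+1) x * hOp u (N+2) y * (Tx * hOp u (N+1) p * Ty * hOp u (N+1) m) *
          hOp u (N+2) y * hOp u (N+1) x := by rw [y2]; simp only [mul_assoc]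
      _ = (hOp u (N+1) x * hOp u (N+2) y * hOp u (N+1) m) * Ty * hOp u (N+1) p * Tx *
          hOp u (N+2) y * hOp u (N+1) x := by rw [ih]; simp only [mul_assoc]
      _ = hOp u (N+2) m * hOp u (N+1) y * (hOp u (N+2) x * Ty) * hOp u (N+1) p *
          (Tx * hOp u (N+2) y) * hOp u (N+1) x := by rw [y3]; simp only [mul_assoc]
      _ = hOp u (N+2) m * hOp u (N+1) y * Ty * (hOp u (N+2) x * hOp u (N+1) p * hOp u (N+2) y)
          * Tx * hOp u (N+1) x := by rw [cy, ← cx]; simp only [mul_assoc]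
      _ = _ := by rw [y4]; simp only [mul_assoc]

/-- The transfer operators at `x` and at `x ⊕ m` commute. -/
theorem transferQ_comm (H : HeckeRelations β u) (N : ℕ) (x m : R) :
    transferQ u N x * transferQ u N (kadd β x m) =
      transferQ u N (kadd β x m) * transferQ u N x := by
  cases N with
  | zero =>
    simp only [transferQ, descProd, ascProd, one_mul, mul_one, H.hOp_mul]
    congr 1
    unfold kadd; ring
  | succ N =>
    have key := H.reflection N x m
    set y := kadd β x m with hy
    have hxm : hOp u (N + 1) x * hOp u (N + 1) m = hOp u (N + 1) y := H.hOp_mul _ _ _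
    have hmx : hOp u (N + 1) m * hOp u (N + 1) x = hOp u (N + 1) y := by
      rw [H.hOp_mul, kadd_comm]
    have hxy := H.hOp_mul (N + 1) x y
    have hyx : hOp u (N + 1) y * hOp u (N + 1) x = hOp u (N + 1) (kadd β x y) := by
      rw [H.hOp_mul, kadd_comm]
    rw [transferQ_succ, transferQ_succ]
    set h := hOp u (N + 1) x
    calc h * transferQ u N x * h * (hOp u (N+1) y * transferQ u N y * hOp u (N+1) y)
        = h * transferQ u N x * (h * hOp u (N+1) y) * transferQ u N y * hOp u (N+1) y := by
          simp only [mul_assoc]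
      _ = h * (transferQ u N x * hOp u (N+1) (kadd β x y) * transferQ u N y * hOp u (N+1) m) *
          h := by
          rw [hxy, ← hmx]; simp only [mul_assoc]
      _ = (h * hOp u (N+1) m) * transferQ u N y * hOp u (N+1) (kadd β x y) * transferQ u N x *
          h := by
          rw [key]; simp only [mul_assoc]
      _ = _ := by rw [hxm, ← hyx]; simp only [mul_assoc]

/-- The exchange relation between the ascending products at `x` and at `x ⊕ m`. -/
theorem ascProd_exchange (H : HeckeRelations β u) (N : ℕ) (x m : R) :
    ascProd u (N + 1) x * ascProd u N (kadd β x m) * hOp u (N + 1) m =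
      ascProd u (N + 1) (kadd β x m) * ascProd u N x := by
  induction N with
  | zero => simp [ascProd, H.hOp_mul]
  | succ N ih =>
    set y := kadd β x m with hy
    have hy' : kadd β m x = y := kadd_comm _ _ _
    have y2 : hOp u (N+2) x * hOp u (N+1) y * hOp u (N+2) m =
      hOp u (N+1) m * hOp u (N+2) y * hOp u (N+1) x := by
      have := H.yangBaxter N m x; rw [hy'] at this; exact this.symm
    have c (z w : R) : hOp u (N+2) z * ascProd u N w = ascProd u N w * hOp u (N+2) z :=
      H.hOp_comm_ascProd le_rfl w z
    calc ascProd u (N+2) x * ascProd u (N+1) y * hOp u (N+2) m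
        = ascProd u (N+1) x * (hOp u (N+2) x * ascProd u N y) * hOp u (N+1) y * hOp u (N+2) m := by
          simp only [ascProd, mul_assoc]
      _ = ascProd u (N+1) x * ascProd u N y * (hOp u (N+2) x * hOp u (N+1) y * hOp u (N+2) m) := by
          rw [c]; simp only [mul_assoc]
      _ = (ascProd u (N+1) x * ascProd u N y * hOp u (N+1) m) * hOp u (N+2) y * hOp u (N+1) x := by
          rw [y2]; simp only [mul_assoc]
      _ = ascProd u (N+1) y * (ascProd u N x * hOp u (N+2) y) * hOp u (N+1) x := by
          rw [ih]; simp only [mul_assoc]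
      _ = _ := by rw [← c]; simp only [ascProd, mul_assoc]

theorem ascProd_comm (H : HeckeRelations β u) (N : ℕ) (x m : R) :
    ascProd u N x * ascProd u N (kadd β x m) = ascProd u N (kadd β x m) * ascProd u N x := by
  cases N with
  | zero => rfl
  | succ N =>
    have key := H.ascProd_exchange N x m
    have hmx : hOp u (N + 1) m * hOp u (N + 1) x = hOp u (N + 1) (kadd β x m) := by
      rw [H.hOp_mul, kadd_comm]
    calc _ = ascProd u (N+1) x * ascProd u N (kadd β x m) * hOp u (N+1) m * hOp u (N+1) x := by
          rw [mul_assoc _ (hOp u (N+1) m), hmx, mul_assoc]; rfl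
      _ = _ := by rw [key, mul_assoc]; rfl

theorem hOp_mul_of_kadd_eq_zero (H : HeckeRelations β u) (i : ℕ) {x y : R}
    (h : kadd β x y = 0) : hOp u i x * hOp u i y = 1 := by
  rw [H.hOp_mul, h, hOp, zero_smul, add_zero]

theorem descProd_mul_ascProd (H : HeckeRelations β u) (N : ℕ) {x y : R}
    (h : kadd β x y = 0) : descProd u N x * ascProd u N y = 1 := by
  induction N with
  | zero => simp [descProd, ascProd]
  | succ N ih =>
    calc _ = hOp u (N+1) x * (descProd u N x * ascProd u N y) * hOp u (N+1) y := by
          simp only [descProd, ascProd, mul_assoc]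
      _ = 1 := by rw [ih, mul_one, H.hOp_mul_of_kadd_eq_zero _ h]

theorem ascProd_mul_descProd (H : HeckeRelations β u) (N : ℕ) {x y : R}
    (h : kadd β x y = 0) : ascProd u N x * descProd u N y = 1 := by
  induction N with
  | zero => simp [descProd, ascProd]
  | succ N ih =>
    calc _ = ascProd u N x * (hOp u (N+1) x * hOp u (N+1) y) * descProd u N y := by
          simp only [descProd, ascProd, mul_assoc]
      _ = 1 := by rw [H.hOp_mul_of_kadd_eq_zero _ h, mul_one, ih]

/-- `T(x) T(y) ≡ 1` modulo `x ⊕ y`: this is the source of the cancellation property of `GQ`. -/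
theorem exists_transferQ_mul (H : HeckeRelations β u) (N : ℕ) (x y : R) :
    ∃ Z : A, transferQ u N x * transferQ u N y = 1 + kadd β x y • Z := by
  have sandwich : ∀ i, ∀ W : A, ∃ Z : A,
      hOp u i x * (1 + kadd β x y • W) * hOp u i y = 1 + kadd β x y • Z := fun i W =>
    ⟨u i + hOp u i x * W * hOp u i y, by
      rw [mul_add, mul_one, add_mul, H.hOp_mul, mul_smul_comm, smul_mul_assoc]
      simp only [hOp, smul_add, add_assoc]⟩
  have sandwich' : ∀ i, ∀ W : A, ∃ Z : A,
      hOp u i y * (1 + kadd β x y • W) * hOp u i x = 1 + kadd β x y • Z := fun i W =>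
    ⟨u i + hOp u i y * W * hOp u i x, by
      rw [mul_add, mul_one, add_mul, H.hOp_mul, kadd_comm β y x, mul_smul_comm, smul_mul_assoc]
      simp only [hOp, smul_add, add_assoc]⟩
  have hBA : ∀ N, ∃ Z : A, ascProd u N x * descProd u N y = 1 + kadd β x y • Z := by
    intro N
    induction N with
    | zero => exact ⟨0, by simp [ascProd, descProd]⟩
    | succ N ih =>
      obtain ⟨Z, hZ⟩ := ih
      refine ⟨Z + ascProd u N x * u (N+1) * descProd u N y, ?_⟩
      calc _ = ascProd u N x * (hOp u (N+1) x * hOp u (N+1) y) * descProd u N y := by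
            simp only [ascProd, descProd, mul_assoc]
        _ = _ := by
          rw [H.hOp_mul, hOp, mul_add, mul_one, add_mul, hZ, mul_smul_comm, smul_mul_assoc]
          module
  have hABC : ∀ N, ∀ W : A, ∃ Z : A,
      descProd u N x * (1 + kadd β x y • W) * ascProd u N y = 1 + kadd β x y • Z := by
    intro N
    induction N with
    | zero => exact fun W => ⟨W, by simp [ascProd, descProd]⟩
    | succ N ih =>
      intro W
      obtain ⟨Z, hZ⟩ := ih W
      obtain ⟨Z', hZ'⟩ := sandwich (N+1) Z
      refine ⟨Z', ?_⟩
      rw [← hZ', ← hZ]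
      simp only [ascProd, descProd, mul_assoc]
  obtain ⟨Z, hZ⟩ := hBA N
  obtain ⟨Z1, h1⟩ := sandwich 0 Z
  obtain ⟨Z2, h2⟩ := sandwich 0 Z1
  obtain ⟨Z3, h3⟩ := hABC N Z2
  refine ⟨Z3, ?_⟩
  rw [← h3, ← h2, ← h1, ← hZ]
  simp only [transferQ, mul_assoc]

/-- `T(x) ≡ 1` modulo `x ⊕ x`: this is the source of the divisibility of coefficients of `GQ` by
powers of `2`. -/
theorem exists_transferQ_eq (H : HeckeRelations β u) (N : ℕ) (x : R) :
    ∃ W : A, transferQ u N x = 1 + kadd β x x • W := by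
  induction N with
  | zero =>
    refine ⟨u 0, ?_⟩
    rw [transferQ, descProd, ascProd, H.hOp_mul, one_mul, mul_one, hOp]
  | succ N ih =>
    obtain ⟨W, hW⟩ := ih
    refine ⟨u (N+1) + hOp u (N+1) x * W * hOp u (N+1) x, ?_⟩
    rw [transferQ_succ, hW, mul_add, mul_one, add_mul, H.hOp_mul, mul_smul_comm, smul_mul_assoc]
    simp only [hOp, smul_add, add_assoc]

end HeckeRelations

end Hecke

/-! ### The Hecke action on functions of strict partitions -/

section Action

variable {R : Type*} [CommRing R]

/-- Whether the strict partition with set of sites `s` (a part `p` occupies the site `p - 1`) has a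
removable box of content `c`. -/
def Removable : ℕ → Finset ℕ → Prop
  | 0, s => 0 ∈ s
  | c + 1, s => c + 1 ∈ s ∧ c ∉ s

instance decidableRemovable : ∀ c s, Decidable (Removable c s)
  | 0, s => inferInstanceAs (Decidable (0 ∈ s))
  | c + 1, s => inferInstanceAs (Decidable (c + 1 ∈ s ∧ c ∉ s))

/-- The set of sites after removal of the box of content `c`. -/
def lower : ℕ → Finset ℕ → Finset ℕ
  | 0, s => s.erase 0
  | c + 1, s => insert c (s.erase (c + 1))

/-- The operator `u_c` on functions of strict partitions, encoded by their sets of sites: the value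
at `s` involves `s` and the result of removing the box of content `c` from `s`. -/
def uOp (β : R) (c : ℕ) : Module.End R (Finset ℕ → R) where
  toFun f s := if Removable c s then f (lower c s) + β * f s else 0
  map_add' f g := by
    funext s
    simp only [Pi.add_apply]
    split_ifs <;> ring
  map_smul' r f := by
    funext s
    simp only [Pi.smul_apply, smul_eq_mul, RingHom.id_apply]
    split_ifs <;> ring

theorem uOp_apply (β : R) (c : ℕ) (f : Finset ℕ → R) (s : Finset ℕ) :
    uOp β c f s = if Removable c s then f (lower c s) + β * f s else 0 := rfl

theorem mem_lower_zero (m : ℕ) (s : Finset ℕ) : m ∈ lower 0 s ↔ m ≠ 0 ∧ m ∈ s := by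
  simp [lower]

theorem mem_lower_succ (c m : ℕ) (s : Finset ℕ) :
    m ∈ lower (c + 1) s ↔ m = c ∨ (m ≠ c + 1 ∧ m ∈ s) := by
  simp [lower]

theorem removable_zero (s : Finset ℕ) : Removable 0 s ↔ 0 ∈ s := Iff.rfl

theorem removable_succ (c : ℕ) (s : Finset ℕ) : Removable (c + 1) s ↔ c + 1 ∈ s ∧ c ∉ s := Iff.rfl

theorem uOp_comm (β : R) {i j : ℕ} (h : i + 2 ≤ j) : uOp β i * uOp β j = uOp β j * uOp β i := by
  ext1 f
  funext s
  obtain ⟨j, rfl⟩ : ∃ k, j = k + 1 := ⟨j - 1, by omega⟩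
  have e : lower (j + 1) (lower i s) = lower i (lower (j + 1) s) := by
    cases i <;> ext m <;> simp only [mem_lower_zero, mem_lower_succ] <;> grind
  have h1 : Removable i (lower (j + 1) s) ↔ Removable i s := by
    cases i <;> simp only [removable_zero, removable_succ, mem_lower_succ] <;> grind
  have h2 : Removable (j + 1) (lower i s) ↔ Removable (j + 1) s := by
    cases i <;> simp only [removable_succ, mem_lower_succ, mem_lower_zero] <;> grind
  simp only [Module.End.mul_apply, uOp_apply, h1, h2, e]
  split_ifs <;> ring

theorem heckeRelations_uOp (β : R) : HeckeRelations β (uOp β) where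
  sq i := by
    ext1 f
    funext s
    have h1 : ¬ Removable i (lower i s) := by
      cases i <;> simp only [removable_zero, removable_succ, mem_lower_succ, mem_lower_zero] <;>
        grind
    simp only [Module.End.mul_apply, uOp_apply, h1, if_false, LinearMap.smul_apply, Pi.smul_apply,
      smul_eq_mul]
    split_ifs <;> ring
  comm i j h := uOp_comm β h
  braid i := by
    ext1 f
    funext s
    simp only [Module.End.mul_apply, uOp_apply, removable_succ, mem_lower_succ]
    by_cases h0 : i ∈ s <;> by_cases h1 : i + 1 ∈ s <;> by_cases h2 : i + 2 ∈ s <;>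
      simp [h0, h1, h2]
    all_goals (intros; omega)
  braid_zero := by
    ext1 f
    funext s
    simp only [Module.End.mul_apply, uOp_apply, removable_succ, removable_zero, mem_lower_succ,
      mem_lower_zero]
    by_cases h0 : 0 ∈ s <;> by_cases h1 : 1 ∈ s <;>
      simp [h0, h1]
end Action

/-! ### Strict partitions as finite sets of sites -/

namespace StrictPartition

theorem part_lt_part (lam : StrictPartition) {i j : ℕ} (hij : i < j) (hj : 0 < lam.part j) :
    lam.part j < lam.part i := by
  have hjl := (lam.part_pos_iff j).mp hj
  have hil : i < lam.length := by omega
  unfold part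
  unfold length at hjl hil
  rw [List.getD_eq_getElem _ _ hjl, List.getD_eq_getElem _ _ hil]
  exact List.pairwise_iff_getElem.mp lam.decreasing i j hil hjl hij

theorem part_le_part (lam : StrictPartition) {i j : ℕ} (hij : i ≤ j) :
    lam.part j ≤ lam.part i := by
  rcases Nat.eq_zero_or_pos (lam.part j) with h | h
  · omega
  · rcases hij.eq_or_lt with rfl | h'
    · exact le_rfl
    · exact (lam.part_lt_part h' h).le

theorem part_length (lam : StrictPartition) : lam.part lam.length = 0 := by
  have := lam.part_pos_iff lam.length
  omega

theorem part_injective : Function.Injective part := by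
  intro lam mu h
  apply diagram_injective
  ext p
  rw [mem_diagram, mem_diagram, h]

theorem mem_parts_iff (lam : StrictPartition) (a : ℕ) :
    a ∈ lam.parts ↔ 0 < a ∧ ∃ i, lam.part i = a := by
  constructor
  · intro h
    refine ⟨lam.positive a h, ?_⟩
    obtain ⟨i, hi, rfl⟩ := List.mem_iff_getElem.mp h
    exact ⟨i, List.getD_eq_getElem _ _ hi⟩
  · rintro ⟨h0, i, rfl⟩
    have hi := (lam.part_pos_iff i).mp h0
    unfold part
    unfold length at hi
    rw [List.getD_eq_getElem _ _ hi]
    exact List.getElem_mem hi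

theorem exists_part_eq (g : ℕ → ℕ) (hdec : ∀ i, 0 < g (i + 1) → g (i + 1) < g i)
    (hfin : ∃ n, g n = 0) : ∃ mu : StrictPartition, mu.part = g := by
  classical
  have hz : ∀ i k, g i = 0 → g (i + k) = 0 := by
    intro i k h
    induction k with
    | zero => exact h
    | succ k ih =>
      have := hdec (i + k)
      rw [← add_assoc]
      omega
  have hlt : ∀ i k, 0 < g (i + k + 1) → g (i + k + 1) < g i := by
    intro i k
    induction k with
    | zero => exact hdec i
    | succ k ih =>
      intro h
      have h1 := hdec (i + k + 1) h
      have h2 := ih (by omega)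
      rw [← add_assoc]
      omega
  have hpos : ∀ i, i < Nat.find hfin → 0 < g i := fun i hi =>
    Nat.pos_of_ne_zero (Nat.find_min hfin hi)
  refine ⟨⟨(List.range (Nat.find hfin)).map g, ?_, ?_⟩, ?_⟩
  · rw [List.pairwise_map]
    refine List.Pairwise.imp_of_mem ?_ List.pairwise_lt_range
    intro a b ha hb hab
    have hb' := hpos b (List.mem_range.mp hb)
    obtain ⟨k, rfl⟩ : ∃ k, b = a + k + 1 := ⟨b - a - 1, by omega⟩
    exact hlt a k hb'
  · intro a ha
    obtain ⟨i, hi, rfl⟩ := List.mem_map.mp ha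
    exact hpos i (List.mem_range.mp hi)
  · funext i
    unfold part
    rcases lt_or_ge i (Nat.find hfin) with h | h
    · rw [List.getD_eq_getElem _ _ (by simpa using h)]
      simp
    · rw [List.getD_eq_default _ _ (by simpa using h)]
      obtain ⟨k, rfl⟩ := Nat.exists_eq_add_of_le h
      exact (hz _ k (Nat.find_spec hfin)).symm

/-- The set of sites occupied by a strict partition: a part `p` occupies the site `p - 1`. -/
def sites (lam : StrictPartition) : Finset ℕ := (lam.parts.map (· - 1)).toFinset

theorem mem_sites (lam : StrictPartition) (m : ℕ) : m ∈ lam.sites ↔ ∃ i, lam.part i = m + 1 := by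
  simp only [sites, List.mem_toFinset, List.mem_map]
  constructor
  · rintro ⟨a, ha, rfl⟩
    obtain ⟨h0, i, hi⟩ := (lam.mem_parts_iff a).mp ha
    exact ⟨i, by omega⟩
  · rintro ⟨i, hi⟩
    exact ⟨m + 1, (lam.mem_parts_iff _).mpr ⟨by omega, i, hi⟩, by omega⟩

theorem mem_sites_iff_mem_parts (lam : StrictPartition) (m : ℕ) :
    m ∈ lam.sites ↔ m + 1 ∈ lam.parts := by
  rw [mem_sites, mem_parts_iff]
  simp

theorem card_sites (lam : StrictPartition) : lam.sites.card = lam.length := by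
  unfold sites length
  rw [List.toFinset_card_of_nodup, List.length_map]
  rw [List.nodup_iff_pairwise_ne, List.pairwise_map]
  refine lam.decreasing.imp_of_mem ?_
  intro a b ha hb hab
  have := lam.positive b hb
  omega

theorem sites_injective : Function.Injective sites := by
  intro lam mu h
  have hp : lam.parts = mu.parts := by
    refine List.Perm.eq_of_pairwise (le := fun a b => b < a) ?_ lam.decreasing mu.decreasing ?_
    · intro a b _ _ h1 h2
      omega
    · rw [List.perm_ext_iff_of_nodup (lam.decreasing.imp fun h => h.ne')
        (mu.decreasing.imp fun h => h.ne')]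
      intro a
      rcases a with _ | a
      · simp [mem_parts_iff]
      · rw [← mem_sites_iff_mem_parts, ← mem_sites_iff_mem_parts, h]
  cases lam
  cases mu
  simpa using hp

theorem sites_surjective : Function.Surjective sites := by
  intro s
  refine ⟨⟨(s.sort (· ≥ ·)).map (· + 1), ?_, ?_⟩, ?_⟩
  · rw [List.pairwise_map]
    exact (s.sortedGT_sort.pairwise).imp (by intro a b h; omega)
  · intro a ha
    obtain ⟨b, _, rfl⟩ := List.mem_map.mp ha
    omega
  · ext m
    rw [mem_sites_iff_mem_parts]
    simp

/-- Strict partitions correspond to finite sets of sites. -/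
noncomputable def siteEquiv : StrictPartition ≃ Finset ℕ :=
  Equiv.ofBijective sites ⟨sites_injective, sites_surjective⟩

theorem siteEquiv_apply (lam : StrictPartition) : siteEquiv lam = lam.sites := rfl

theorem sites_siteEquiv_symm (s : Finset ℕ) : (siteEquiv.symm s).sites = s :=
  siteEquiv.apply_symm_apply s

/-- If the box of content `c` of `λ` is removable, it lies at the end of a row of length `c + 1`,
and shortening this row gives the strict partition with set of sites `lower c λ.sites`. -/
theorem exists_lower (lam : StrictPartition) (c : ℕ) (h : Removable c lam.sites) :
    ∃ (i : ℕ) (mu : StrictPartition), lam.part i = c + 1 ∧ mu.part = Function.update lam.part i c ∧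
      mu.sites = lower c lam.sites := by
  have hc : c ∈ lam.sites := by
    cases c with
    | zero => exact h
    | succ c => exact h.1
  obtain ⟨i, hi⟩ := (lam.mem_sites c).mp hc
  have hnext : lam.part (i + 1) < c ∨ lam.part (i + 1) = 0 := by
    rcases Nat.eq_zero_or_pos (lam.part (i + 1)) with h0 | h0
    · exact Or.inr h0
    · have h1 := lam.part_lt_part (Nat.lt_add_one i) h0
      left
      rcases c with _ | c
      · omega
      · have h2 : lam.part (i + 1) ≠ c + 1 := fun h3 => h.2 ((lam.mem_sites c).mpr ⟨_, h3⟩)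
        omega
  obtain ⟨mu, hmu⟩ := exists_part_eq (Function.update lam.part i c) (by
    intro j hj
    by_cases h1 : j = i
    · subst h1
      rw [Function.update_of_ne (by omega)] at hj ⊢
      rw [Function.update_self]
      omega
    · rw [Function.update_of_ne h1]
      by_cases h2 : j + 1 = i
      · subst h2
        rw [Function.update_self] at hj ⊢
        have := lam.part_lt_part (Nat.lt_add_one j) (by omega)
        omega
      · rw [Function.update_of_ne h2] at hj ⊢
        exact lam.part_lt_part (Nat.lt_add_one j) hj) ⟨lam.length + i + 1, by
      rw [Function.update_of_ne (by omega)]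
      have := lam.part_le_part (i := lam.length) (j := lam.length + i + 1) (by omega)
      have := lam.part_length
      omega⟩
  refine ⟨i, mu, hi, hmu, ?_⟩
  have hinj : ∀ j, lam.part j = c + 1 → j = i := by
    intro j hj
    rcases lt_trichotomy j i with h1 | h1 | h1
    · have := lam.part_lt_part h1 (by omega)
      omega
    · exact h1
    · have := lam.part_lt_part h1 (by omega)
      omega
  ext m
  rw [mem_sites, hmu]
  have key : (∃ j, Function.update lam.part i c j = m + 1) ↔
      c = m + 1 ∨ (m ≠ c ∧ m ∈ lam.sites) := by
    rw [mem_sites]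
    constructor
    · rintro ⟨j, hj⟩
      by_cases h1 : j = i
      · subst h1
        rw [Function.update_self] at hj
        exact Or.inl hj
      · rw [Function.update_of_ne h1] at hj
        refine Or.inr ⟨?_, j, hj⟩
        rintro rfl
        exact h1 (hinj j hj)
    · rintro (h1 | ⟨h1, j, hj⟩)
      · exact ⟨i, by rw [Function.update_self, h1]⟩
      · refine ⟨j, ?_⟩
        rw [Function.update_of_ne, hj]
        rintro rfl
        omega
  rw [key]
  cases c with
  | zero => simp [mem_lower_zero]
  | succ c =>
    rw [mem_lower_succ]
    constructor
    · rintro (h1 | h1)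
      · exact Or.inl (by omega)
      · exact Or.inr h1
    · rintro (h1 | h1)
      · exact Or.inl (by omega)
      · exact Or.inr h1

theorem removable_of_corner (lam : StrictPartition) {i c : ℕ} (h : (i, i + c) ∈ lam.diagram)
    (hr : (i, i + c + 1) ∉ lam.diagram) (hb : (i + 1, i + c) ∉ lam.diagram) :
    Removable c lam.sites ∧ lam.part i = c + 1 := by
  rw [mem_diagram] at h hr hb
  simp only at h hr hb
  have hi : lam.part i = c + 1 := by omega
  refine ⟨?_, hi⟩
  rcases c with _ | c
  · exact (lam.mem_sites 0).mpr ⟨i, hi⟩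
  · refine ⟨(lam.mem_sites _).mpr ⟨i, hi⟩, fun h1 => ?_⟩
    obtain ⟨j, hj⟩ := (lam.mem_sites c).mp h1
    rcases Nat.lt_or_ge i j with h2 | h2
    · have := lam.part_le_part (i := i + 1) (j := j) (by omega)
      omega
    · have := lam.part_le_part h2
      omega

theorem diagram_of_part_update {lam mu : StrictPartition} {i c : ℕ} (hi : lam.part i = c + 1)
    (h : mu.part = Function.update lam.part i c) : mu.diagram = lam.diagram.erase (i, i + c) := by
  ext ⟨a, b⟩
  rw [Finset.mem_erase, mem_diagram, mem_diagram, h]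
  simp only [ne_eq, Prod.mk.injEq]
  by_cases h1 : a = i
  · subst h1
    rw [Function.update_self]
    omega
  · rw [Function.update_of_ne h1]
    tauto

end StrictPartition

/-! ### Set-valued tableaux and the Hecke action -/

namespace StrictPartition

theorem add_part_le (lam : StrictPartition) {i j : ℕ} (hij : i ≤ j) (hj : 0 < lam.part j) :
    j + lam.part j ≤ i + lam.part i := by
  obtain ⟨k, rfl⟩ := Nat.exists_eq_add_of_le hij
  clear hij
  induction k with
  | zero => exact le_rfl
  | succ k ih =>
    have h := lam.part_lt_part (i := i + k) (j := i + (k + 1)) (by omega) hj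
    have := ih (by omega)
    omega

theorem mem_diagram_above (lam : StrictPartition) {i i' j : ℕ} (h : (i', j) ∈ lam.diagram)
    (hi : i ≤ i') : (i, j) ∈ lam.diagram := by
  rw [mem_diagram] at h ⊢
  simp only at h ⊢
  have := lam.add_part_le hi (by omega)
  omega

theorem mem_diagram_left (lam : StrictPartition) {i j j' : ℕ} (h : (i, j') ∈ lam.diagram)
    (hj : j ≤ j') (hij : i ≤ j) : (i, j) ∈ lam.diagram := by
  rw [mem_diagram] at h ⊢
  simp only at h ⊢
  omega

theorem below_notMem_diagram (lam : StrictPartition) {i c : ℕ} (hi : lam.part i = c + 1)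
    (h : Removable c lam.sites) : (i + 1, i + c) ∉ lam.diagram := by
  rw [mem_diagram]
  rintro ⟨h1, h2⟩
  simp only at h1 h2
  obtain ⟨c, rfl⟩ : ∃ d, c = d + 1 := ⟨c - 1, by omega⟩
  refine h.2 ((lam.mem_sites c).mpr ⟨i + 1, ?_⟩)
  have := lam.part_lt_part (Nat.lt_add_one i) (by omega)
  omega

theorem part_eq_imp_eq (lam : StrictPartition) {i j : ℕ} (h : lam.part i = lam.part j)
    (hi : 0 < lam.part i) : i = j := by
  rcases lt_trichotomy i j with h1 | h1 | h1
  · have := lam.part_lt_part h1 (by omega)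
    omega
  · exact h1
  · have := lam.part_lt_part h1 (by omega)
    omega

end StrictPartition

/-- A set-valued filling, encoded by the set of its pairs (box, letter), that satisfies the
conditions of a semistandard shifted tableau. -/
structure IsTableau (E : Finset ((ℕ × ℕ) × ℕ)) : Prop where
  row_weak : ∀ e ∈ E, ∀ f ∈ E, e.1.1 = f.1.1 → e.1.2 < f.1.2 → e.2 ≤ f.2
  col_weak : ∀ e ∈ E, ∀ f ∈ E, e.1.2 = f.1.2 → e.1.1 < f.1.1 → e.2 ≤ f.2
  col_unprimed : ∀ e ∈ E, ∀ f ∈ E, e.1.2 = f.1.2 → e.2 = f.2 → Odd e.2 → e = f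
  row_primed : ∀ e ∈ E, ∀ f ∈ E, e.1.1 = f.1.1 → e.2 = f.2 → Even e.2 → e = f

theorem IsTableau.subset {E E' : Finset ((ℕ × ℕ) × ℕ)} (h : IsTableau E) (hE : E' ⊆ E) :
    IsTableau E' where
  row_weak e he f hf := h.row_weak e (hE he) f (hE hf)
  col_weak e he f hf := h.col_weak e (hE he) f (hE hf)
  col_unprimed e he f hf := h.col_unprimed e (hE he) f (hE hf)
  row_primed e he f hf := h.row_primed e (hE he) f (hE hf)

/-- The set-valued shifted tableaux of shape `λ` in which the pair (letter, content of the box) of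
every entry lies in `A`. -/
noncomputable def tableaux (A : Finset (ℕ × ℕ)) (lam : StrictPartition) :
    Finset (Finset ((ℕ × ℕ) × ℕ)) := by
  classical
  exact (lam.diagram ×ˢ A.image Prod.fst).powerset.filter fun E =>
    E.image Prod.fst = lam.diagram ∧ IsTableau E ∧ ∀ e ∈ E, (e.2, e.1.2 - e.1.1) ∈ A

theorem mem_tableaux {A : Finset (ℕ × ℕ)} {lam : StrictPartition}
    {E : Finset ((ℕ × ℕ) × ℕ)} : E ∈ tableaux A lam ↔
      E.image Prod.fst = lam.diagram ∧ IsTableau E ∧ ∀ e ∈ E, (e.2, e.1.2 - e.1.1) ∈ A := by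
  classical
  unfold tableaux
  rw [Finset.mem_filter, Finset.mem_powerset, and_iff_right_iff_imp]
  rintro ⟨h1, _, h3⟩ e he
  rw [Finset.mem_product, ← h1]
  exact ⟨Finset.mem_image_of_mem _ he, Finset.mem_image_of_mem Prod.fst (h3 e he)⟩

section TableauSum

variable {R : Type*} [CommRing R]

/-- The monomial `β^(|T| - |λ|) x^T`. -/
def tableauWeight (β : R) (x : ℕ → R) (lam : StrictPartition) (E : Finset ((ℕ × ℕ) × ℕ)) : R :=
  β ^ (E.card - lam.size) * ∏ e ∈ E, x (e.2 / 2)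

/-- The generating function of `tableaux A λ`. -/
noncomputable def tableauSum (β : R) (x : ℕ → R) (A : Finset (ℕ × ℕ)) (lam : StrictPartition) : R :=
  ∑ E ∈ tableaux A lam, tableauWeight β x lam E

theorem size_le_card {A : Finset (ℕ × ℕ)} {lam : StrictPartition} {E : Finset ((ℕ × ℕ) × ℕ)}
    (h : E ∈ tableaux A lam) : lam.size ≤ E.card := by
  rw [StrictPartition.size, ← (mem_tableaux.mp h).1]
  exact Finset.card_image_le

/-- A pair (letter, content) can be added to the pairs `A` if the letter is at least as large as
all others, and if an unprimed letter occurs in `A` only with smaller contents and a primed letter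
only with larger contents. -/
def Addable (k c : ℕ) (A : Finset (ℕ × ℕ)) : Prop :=
  ∀ p ∈ A, p.1 ≤ k ∧ (p.1 = k → (Odd k → p.2 < c) ∧ (Even k → c < p.2))

theorem Addable.notMem {k c : ℕ} {A : Finset (ℕ × ℕ)} (h : Addable k c A) : (k, c) ∉ A := by
  intro hm
  have := (h _ hm).2 rfl
  rcases Nat.even_or_odd k with h1 | h1
  · exact lt_irrefl _ (this.2 h1)
  · exact lt_irrefl _ (this.1 h1)

/-- The last letter added can only occur in the removable box of its content: a box to the right of
it or below it would contain a letter that is too small. -/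
theorem Addable.corner {k c : ℕ} {A : Finset (ℕ × ℕ)} (hA : Addable k c A)
    {lam : StrictPartition} {E : Finset ((ℕ × ℕ) × ℕ)} (hE : E ∈ tableaux (insert (k, c) A) lam)
    {i j : ℕ} (he : ((i, j), k) ∈ E) (hc : j - i = c) :
    j = i + c ∧ Removable c lam.sites ∧ lam.part i = c + 1 := by
  obtain ⟨h1, h2, h3⟩ := mem_tableaux.mp hE
  have hd : (i, j) ∈ lam.diagram := h1 ▸ Finset.mem_image_of_mem Prod.fst he
  have hij : i ≤ j := ((lam.mem_diagram _).mp hd).1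
  obtain rfl : j = i + c := by omega
  refine ⟨rfl, lam.removable_of_corner hd ?_ ?_⟩
  · intro hr
    rw [← h1] at hr
    obtain ⟨⟨⟨a, b⟩, l⟩, hf, hab⟩ := Finset.mem_image.mp hr
    simp only [Prod.mk.injEq] at hab
    obtain ⟨rfl, rfl⟩ := hab
    have hle := h2.row_weak _ he _ hf rfl (by simp)
    have hm := h3 _ hf
    simp only [Finset.mem_insert, Prod.mk.injEq] at hm
    rcases hm with hm | hm
    · omega
    · have := hA _ hm
      simp only at this hle
      have hk : l = k := by omega
      subst hk
      rcases Nat.even_or_odd l with h4 | h4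
      · have := h2.row_primed _ he _ hf rfl rfl h4
        simp at this
      · have := (this.2 rfl).1 h4
        omega
  · intro hr
    have hr' := ((lam.mem_diagram _).mp hr).1
    rw [← h1] at hr
    obtain ⟨⟨⟨a, b⟩, l⟩, hf, hab⟩ := Finset.mem_image.mp hr
    simp only [Prod.mk.injEq] at hab
    obtain ⟨rfl, rfl⟩ := hab
    have hle := h2.col_weak _ he _ hf rfl (by simp)
    have hm := h3 _ hf
    simp only [Finset.mem_insert, Prod.mk.injEq] at hm
    simp only at hr'
    rcases hm with hm | hm
    · omega
    · have := hA _ hm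
      simp only at this hle
      have hk : l = k := by omega
      subst hk
      rcases Nat.even_or_odd l with h4 | h4
      · have := (this.2 rfl).2 h4
        omega
      · have := h2.col_unprimed _ he _ hf rfl rfl h4
        simp at this

theorem Addable.isTableau_insert {k c : ℕ} {A : Finset (ℕ × ℕ)} (hA : Addable k c A)
    {lam : StrictPartition} {i : ℕ} (hi : lam.part i = c + 1) (hr : Removable c lam.sites)
    {E : Finset ((ℕ × ℕ) × ℕ)} (hE : IsTableau E) (hEA : ∀ e ∈ E, (e.2, e.1.2 - e.1.1) ∈ A)
    (hEl : ∀ e ∈ E, e.1 ∈ lam.diagram) : IsTableau (insert ((i, i + c), k) E) := by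
  have hbelow : ∀ e ∈ E, e.1.2 = i + c → ¬ i < e.1.1 := by
    rintro ⟨⟨a, b⟩, l⟩ he h1 h2
    simp only at h1 h2
    subst h1
    exact lam.below_notMem_diagram hi hr (lam.mem_diagram_above (hEl _ he) h2)
  have hright : ∀ e ∈ E, e.1.1 = i → ¬ i + c < e.1.2 := by
    rintro ⟨⟨a, b⟩, l⟩ he h1 h2
    simp only at h1 h2
    subst h1
    have := (lam.mem_diagram _).mp (hEl _ he)
    simp only at this
    omega
  have hdiag : ∀ e ∈ E, e.1.1 ≤ e.1.2 := fun e he => ((lam.mem_diagram _).mp (hEl _ he)).1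
  constructor
  · intro e he f hf h1 h2
    rcases Finset.mem_insert.mp he with rfl | he <;> rcases Finset.mem_insert.mp hf with rfl | hf
    · exact le_rfl
    · exact absurd h2 (hright f hf h1.symm)
    · exact (hA _ (hEA e he)).1
    · exact hE.row_weak e he f hf h1 h2
  · intro e he f hf h1 h2
    rcases Finset.mem_insert.mp he with rfl | he <;> rcases Finset.mem_insert.mp hf with rfl | hf
    · exact le_rfl
    · exact absurd h2 (hbelow f hf h1.symm)
    · exact (hA _ (hEA e he)).1
    · exact hE.col_weak e he f hf h1 h2
  · have key : ∀ e ∈ E, e.1.2 = i + c → e.2 = k → ¬ Odd k := by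
      intro e he h1 h2 h3
      have h4 := ((hA _ (hEA e he)).2 h2).1 h3
      have h5 := hbelow e he h1
      simp only at h4
      omega
    intro e he f hf h1 h2 h3
    rcases Finset.mem_insert.mp he with rfl | he <;> rcases Finset.mem_insert.mp hf with rfl | hf
    · rfl
    · exact absurd h3 (key f hf h1.symm h2.symm)
    · rw [h2] at h3
      exact absurd h3 (key e he h1 h2)
    · exact hE.col_unprimed e he f hf h1 h2 h3
  · have key : ∀ e ∈ E, e.1.1 = i → e.2 = k → ¬ Even k := by
      intro e he h1 h2 h3
      have h4 := ((hA _ (hEA e he)).2 h2).2 h3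
      have h5 := hright e he h1
      simp only at h4
      omega
    intro e he f hf h1 h2 h3
    rcases Finset.mem_insert.mp he with rfl | he <;> rcases Finset.mem_insert.mp hf with rfl | hf
    · rfl
    · exact absurd h3 (key f hf h1.symm h2.symm)
    · rw [h2] at h3
      exact absurd h3 (key e he h1 h2)
    · exact hE.row_primed e he f hf h1 h2 h3

/-- Allowing one more pair (letter, content) amounts to the action of one factor `h_c`: the new
letter can only occur in the removable box of content `c`, alone or together with other letters. -/
theorem tableauSum_insert (β : R) (x : ℕ → R) {k c : ℕ} {A : Finset (ℕ × ℕ)} (hA : Addable k c A)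
    (lam : StrictPartition) :
    tableauSum β x (insert (k, c) A) lam = tableauSum β x A lam + x (k / 2) *
      uOp β c (fun s => tableauSum β x A (StrictPartition.siteEquiv.symm s)) lam.sites := by
  classical
  set S := tableaux (insert (k, c) A) lam
  have hsplit := Finset.sum_filter_add_sum_filter_not S
    (fun E => ∃ e ∈ E, e.2 = k ∧ e.1.2 - e.1.1 = c) (tableauWeight β x lam)
  have hnot : S.filter (fun E => ¬ ∃ e ∈ E, e.2 = k ∧ e.1.2 - e.1.1 = c) = tableaux A lam := by
    ext E
    rw [Finset.mem_filter, mem_tableaux, mem_tableaux]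
    constructor
    · rintro ⟨⟨h1, h2, h3⟩, h4⟩
      refine ⟨h1, h2, fun e he => ?_⟩
      rcases Finset.mem_insert.mp (h3 e he) with h5 | h5
      · exact absurd ⟨e, he, (Prod.mk.inj h5).1, (Prod.mk.inj h5).2⟩ h4
      · exact h5
    · rintro ⟨h1, h2, h3⟩
      refine ⟨⟨h1, h2, fun e he => Finset.mem_insert_of_mem (h3 e he)⟩, ?_⟩
      rintro ⟨e, he, h4, h5⟩
      have := h3 e he
      rw [h4, h5] at this
      exact hA.notMem this
  rw [hnot] at hsplit
  rw [tableauSum, ← hsplit, add_comm]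
  congr 1
  rw [uOp_apply]
  split_ifs with hr
  · obtain ⟨i, mu, hi, hmu, hs⟩ := lam.exists_lower c hr
    have hmu' : StrictPartition.siteEquiv.symm (lower c lam.sites) = mu := by
      rw [← hs, ← StrictPartition.siteEquiv_apply, Equiv.symm_apply_apply]
    rw [hmu', ← StrictPartition.siteEquiv_apply, Equiv.symm_apply_apply]
    have hd := StrictPartition.diagram_of_part_update hi hmu
    have ha : (i, i + c) ∈ lam.diagram := by
      rw [StrictPartition.mem_diagram]
      simp only
      omega
    have hsize : lam.size = mu.size + 1 := by
      rw [StrictPartition.size, StrictPartition.size, hd, Finset.card_erase_add_one ha]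
    set e₀ : (ℕ × ℕ) × ℕ := ((i, i + c), k) with he₀
    have hcont : ∀ E : Finset ((ℕ × ℕ) × ℕ), (∀ e ∈ E, (e.2, e.1.2 - e.1.1) ∈ A) → e₀ ∉ E := by
      intro E hE he
      have := hE _ he
      rw [he₀] at this
      simp only [add_tsub_cancel_left] at this
      exact hA.notMem this
    -- without the letter `k` in the box `e₀.1`, a tableau has the shape `μ` or the shape `λ`,
    -- according to whether `k` was alone in this box
    have hdisj : Disjoint (tableaux A mu) (tableaux A lam) := by
      rw [Finset.disjoint_left]
      intro E h1 h2
      have h3 := (mem_tableaux.mp h1).1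
      rw [(mem_tableaux.mp h2).1, hd] at h3
      rw [h3] at ha
      exact Finset.notMem_erase _ _ ha
    have hbij : ∑ E ∈ S.filter (fun E => ∃ e ∈ E, e.2 = k ∧ e.1.2 - e.1.1 = c),
        tableauWeight β x lam E =
        ∑ E ∈ (tableaux A mu).disjUnion (tableaux A lam) hdisj,
          tableauWeight β x lam (insert e₀ E) := by
      have hmem : ∀ E ∈ S.filter (fun E => ∃ e ∈ E, e.2 = k ∧ e.1.2 - e.1.1 = c), e₀ ∈ E := by
        intro E hE
        obtain ⟨hE, ⟨⟨a, b⟩, l⟩, he, h1, h2⟩ := Finset.mem_filter.mp hE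
        simp only at h1 h2
        subst h1
        obtain ⟨h3, _, h4⟩ := hA.corner hE he h2
        have := lam.part_eq_imp_eq (hi.trans h4.symm) (by omega)
        rw [he₀, this, ← h3]
        exact he
      refine Finset.sum_bij' (fun E _ => E.erase e₀) (fun E _ => insert e₀ E) ?_ ?_ ?_ ?_ ?_
      · intro E hE
        have hm := hmem E hE
        obtain ⟨hE, -⟩ := Finset.mem_filter.mp hE
        obtain ⟨h1, h2, h3⟩ := mem_tableaux.mp hE
        have h4 : ∀ e ∈ E.erase e₀, (e.2, e.1.2 - e.1.1) ∈ A := by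
          rintro ⟨⟨a, b⟩, l⟩ he
          obtain ⟨h5, h6⟩ := Finset.mem_erase.mp he
          rcases Finset.mem_insert.mp (h3 _ h6) with h7 | h7
          · exfalso
            obtain ⟨h8, h9⟩ := Prod.mk.inj h7
            simp only at h8 h9
            subst h8
            obtain ⟨h10, _, h11⟩ := hA.corner hE h6 h9
            have := lam.part_eq_imp_eq (hi.trans h11.symm) (by omega)
            apply h5
            rw [he₀, this, ← h10]
          · exact h7
        have h5 : IsTableau (E.erase e₀) := h2.subset (Finset.erase_subset _ _)
        rw [Finset.mem_disjUnion, mem_tableaux, mem_tableaux]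
        by_cases h6 : (i, i + c) ∈ (E.erase e₀).image Prod.fst
        · right
          refine ⟨?_, h5, h4⟩
          rw [← h1]
          conv_rhs => rw [← Finset.insert_erase hm, Finset.image_insert]
          exact (Finset.insert_eq_of_mem h6).symm
        · left
          refine ⟨?_, h5, h4⟩
          rw [hd, ← h1]
          conv_rhs => rw [← Finset.insert_erase hm, Finset.image_insert]
          exact (Finset.erase_insert h6).symm
      · intro E hE
        have hE' : E.image Prod.fst ⊆ lam.diagram ∧
            insert (i, i + c) (E.image Prod.fst) = lam.diagram ∧ IsTableau E ∧ ∀ e ∈ E, (e.2, e.1.2 - e.1.1) ∈ A := by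
          rcases Finset.mem_disjUnion.mp hE with h | h
          · obtain ⟨h1, h2⟩ := mem_tableaux.mp h
            rw [h1, hd]
            exact ⟨Finset.erase_subset _ _, Finset.insert_erase ha, h2⟩
          · obtain ⟨h1, h2⟩ := mem_tableaux.mp h
            rw [h1]
            exact ⟨subset_rfl, Finset.insert_eq_of_mem ha, h2⟩
        obtain ⟨h0, h1, h2, h3⟩ := hE'
        rw [Finset.mem_filter, mem_tableaux]
        refine ⟨⟨by rw [Finset.image_insert, h1], hA.isTableau_insert hi hr h2 h3
          (fun e he => h0 (Finset.mem_image_of_mem _ he)), ?_⟩, e₀, Finset.mem_insert_self _ _, rfl,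
          by simp [he₀]⟩
        intro e he
        rcases Finset.mem_insert.mp he with rfl | he
        · simp [he₀]
        · exact Finset.mem_insert_of_mem (h3 e he)
      · intro E hE
        exact Finset.insert_erase (hmem E hE)
      · intro E hE
        refine Finset.erase_insert (hcont E ?_)
        rcases Finset.mem_disjUnion.mp hE with h | h
        · exact (mem_tableaux.mp h).2.2
        · exact (mem_tableaux.mp h).2.2
      · intro E hE
        rw [Finset.insert_erase (hmem E hE)]
    rw [hbij, Finset.sum_disjUnion, mul_add, tableauSum, tableauSum, Finset.mul_sum,
      Finset.mul_sum, Finset.mul_sum]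
    congr 1
    · refine Finset.sum_congr rfl fun E hE => ?_
      have h1 := hcont E (mem_tableaux.mp hE).2.2
      rw [tableauWeight, tableauWeight, Finset.card_insert_of_notMem h1, Finset.prod_insert h1,
        hsize, Nat.add_sub_add_right]
      ring
    · refine Finset.sum_congr rfl fun E hE => ?_
      have h1 := hcont E (mem_tableaux.mp hE).2.2
      have h2 := size_le_card hE
      rw [tableauWeight, tableauWeight, Finset.card_insert_of_notMem h1, Finset.prod_insert h1,
        Nat.sub_add_comm h2, pow_succ]
      ring
  · rw [mul_zero]
    refine Finset.sum_eq_zero fun E hE => ?_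
    exfalso
    obtain ⟨hE, ⟨⟨a, b⟩, l⟩, he, h1, h2⟩ := Finset.mem_filter.mp hE
    simp only at h1 h2
    subst h1
    exact hr (hA.corner hE he h2).2.1

end TableauSum

/-! ### Generating functions of tableaux as products of transfer operators -/

section Evolution

variable {R : Type*} [CommRing R]

/-- `tableauSum` as a function of the set of sites of the shape. -/
noncomputable def tableauFun (β : R) (x : ℕ → R) (A : Finset (ℕ × ℕ)) (s : Finset ℕ) : R :=
  tableauSum β x A (StrictPartition.siteEquiv.symm s)

theorem tableauFun_sites (β : R) (x : ℕ → R) (A : Finset (ℕ × ℕ)) (lam : StrictPartition) :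
    tableauFun β x A lam.sites = tableauSum β x A lam := by
  rw [tableauFun, ← StrictPartition.siteEquiv_apply, Equiv.symm_apply_apply]

theorem tableauFun_insert (β : R) (x : ℕ → R) {k c : ℕ} {A : Finset (ℕ × ℕ)}
    (hA : Addable k c A) :
    tableauFun β x (insert (k, c) A) = hOp (uOp β) c (x (k / 2)) (tableauFun β x A) := by
  funext s
  rw [tableauFun, tableauSum_insert β x hA, StrictPartition.sites_siteEquiv_symm]
  rfl

/-- The set of pairs `(k, c)` with `1 ≤ c ≤ N`. -/
def letterRange (k N : ℕ) : Finset (ℕ × ℕ) := (Finset.Icc 1 N).image fun c => (k, c)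

theorem mem_letterRange (k N : ℕ) (p : ℕ × ℕ) :
    p ∈ letterRange k N ↔ p.1 = k ∧ 1 ≤ p.2 ∧ p.2 ≤ N := by
  obtain ⟨a, b⟩ := p
  simp only [letterRange, Finset.mem_image, Finset.mem_Icc, Prod.mk.injEq]
  constructor
  · rintro ⟨c, hc, rfl, rfl⟩
    exact ⟨rfl, hc⟩
  · rintro ⟨rfl, hc⟩
    exact ⟨b, hc, rfl, rfl⟩

theorem tableauFun_union_even (β : R) (x : ℕ → R) (n N : ℕ) (A : Finset (ℕ × ℕ))
    (hA : ∀ p ∈ A, p.1 ≤ 2 * n ∧ (p.1 = 2 * n → N < p.2)) :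
    tableauFun β x (A ∪ letterRange (2 * n) N) =
      ascProd (uOp β) N (x n) (tableauFun β x A) := by
  induction N generalizing A with
  | zero =>
    have : letterRange (2 * n) 0 = ∅ := by
      ext p
      rw [mem_letterRange]
      simp
      omega
    rw [this, Finset.union_empty]
    rfl
  | succ N ih =>
    have hadd : Addable (2 * n) (N + 1) A := fun p hp =>
      ⟨(hA p hp).1, fun h => ⟨fun h' => absurd h' (by simp), fun _ => (hA p hp).2 h⟩⟩
    have hset : A ∪ letterRange (2 * n) (N + 1) =
        insert (2 * n, N + 1) A ∪ letterRange (2 * n) N := by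
      ext ⟨a, b⟩
      simp only [Finset.mem_union, Finset.mem_insert, mem_letterRange, Prod.mk.injEq]
      by_cases h : (a, b) ∈ A
      · simp [h]
      · simp only [h, false_or, or_false]
        omega
    rw [hset, ih, tableauFun_insert β x hadd, Nat.mul_div_cancel_left _ two_pos]
    · rfl
    · intro p hp
      rcases Finset.mem_insert.mp hp with rfl | hp
      · simp
      · exact ⟨(hA p hp).1, fun h => (Nat.lt_succ_self N).trans ((hA p hp).2 h)⟩

theorem tableauFun_union_odd (β : R) (x : ℕ → R) (n N : ℕ) (A : Finset (ℕ × ℕ))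
    (hA : ∀ p ∈ A, p.1 ≤ 2 * n + 1 ∧ (p.1 = 2 * n + 1 → p.2 = 0)) :
    tableauFun β x (A ∪ letterRange (2 * n + 1) N) =
      descProd (uOp β) N (x n) (tableauFun β x A) := by
  induction N with
  | zero =>
    have : letterRange (2 * n + 1) 0 = ∅ := by
      ext p
      rw [mem_letterRange]
      simp
      omega
    rw [this, Finset.union_empty]
    rfl
  | succ N ih =>
    have hadd : Addable (2 * n + 1) (N + 1) (A ∪ letterRange (2 * n + 1) N) := by
      intro p hp
      rcases Finset.mem_union.mp hp with hp | hp
      · refine ⟨(hA p hp).1, fun h => ⟨fun _ => ?_, fun h' => absurd h' (by simp)⟩⟩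
        rw [(hA p hp).2 h]
        omega
      · rw [mem_letterRange] at hp
        refine ⟨by omega, fun h => ⟨fun _ => by omega, fun h' => absurd h' (by simp)⟩⟩
    have hset : A ∪ letterRange (2 * n + 1) (N + 1) =
        insert (2 * n + 1, N + 1) (A ∪ letterRange (2 * n + 1) N) := by
      ext ⟨a, b⟩
      simp only [Finset.mem_union, Finset.mem_insert, mem_letterRange, Prod.mk.injEq]
      by_cases h : (a, b) ∈ A
      · simp [h]
      · simp only [h, false_or]
        omega
    have hdiv : (2 * n + 1) / 2 = n := by omega
    rw [hset, tableauFun_insert β x hadd, ih, hdiv]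
    rfl

/-- The pairs (letter, content) allowed in tableaux with `n` variables and contents at most `N`. -/
def pairsQ (N n : ℕ) : Finset (ℕ × ℕ) := Finset.range (2 * n) ×ˢ Finset.range (N + 1)

/-- The pairs of `pairsQ N n` other than those of a primed letter and the content `0`. -/
def pairsP (N n : ℕ) : Finset (ℕ × ℕ) := (pairsQ N n).filter fun p => p.2 = 0 → Odd p.1

theorem mem_pairsQ (N n : ℕ) (p : ℕ × ℕ) : p ∈ pairsQ N n ↔ p.1 < 2 * n ∧ p.2 ≤ N := by
  rw [pairsQ, Finset.mem_product, Finset.mem_range, Finset.mem_range, Nat.lt_succ_iff]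

theorem mem_pairsP (N n : ℕ) (p : ℕ × ℕ) :
    p ∈ pairsP N n ↔ (p.1 < 2 * n ∧ p.2 ≤ N) ∧ (p.2 = 0 → Odd p.1) := by
  rw [pairsP, Finset.mem_filter, mem_pairsQ]

theorem tableauFun_pairsQ_succ (β : R) (x : ℕ → R) (N n : ℕ) :
    tableauFun β x (pairsQ N (n + 1)) =
      transferQ (uOp β) N (x n) (tableauFun β x (pairsQ N n)) := by
  have hset : pairsQ N (n + 1) = insert (2 * n + 1, 0) (insert (2 * n, 0)
      (pairsQ N n ∪ letterRange (2 * n) N)) ∪ letterRange (2 * n + 1) N := by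
    ext ⟨a, b⟩
    simp only [Finset.mem_union, Finset.mem_insert, mem_letterRange, mem_pairsQ, Prod.mk.injEq]
    omega
  have hdiv : (2 * n + 1) / 2 = n := by omega
  rw [hset, tableauFun_union_odd, tableauFun_insert, tableauFun_insert, tableauFun_union_even,
    hdiv, Nat.mul_div_cancel_left _ two_pos]
  · rfl
  · intro p hp
    rw [mem_pairsQ] at hp
    omega
  · intro p hp
    simp only [Finset.mem_union, mem_pairsQ, mem_letterRange] at hp
    exact ⟨by omega, fun h => ⟨fun h' => absurd h' (by simp), fun _ => by omega⟩⟩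
  · intro p hp
    simp only [Finset.mem_insert, Finset.mem_union, mem_pairsQ, mem_letterRange] at hp
    have : p.1 ≤ 2 * n := by
      rcases hp with rfl | hp
      · exact le_rfl
      · omega
    exact ⟨by omega, fun h => by omega⟩
  · intro p hp
    obtain ⟨a, b⟩ := p
    simp only [Finset.mem_insert, Finset.mem_union, mem_pairsQ, mem_letterRange,
      Prod.mk.injEq] at hp
    simp only
    omega

theorem tableauFun_pairsP_succ (β : R) (x : ℕ → R) (N n : ℕ) :
    tableauFun β x (pairsP N (n + 1)) =
      transferP (uOp β) N (x n) (tableauFun β x (pairsP N n)) := by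
  have hset : pairsP N (n + 1) = insert (2 * n + 1, 0)
      (pairsP N n ∪ letterRange (2 * n) N) ∪ letterRange (2 * n + 1) N := by
    ext ⟨a, b⟩
    simp only [Finset.mem_union, Finset.mem_insert, mem_letterRange, mem_pairsP, Prod.mk.injEq,
      Nat.odd_iff]
    omega
  have hdiv : (2 * n + 1) / 2 = n := by omega
  rw [hset, tableauFun_union_odd, tableauFun_insert, tableauFun_union_even, hdiv]
  · rfl
  · intro p hp
    rw [mem_pairsP] at hp
    omega
  · intro p hp
    simp only [Finset.mem_union, mem_pairsP, mem_letterRange] at hp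
    exact ⟨by omega, fun h => by omega⟩
  · intro p hp
    obtain ⟨a, b⟩ := p
    simp only [Finset.mem_insert, Finset.mem_union, mem_pairsP, mem_letterRange,
      Prod.mk.injEq] at hp
    simp only
    omega

/-- The value of `T(x_{n-1}) ⋯ T(x_1) T(x_0)` at the indicator function of the empty partition. -/
def evolve (T : R → Module.End R (Finset ℕ → R)) (x : ℕ → R) : ℕ → Finset ℕ → R
  | 0 => Pi.single ∅ 1
  | n + 1 => T (x n) (evolve T x n)

theorem tableauFun_empty (β : R) (x : ℕ → R) : tableauFun β x ∅ = Pi.single ∅ 1 := by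
  funext s
  obtain ⟨lam, rfl⟩ := StrictPartition.sites_surjective s
  rw [tableauFun_sites, tableauSum]
  have h0 : ∀ E, E ∈ tableaux ∅ lam ↔ E = ∅ ∧ lam.diagram = ∅ := by
    intro E
    rw [mem_tableaux]
    constructor
    · rintro ⟨h1, _, h3⟩
      have : E = ∅ := Finset.eq_empty_of_forall_notMem fun e he => by simpa using h3 e he
      subst this
      exact ⟨rfl, by simpa using h1.symm⟩
    · rintro ⟨rfl, h⟩
      refine ⟨by simpa using h.symm, ⟨?_, ?_, ?_, ?_⟩, ?_⟩ <;> simp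
  have h1 : lam.diagram = ∅ ↔ lam.sites = ∅ := by
    constructor
    · intro h
      refine Finset.eq_empty_of_forall_notMem fun m hm => ?_
      obtain ⟨i, hi⟩ := (lam.mem_sites m).mp hm
      have : (i, i) ∈ lam.diagram := by
        rw [StrictPartition.mem_diagram]
        simp only
        omega
      rw [h] at this
      simp at this
    · intro h
      refine Finset.eq_empty_of_forall_notMem fun p hp => ?_
      rw [StrictPartition.mem_diagram] at hp
      have : lam.part p.1 - 1 ∈ lam.sites := (lam.mem_sites _).mpr ⟨p.1, by omega⟩
      rw [h] at this
      simp at this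
  by_cases h : lam.sites = ∅
  · have : tableaux ∅ lam = {∅} := by
      ext E
      rw [h0, Finset.mem_singleton, and_iff_left (h1.mpr h)]
    rw [this, h, Pi.single_eq_same, Finset.sum_singleton, tableauWeight]
    simp
  · have : tableaux ∅ lam = ∅ := by
      refine Finset.eq_empty_of_forall_notMem fun E hE => h (h1.mp ((h0 E).mp hE).2)
    rw [this, Pi.single_eq_of_ne h, Finset.sum_empty]

theorem tableauFun_pairsQ (β : R) (x : ℕ → R) (N n : ℕ) :
    tableauFun β x (pairsQ N n) = evolve (transferQ (uOp β) N) x n := by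
  induction n with
  | zero =>
    rw [show pairsQ N 0 = ∅ by simp [pairsQ], tableauFun_empty]
    rfl
  | succ n ih => rw [tableauFun_pairsQ_succ, ih, evolve]

theorem tableauFun_pairsP (β : R) (x : ℕ → R) (N n : ℕ) :
    tableauFun β x (pairsP N n) = evolve (transferP (uOp β) N) x n := by
  induction n with
  | zero =>
    rw [show pairsP N 0 = ∅ by simp [pairsP, pairsQ], tableauFun_empty]
    rfl
  | succ n ih => rw [tableauFun_pairsP_succ, ih, evolve]

end Evolution

/-! ### Coefficients of `GQ` and `GP` -/

namespace Filling

variable {lam : StrictPartition}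

/-- The set of pairs (box, letter) of a filling. -/
def graph (T : Filling lam) : Finset ((ℕ × ℕ) × ℕ) :=
  (Finset.univ.sigma T).image fun s => (s.1.1, s.2)

theorem mem_graph (T : Filling lam) (p : ℕ × ℕ) (k : ℕ) :
    (p, k) ∈ T.graph ↔ ∃ h : p ∈ lam.diagram, k ∈ T ⟨p, h⟩ := by
  simp only [graph, Finset.mem_image, Finset.mem_sigma, Finset.mem_univ, true_and, Sigma.exists,
    Subtype.exists, Prod.mk.injEq]
  constructor
  · rintro ⟨a, h, l, h1, rfl, rfl⟩
    exact ⟨h, h1⟩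
  · rintro ⟨h, h1⟩
    exact ⟨p, h, k, h1, rfl, rfl⟩

theorem prod_graph {M : Type*} [CommMonoid M] (T : Filling lam) (f : (ℕ × ℕ) × ℕ → M) :
    ∏ e ∈ T.graph, f e = ∏ a, ∏ k ∈ T a, f (a.1, k) := by
  rw [graph, Finset.prod_image, Finset.prod_sigma]
  rintro ⟨a, k⟩ _ ⟨b, l⟩ _ h
  obtain ⟨h1, h2⟩ := Prod.mk.inj h
  obtain rfl : a = b := Subtype.ext h1
  simp only at h2
  rw [h2]

theorem sum_graph {M : Type*} [AddCommMonoid M] (T : Filling lam) (f : (ℕ × ℕ) × ℕ → M) :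
    ∑ e ∈ T.graph, f e = ∑ a, ∑ k ∈ T a, f (a.1, k) :=
  prod_graph (M := Multiplicative M) T f

theorem card_graph (T : Filling lam) : T.graph.card = T.totalCard := by
  rw [Finset.card_eq_sum_ones, sum_graph, totalCard]
  simp

theorem weight_eq_sum_graph (T : Filling lam) :
    T.weight = ∑ e ∈ T.graph, Finsupp.single (e.2 / 2) 1 := by
  rw [sum_graph, weight]

theorem image_fst_graph {T : Filling lam} (h : ∀ a, (T a).Nonempty) :
    T.graph.image Prod.fst = lam.diagram := by
  ext p
  rw [Finset.mem_image]
  constructor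
  · rintro ⟨⟨q, k⟩, h1, rfl⟩
    exact ((T.mem_graph q k).mp h1).1
  · intro hp
    obtain ⟨k, hk⟩ := h ⟨p, hp⟩
    exact ⟨(p, k), (T.mem_graph p k).mpr ⟨hp, hk⟩, rfl⟩

theorem isTableau_graph {T : Filling lam} (h : T.IsSemistandard) : IsTableau T.graph := by
  constructor
  · rintro ⟨p, k⟩ he ⟨q, l⟩ hf h1 h2
    obtain ⟨hp, hk⟩ := (T.mem_graph p k).mp he
    obtain ⟨hq, hl⟩ := (T.mem_graph q l).mp hf
    exact h.row_weak ⟨p, hp⟩ ⟨q, hq⟩ h1 h2 k hk l hl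
  · rintro ⟨p, k⟩ he ⟨q, l⟩ hf h1 h2
    obtain ⟨hp, hk⟩ := (T.mem_graph p k).mp he
    obtain ⟨hq, hl⟩ := (T.mem_graph q l).mp hf
    exact h.col_weak ⟨p, hp⟩ ⟨q, hq⟩ h1 h2 k hk l hl
  · rintro ⟨p, k⟩ he ⟨q, l⟩ hf h1 h2 h3
    obtain ⟨hp, hk⟩ := (T.mem_graph p k).mp he
    obtain ⟨hq, hl⟩ := (T.mem_graph q l).mp hf
    simp only at h2 h3
    subst h2
    have := h.col_unprimed ⟨p, hp⟩ ⟨q, hq⟩ h1 k h3 hk hl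
    rw [Subtype.mk.injEq] at this
    rw [this]
  · rintro ⟨p, k⟩ he ⟨q, l⟩ hf h1 h2 h3
    obtain ⟨hp, hk⟩ := (T.mem_graph p k).mp he
    obtain ⟨hq, hl⟩ := (T.mem_graph q l).mp hf
    simp only at h2 h3
    subst h2
    have := h.row_primed ⟨p, hp⟩ ⟨q, hq⟩ h1 k h3 hk hl
    rw [Subtype.mk.injEq] at this
    rw [this]

/-- The filling with a given set of pairs (box, letter). -/
def ofGraph (lam : StrictPartition) (E : Finset ((ℕ × ℕ) × ℕ)) : Filling lam :=
  fun a => (E.filter fun e => e.1 = a.1).image Prod.snd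

theorem mem_ofGraph (E : Finset ((ℕ × ℕ) × ℕ)) (a : lam.diagram) (k : ℕ) :
    k ∈ ofGraph lam E a ↔ (a.1, k) ∈ E := by
  simp only [ofGraph, Finset.mem_image, Finset.mem_filter]
  constructor
  · rintro ⟨⟨p, l⟩, ⟨h1, h2⟩, rfl⟩
    simp only at h2
    rwa [← h2]
  · intro h
    exact ⟨(a.1, k), ⟨h, rfl⟩, rfl⟩

theorem ofGraph_graph (T : Filling lam) : ofGraph lam T.graph = T := by
  funext a
  ext k
  rw [mem_ofGraph, mem_graph]
  exact ⟨fun ⟨_, h⟩ => h, fun h => ⟨a.2, h⟩⟩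

theorem graph_ofGraph {E : Finset ((ℕ × ℕ) × ℕ)} (h : E.image Prod.fst = lam.diagram) :
    (ofGraph lam E).graph = E := by
  ext ⟨p, k⟩
  rw [mem_graph]
  constructor
  · rintro ⟨hp, hk⟩
    rwa [mem_ofGraph] at hk
  · intro he
    exact ⟨h ▸ Finset.mem_image_of_mem Prod.fst he, (mem_ofGraph _ _ _).mpr he⟩

theorem isSemistandard_ofGraph {E : Finset ((ℕ × ℕ) × ℕ)} (h : E.image Prod.fst = lam.diagram)
    (hE : IsTableau E) : (ofGraph lam E).IsSemistandard where
  nonempty a := by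
    have ha : a.1 ∈ E.image Prod.fst := h.symm ▸ a.2
    obtain ⟨⟨p, k⟩, h1, h2⟩ := Finset.mem_image.mp ha
    simp only at h2
    subst h2
    exact ⟨k, (mem_ofGraph _ _ _).mpr h1⟩
  row_weak a b h1 h2 k hk l hl :=
    hE.row_weak _ ((mem_ofGraph _ _ _).mp hk) _ ((mem_ofGraph _ _ _).mp hl) h1 h2
  col_weak a b h1 h2 k hk l hl :=
    hE.col_weak _ ((mem_ofGraph _ _ _).mp hk) _ ((mem_ofGraph _ _ _).mp hl) h1 h2
  col_unprimed a b h1 k hk ha hb := Subtype.ext (Prod.mk.inj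
    (hE.col_unprimed _ ((mem_ofGraph _ _ _).mp ha) _ ((mem_ofGraph _ _ _).mp hb) h1 rfl hk)).1
  row_primed a b h1 k hk ha hb := Subtype.ext (Prod.mk.inj
    (hE.row_primed _ ((mem_ofGraph _ _ _).mp ha) _ ((mem_ofGraph _ _ _).mp hb) h1 rfl hk)).1

theorem weight_ne_zero {T : Filling lam} {a : lam.diagram} {k : ℕ} (hk : k ∈ T a) :
    T.weight (k / 2) ≠ 0 := by
  unfold weight
  rw [Finsupp.finsetSum_apply]
  intro h0
  have h1 := (Finset.sum_eq_zero_iff.mp h0) a (Finset.mem_univ a)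
  rw [Finsupp.finsetSum_apply] at h1
  have h2 := (Finset.sum_eq_zero_iff.mp h1) k hk
  simp at h2

end Filling

/-- The exponent vector of `x^T` for a set of pairs (box, letter). -/
noncomputable def exponent (E : Finset ((ℕ × ℕ) × ℕ)) : ℕ →₀ ℕ :=
  ∑ e ∈ E, Finsupp.single (e.2 / 2) 1

theorem coeff_tableauWeight {σ : Type*} (v : ℕ → σ) (lam : StrictPartition)
    (E : Finset ((ℕ × ℕ) × ℕ)) (d : σ →₀ ℕ) [Decidable ((exponent E).mapDomain v = d)] :
    MvPowerSeries.coeff d (tableauWeight (MvPowerSeries.C (X : ℤ[X]))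
      (fun i => (MvPowerSeries.X (v i) : MvPowerSeries σ ℤ[X])) lam E) =
      if (exponent E).mapDomain v = d then X ^ (E.card - lam.size) else 0 := by
  classical
  have h : ∏ e ∈ E, (MvPowerSeries.X (v (e.2 / 2)) : MvPowerSeries σ ℤ[X]) =
      MvPowerSeries.monomial ((exponent E).mapDomain v) 1 := by
    induction E using Finset.induction_on with
    | empty => simp [exponent, MvPowerSeries.monomial_zero_eq_C]
    | insert e E he ih =>
      rw [Finset.prod_insert he, ih, MvPowerSeries.X, MvPowerSeries.monomial_mul_monomial]
      simp [exponent, Finset.sum_insert he, Finsupp.mapDomain_add]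
  rw [tableauWeight, h, ← map_pow, MvPowerSeries.coeff_C_mul, MvPowerSeries.coeff_monomial]
  simp only [mul_ite, mul_one, mul_zero, eq_comm]

theorem coeff_tableauSeries (lam : StrictPartition) (P : Filling lam → Prop) (A : Finset (ℕ × ℕ))
    (d : ℕ →₀ ℕ) (hP : ∀ T : Filling lam, T.weight = d → (P T ↔ T.IsSemistandard ∧
      ∀ a : lam.diagram, ∀ k ∈ T a, (k, a.1.2 - a.1.1) ∈ A)) :
    MvPowerSeries.coeff d (tableauSeries lam P) =
      MvPowerSeries.coeff d (tableauSum (MvPowerSeries.C (X : ℤ[X])) MvPowerSeries.X A lam) := by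
  classical
  have h1 : ∀ E ∈ tableaux A lam, MvPowerSeries.coeff d
      (tableauWeight (MvPowerSeries.C (X : ℤ[X])) MvPowerSeries.X lam E) =
      if exponent E = d then X ^ (E.card - lam.size) else 0 := by
    intro E _
    have := coeff_tableauWeight id lam E d
    rwa [Finsupp.mapDomain_id] at this
  rw [tableauSum, map_sum, Finset.sum_congr rfl h1, ← Finset.sum_filter]
  change ∑ T ∈ _, _ = _
  refine Finset.sum_bij' (fun T _ => T.graph) (fun E _ => Filling.ofGraph lam E) ?_ ?_ ?_ ?_ ?_
  · intro T hT
    rw [Set.Finite.mem_toFinset] at hT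
    obtain ⟨h2, h3⟩ := hT
    obtain ⟨h4, h5⟩ := (hP T h2).mp h3
    rw [Finset.mem_filter, mem_tableaux]
    refine ⟨⟨Filling.image_fst_graph h4.nonempty, Filling.isTableau_graph h4, ?_⟩, ?_⟩
    · rintro ⟨p, k⟩ he
      obtain ⟨hp, hk⟩ := (T.mem_graph p k).mp he
      exact h5 ⟨p, hp⟩ k hk
    · rw [← h2, Filling.weight_eq_sum_graph, exponent]
  · intro E hE
    rw [Finset.mem_filter, mem_tableaux] at hE
    obtain ⟨⟨h2, h3, h4⟩, h5⟩ := hE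
    rw [Set.Finite.mem_toFinset]
    have h6 : (Filling.ofGraph lam E).weight = d := by
      rw [← h5, Filling.weight_eq_sum_graph, Filling.graph_ofGraph h2, exponent]
    refine ⟨h6, (hP _ h6).mpr ⟨Filling.isSemistandard_ofGraph h2 h3, ?_⟩⟩
    intro a k hk
    exact h4 _ ((Filling.mem_ofGraph _ _ _).mp hk)
  · intro T _
    exact Filling.ofGraph_graph T
  · intro E hE
    rw [Finset.mem_filter, mem_tableaux] at hE
    exact Filling.graph_ofGraph hE.1.1
  · intro T _
    rw [Filling.card_graph]

theorem content_le {lam : StrictPartition} {N : ℕ} (hN : lam.part 0 ≤ N + 1) {p : ℕ × ℕ}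
    (hp : p ∈ lam.diagram) : p.2 - p.1 ≤ N := by
  rw [StrictPartition.mem_diagram] at hp
  have := lam.part_le_part (Nat.zero_le p.1)
  omega

theorem coeff_GQ (lam : StrictPartition) {N n : ℕ} (hN : lam.part 0 ≤ N + 1) {d : ℕ →₀ ℕ}
    (hd : ∀ i, n ≤ i → d i = 0) : MvPowerSeries.coeff d (GQ lam) =
      MvPowerSeries.coeff d
        (tableauSum (MvPowerSeries.C (X : ℤ[X])) MvPowerSeries.X (pairsQ N n) lam) := by
  refine coeff_tableauSeries lam _ _ d fun T hT => (and_iff_left ?_).symm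
  intro a k hk
  have h1 := Filling.weight_ne_zero hk
  rw [hT] at h1
  have h2 : k / 2 < n := by
    by_contra h
    exact h1 (hd _ (not_lt.mp h))
  rw [mem_pairsQ]
  exact ⟨by simp only; omega, content_le hN a.2⟩

theorem coeff_GP (lam : StrictPartition) {N n : ℕ} (hN : lam.part 0 ≤ N + 1) {d : ℕ →₀ ℕ}
    (hd : ∀ i, n ≤ i → d i = 0) : MvPowerSeries.coeff d (GP lam) =
      MvPowerSeries.coeff d
        (tableauSum (MvPowerSeries.C (X : ℤ[X])) MvPowerSeries.X (pairsP N n) lam) := by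
  refine coeff_tableauSeries lam _ _ d fun T hT => and_congr_right fun _ => ?_
  have hle : ∀ a : lam.diagram, a.1.1 ≤ a.1.2 := fun a => ((lam.mem_diagram _).mp a.2).1
  constructor
  · intro h a k hk
    have h1 := Filling.weight_ne_zero hk
    rw [hT] at h1
    have h2 : k / 2 < n := by
      by_contra h
      exact h1 (hd _ (not_lt.mp h))
    rw [mem_pairsP]
    refine ⟨⟨by simp only; omega, content_le hN a.2⟩, fun h3 => h a ?_ k hk⟩
    have := hle a
    simp only at h3
    omega
  · intro h a ha k hk
    have := ((mem_pairsP _ _ _).mp (h a k hk)).2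
    simp only at this
    exact this (by omega)

/-! ### An operator intertwining the two transfer operators -/

section Intertwiner

variable {R : Type*} [CommRing R]

/-- The set of sites after all parts are increased by one. -/
def shift (s : Finset ℕ) : Finset ℕ := s.image (· + 1)

theorem succ_mem_shift (m : ℕ) (s : Finset ℕ) : m + 1 ∈ shift s ↔ m ∈ s := by simp [shift]

theorem zero_notMem_shift (s : Finset ℕ) : 0 ∉ shift s := by simp [shift]

/-- Pullback of functions along `shift`. -/
def unshift : Module.End R (Finset ℕ → R) where
  toFun f s := f (shift s)
  map_add' _ _ := rfl
  map_smul' _ _ := rfl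

/-- Multiplication by `(-β)^ℓ`. -/
def scale (β : R) : Module.End R (Finset ℕ → R) where
  toFun f s := (-β) ^ s.card * f s
  map_add' f g := by
    funext s
    simp only [Pi.add_apply]
    ring
  map_smul' r f := by
    funext s
    simp only [Pi.smul_apply, smul_eq_mul, RingHom.id_apply]
    ring

theorem lower_succ_shift (c : ℕ) (s : Finset ℕ) :
    lower (c + 2) (shift s) = shift (lower (c + 1) s) := by
  ext m
  cases m with
  | zero => simp [mem_lower_succ, zero_notMem_shift]
  | succ m => simp [mem_lower_succ, succ_mem_shift]

theorem removable_succ_shift (c : ℕ) (s : Finset ℕ) :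
    Removable (c + 2) (shift s) ↔ Removable (c + 1) s := by
  rw [removable_succ, removable_succ, succ_mem_shift, succ_mem_shift]

theorem unshift_mul_uOp (β : R) (c : ℕ) :
    unshift * uOp β (c + 2) = uOp β (c + 1) * unshift := by
  ext1 f
  funext s
  change uOp β (c + 2) f (shift s) = uOp β (c + 1) (unshift f) s
  simp only [uOp_apply, removable_succ_shift, lower_succ_shift]
  rfl

theorem unshift_mul_hOp (β : R) (c : ℕ) (x : R) :
    unshift * hOp (uOp β) (c + 2) x = hOp (uOp β) (c + 1) x * unshift := by
  rw [hOp, hOp, mul_add, add_mul, mul_smul_comm, unshift_mul_uOp, smul_mul_assoc, mul_one, one_mul]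

theorem card_lower_succ {c : ℕ} {s : Finset ℕ} (h : Removable (c + 1) s) :
    (lower (c + 1) s).card = s.card := by
  rw [lower, Finset.card_insert_of_notMem, Finset.card_erase_add_one h.1]
  intro h1
  exact h.2 (Finset.mem_of_mem_erase h1)

theorem scale_mul_uOp (β : R) (c : ℕ) :
    scale β * uOp β (c + 1) = uOp β (c + 1) * scale β := by
  ext1 f
  funext s
  change (-β) ^ s.card * uOp β (c + 1) f s = uOp β (c + 1) (scale β f) s
  simp only [uOp_apply]
  split_ifs with h
  · change _ = (-β) ^ (lower (c + 1) s).card * _ + β * ((-β) ^ s.card * f s)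
    rw [card_lower_succ h]
    ring
  · ring

theorem scale_mul_hOp (β : R) (c : ℕ) (x : R) :
    scale β * hOp (uOp β) (c + 1) x = hOp (uOp β) (c + 1) x * scale β := by
  rw [hOp, mul_add, add_mul, mul_smul_comm, scale_mul_uOp, smul_mul_assoc, mul_one, one_mul]

theorem scale_mul_descProd (β : R) (N : ℕ) (x : R) :
    scale β * descProd (uOp β) N x = descProd (uOp β) N x * scale β := by
  induction N with
  | zero => simp [descProd]
  | succ N ih => rw [descProd, ← mul_assoc, scale_mul_hOp, mul_assoc, ih, mul_assoc]

theorem scale_mul_ascProd (β : R) (N : ℕ) (x : R) :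
    scale β * ascProd (uOp β) N x = ascProd (uOp β) N x * scale β := by
  induction N with
  | zero => simp [ascProd]
  | succ N ih => rw [ascProd, ← mul_assoc, ih, mul_assoc, scale_mul_hOp, mul_assoc]

theorem unshift_mul_descProd (β : R) (N : ℕ) (x : R) :
    unshift * descProd (uOp β) (N + 1) x = descProd (uOp β) N x * unshift * hOp (uOp β) 1 x := by
  induction N with
  | zero => simp [descProd]
  | succ N ih =>
    rw [descProd, ← mul_assoc, unshift_mul_hOp, mul_assoc, ih, descProd]
    simp only [mul_assoc]

/-- If `x'` is the inverse of `x`, then the factor `h_1(x')` removes the first factor of the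
ascending product, and the others are shifted by one. -/
theorem unshift_mul_ascProd (β : R) (N : ℕ) {x x' : R} (h : kadd β x' x = 0) :
    unshift * (hOp (uOp β) 1 x' * ascProd (uOp β) (N + 1) x) = ascProd (uOp β) N x * unshift := by
  induction N with
  | zero =>
    simp only [ascProd, one_mul, zero_add]
    rw [(heckeRelations_uOp β).hOp_mul_of_kadd_eq_zero 1 h, mul_one]
  | succ N ih =>
    rw [ascProd, ← mul_assoc, ← mul_assoc, mul_assoc unshift, ih, mul_assoc, unshift_mul_hOp,
      ascProd, mul_assoc]

/-- After removal of its first factor, the ascending product at `z` only involves `h_2, h_3, …`,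
which commute with `h_0`. -/
theorem hOp_zero_comm_ascProd (β : R) (N : ℕ) (x : R) {z : R} (h : kadd β z z = 0) :
    hOp (uOp β) 0 x * (hOp (uOp β) 1 z * ascProd (uOp β) (N + 1) z) =
      hOp (uOp β) 1 z * ascProd (uOp β) (N + 1) z * hOp (uOp β) 0 x := by
  induction N with
  | zero =>
    simp only [ascProd, one_mul, zero_add]
    rw [(heckeRelations_uOp β).hOp_mul_of_kadd_eq_zero 1 h, mul_one, one_mul]
  | succ N ih =>
    have h1 := (heckeRelations_uOp β).hOp_comm (i := 0) (j := N + 2) (by omega) x z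
    calc _ = (hOp (uOp β) 0 x * (hOp (uOp β) 1 z * ascProd (uOp β) (N + 1) z)) *
          hOp (uOp β) (N + 2) z := by rw [ascProd]; simp only [mul_assoc]
      _ = _ := by
        rw [ih, mul_assoc, h1]
        simp only [ascProd, mul_assoc]

theorem hOp_apply (β : R) (c : ℕ) (x : R) (f : Finset ℕ → R) (s : Finset ℕ) :
    hOp (uOp β) c x f s = f s + x * if Removable c s then f (lower c s) + β * f s else 0 := rfl

/-- The local form of the intertwining relation, at the two sites next to the boundary.  It
depends on `z = -2/β` being the nontrivial solution of `z ⊕ z = 0`. -/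
theorem intertwine_boundary (β : R) {x x' z : R} (hx : kadd β x x' = 0) (hz : β * z + 2 = 0) :
    scale β * unshift * hOp (uOp β) 1 (kadd β x z) * hOp (uOp β) 0 x =
      hOp (uOp β) 0 x * hOp (uOp β) 0 x * (scale β * unshift * hOp (uOp β) 1 (kadd β x' z)) := by
  rw [(heckeRelations_uOp β).hOp_mul]
  ext1 f
  funext s
  have hl : ∀ g : Finset ℕ → R, ∀ t,
      (scale β * unshift : Module.End R (Finset ℕ → R)) g t = (-β) ^ t.card * g (shift t) :=
    fun _ _ => rfl
  simp only [Module.End.mul_apply] at hl ⊢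
  rw [hl, hOp_apply, hOp_apply β 0 (kadd β x x), hl]
  have r0 : ∀ t : Finset ℕ, ¬ Removable 0 (shift t) := fun t => zero_notMem_shift t
  have r1 : ∀ t : Finset ℕ, Removable 1 (shift t) ↔ 0 ∈ t := fun t => by
    rw [removable_succ, succ_mem_shift]
    exact and_iff_left (zero_notMem_shift t)
  have e0 : 0 ∉ lower 0 s := by simp [lower]
  by_cases h : 0 ∈ s
  · have e1 : lower 0 (lower 1 (shift s)) = shift (lower 0 s) := by
      ext m
      cases m with
      | zero => simp [mem_lower_zero, zero_notMem_shift]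
      | succ m =>
        rw [mem_lower_zero, mem_lower_succ, succ_mem_shift, succ_mem_shift, mem_lower_zero]
        simp
    have e2 : Removable 0 (lower 1 (shift s)) := by
      rw [removable_zero, mem_lower_succ]
      exact Or.inl rfl
    have e3 : s.card = (lower 0 s).card + 1 := (Finset.card_erase_add_one h).symm
    simp only [hl, hOp_apply, r0, r1, e0, e1, e2, h, removable_zero, if_true, if_false]
    rw [e3]
    generalize (lower 0 s).card = c
    unfold kadd at *
    linear_combination (-β) ^ c * (-β * (-(1 + β * x) * (1 + β * z) * β * f (shift s) * hx +
      f (lower 1 (shift s)) * ((1 + β * x) * x * hz - (1 + β * x) * (1 + β * z) * hx)) -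
      f (shift (lower 0 s)) * x * (1 + β * x) * hz)
  · simp only [hOp_apply, r0, r1, h, removable_zero, if_false, mul_zero, add_zero]

/-- The operator carrying the functions `GP` to the functions `GQ`, when `z = -2/β`. -/
def intertwiner (β z : R) (N : ℕ) : Module.End R (Finset ℕ → R) :=
  scale β * unshift * ascProd (uOp β) (N + 1) z

theorem kadd_assoc (β x y z : R) : kadd β (kadd β x y) z = kadd β x (kadd β y z) := by
  unfold kadd; ring

theorem zero_kadd (β x : R) : kadd β 0 x = x := by
  unfold kadd; ring

theorem kadd_zero (β x : R) : kadd β x 0 = x := by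
  unfold kadd; ring

/-- The operator `h_1(z) h_2(z) ⋯` commutes with both factors of the transfer operator away from the
boundary, so that the relation reduces to `intertwine_boundary`. -/
theorem intertwiner_mul_transferP (β : R) (N : ℕ) {x x' z : R} (hx : kadd β x x' = 0)
    (hz : β * z + 2 = 0) :
    intertwiner β z N * transferP (uOp β) (N + 1) x =
      transferQ (uOp β) N x * intertwiner β z N := by
  have H := heckeRelations_uOp β
  have hx' : kadd β x' x = 0 := by rw [HeckeRelations.kadd_comm]; exact hx
  have hzz : kadd β z z = 0 := by
    unfold kadd
    linear_combination z * hz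
  have hB : ascProd (uOp β) (N + 1) z * ascProd (uOp β) (N + 1) x =
      ascProd (uOp β) (N + 1) x * ascProd (uOp β) (N + 1) z := by
    have := H.ascProd_comm (N + 1) x (kadd β x' z)
    rw [← kadd_assoc, hx, zero_kadd] at this
    exact this.symm
  have hB' : ascProd (uOp β) (N + 1) z * ascProd (uOp β) (N + 1) x' =
      ascProd (uOp β) (N + 1) x' * ascProd (uOp β) (N + 1) z := by
    have := H.ascProd_comm (N + 1) x' (kadd β x z)
    rw [← kadd_assoc, hx', zero_kadd] at this
    exact this.symm
  have hA : ascProd (uOp β) (N + 1) z * descProd (uOp β) (N + 1) x =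
      descProd (uOp β) (N + 1) x * ascProd (uOp β) (N + 1) z := by
    have h1 := H.descProd_mul_ascProd (N + 1) hx
    have h2 := H.ascProd_mul_descProd (N + 1) hx'
    calc _ = (descProd (uOp β) (N + 1) x * ascProd (uOp β) (N + 1) x') *
          (ascProd (uOp β) (N + 1) z * descProd (uOp β) (N + 1) x) := by rw [h1, one_mul]
      _ = descProd (uOp β) (N + 1) x * (ascProd (uOp β) (N + 1) x' * ascProd (uOp β) (N + 1) z) *
          descProd (uOp β) (N + 1) x := by simp only [mul_assoc]
      _ = descProd (uOp β) (N + 1) x * ascProd (uOp β) (N + 1) z *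
          (ascProd (uOp β) (N + 1) x' * descProd (uOp β) (N + 1) x) := by
          rw [← hB']; simp only [mul_assoc]
      _ = _ := by rw [h2, mul_one]
  have h11 := H.hOp_mul_of_kadd_eq_zero 1 hzz
  have h0 : ascProd (uOp β) (N + 1) z * hOp (uOp β) 0 x =
      hOp (uOp β) 1 z * hOp (uOp β) 0 x * (hOp (uOp β) 1 z * ascProd (uOp β) (N + 1) z) := by
    rw [mul_assoc, hOp_zero_comm_ascProd β N x hzz]
    simp only [← mul_assoc]
    rw [h11, one_mul]
  have hxz : hOp (uOp β) 1 x * hOp (uOp β) 1 z = hOp (uOp β) 1 (kadd β x z) := H.hOp_mul _ _ _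
  have hx'z : hOp (uOp β) 1 (kadd β x' z) * hOp (uOp β) 1 z = hOp (uOp β) 1 x' := by
    rw [H.hOp_mul, kadd_assoc, hzz, kadd_zero]
  have hloc := intertwine_boundary β hx hz
  have hS := unshift_mul_ascProd β N hx'
  have hD := unshift_mul_descProd β N x
  have hLD := scale_mul_descProd β N x
  have hLA := scale_mul_ascProd β N x
  unfold intertwiner transferP transferQ
  generalize ascProd (uOp β) (N + 1) z = Bz at *
  generalize ascProd (uOp β) (N + 1) x = Bx at *
  generalize descProd (uOp β) (N + 1) x = Ax at *
  generalize descProd (uOp β) N x = A at *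
  generalize ascProd (uOp β) N x = B at *
  generalize hOp (uOp β) 1 (kadd β x' z) = w' at *
  generalize hOp (uOp β) 1 (kadd β x z) = w at *
  generalize hOp (uOp β) 1 x = hx1 at *
  generalize hOp (uOp β) 1 x' = hx1' at *
  generalize hOp (uOp β) 1 z = hz1 at *
  generalize hOp (uOp β) 0 x = h at *
  calc scale β * unshift * Bz * (Ax * h * Bx)
      = scale β * unshift * (Bz * Ax) * h * Bx := by simp only [mul_assoc]
    _ = scale β * (unshift * Ax) * (Bz * h) * Bx := by rw [hA]; simp only [mul_assoc]
    _ = (scale β * A) * unshift * (hx1 * hz1) * h * hz1 * (Bz * Bx) := by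
        rw [hD, h0]; simp only [mul_assoc]
    _ = A * (scale β * unshift * w * h) * hz1 * (Bz * Bx) := by
        rw [hLD, hxz]; simp only [mul_assoc]
    _ = A * h * h * scale β * unshift * (w' * hz1) * (Bz * Bx) := by
        rw [hloc]; simp only [mul_assoc]
    _ = A * h * h * scale β * (unshift * (hx1' * Bx)) * Bz := by
        rw [hx'z, hB]; simp only [mul_assoc]
    _ = A * h * h * (scale β * B) * unshift * Bz := by rw [hS]; simp only [mul_assoc]
    _ = _ := by rw [hLA]; simp only [mul_assoc]

end Intertwiner

/-! ### Matrix entries of the intertwiner -/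

namespace StrictPartition

/-- `μ` arises from `λ` by increasing some of the (nonzero) parts by one. -/
def IsUp (lam mu : StrictPartition) : Prop :=
  ∀ i, mu.part i = lam.part i ∨ (mu.part i = lam.part i + 1 ∧ 0 < lam.part i)

theorem isUp_iff (lam mu : StrictPartition) : IsUp lam mu ↔
    lam.Sub mu ∧ lam.length = mu.length ∧ IsVerticalStrip mu lam := by
  have hlen : lam.length = mu.length ↔ ∀ i, 0 < lam.part i ↔ 0 < mu.part i := by
    simp only [part_pos_iff]
    constructor
    · intro h i
      rw [h]
    · intro h
      have h1 := h lam.length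
      have h2 := h mu.length
      omega
  constructor
  · intro h
    refine ⟨fun i => ?_, hlen.mpr fun i => ?_, ?_⟩
    · rcases h i with h1 | h1 <;> omega
    · rcases h i with h1 | h1 <;> omega
    · rintro ⟨a, b⟩ hp ⟨a', b'⟩ hq hpq
      simp only [skew, Finset.mem_sdiff, mem_diagram] at hp hq hpq
      subst hpq
      rcases h a with h1 | h1
      · omega
      · have : b = b' := by omega
        rw [this]
  · rintro ⟨h1, h2, h3⟩ i
    have h4 := hlen.mp h2 i
    have h5 := h1 i
    by_contra h6
    have key := h3 (i, i + lam.part i) (by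
      simp only [skew, Finset.mem_sdiff, mem_diagram]; omega) (i, i + lam.part i + 1) (by
      simp only [skew, Finset.mem_sdiff, mem_diagram]; omega) rfl
    simp at key

theorem mem_verticalStrips (lam mu : StrictPartition) :
    mu ∈ lam.verticalStrips ↔ IsUp mu lam := by
  rw [isUp_iff, verticalStrips, Set.Finite.mem_toFinset]
  rfl

theorem finite_isUp (lam : StrictPartition) : {mu : StrictPartition | IsUp lam mu}.Finite := by
  apply Set.Finite.of_finite_image (f := sites) _ sites_injective.injOn
  apply (Finset.finite_toSet (Finset.range (lam.part 0 + 1)).powerset).subset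
  rintro _ ⟨mu, hmu, rfl⟩
  simp only [Finset.coe_powerset, Set.mem_preimage, Set.mem_powerset_iff, Finset.coe_subset]
  intro m hm
  obtain ⟨i, hi⟩ := (mu.mem_sites m).mp hm
  have h1 := mu.part_le_part (Nat.zero_le i)
  rw [Finset.mem_range]
  rcases hmu 0 with h2 | h2 <;> omega

/-- The finite set of strict partitions `μ ⊇ λ` of the same length such that `μ/λ` is a vertical
strip. -/
noncomputable def ups (lam : StrictPartition) : Finset StrictPartition := lam.finite_isUp.toFinset

theorem mem_ups (lam mu : StrictPartition) : mu ∈ lam.ups ↔ IsUp lam mu := by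
  rw [ups, Set.Finite.mem_toFinset]
  rfl

/-- The rows in which `μ` has one more box than `λ`. -/
def hops (lam mu : StrictPartition) : Finset ℕ :=
  (Finset.range lam.length).filter fun i => mu.part i = lam.part i + 1

theorem mem_hops {lam mu : StrictPartition} (h : IsUp lam mu) (i : ℕ) :
    i ∈ hops lam mu ↔ mu.part i = lam.part i + 1 := by
  rw [hops, Finset.mem_filter, Finset.mem_range, ← part_pos_iff, and_iff_right_iff_imp]
  intro h1
  rcases h i with h2 | h2 <;> omega

theorem skew_eq_image {lam mu : StrictPartition} (h : IsUp lam mu) :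
    skew mu lam = (hops lam mu).image fun i => (i, i + lam.part i) := by
  ext ⟨a, b⟩
  rw [Finset.mem_image, skew, Finset.mem_sdiff, mem_diagram, mem_diagram]
  simp only [mem_hops h, Prod.mk.injEq]
  constructor
  · intro h1
    rcases h a with h2 | h2
    · omega
    · exact ⟨a, by omega, rfl, by omega⟩
  · rintro ⟨i, h1, rfl, rfl⟩
    omega

theorem card_skew {lam mu : StrictPartition} (h : IsUp lam mu) :
    (skew mu lam).card = (hops lam mu).card := by
  rw [skew_eq_image h, Finset.card_image_of_injective]
  intro i j hij
  exact (Prod.mk.inj hij).1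

theorem cols_eq {lam mu : StrictPartition} (h : IsUp lam mu) :
    cols mu lam = ((hops lam mu).image fun i => i + lam.part i).card := by
  rw [cols, skew_eq_image h, Finset.image_image]
  rfl

theorem card_skew_le_length {lam mu : StrictPartition} (h : IsUp lam mu) :
    (skew mu lam).card ≤ lam.length := by
  rw [card_skew h, hops]
  exact (Finset.card_filter_le _ _).trans (by simp)

/-- The strict partition with a new largest part `p` (and `λ` itself if `p ≤ λ_1`). -/
def cons (p : ℕ) (lam : StrictPartition) : StrictPartition :=
  if h : lam.part 0 < p then
    ⟨p :: lam.parts, List.pairwise_cons.mpr ⟨fun a ha => by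
      obtain ⟨_, i, rfl⟩ := (lam.mem_parts_iff a).mp ha
      exact (lam.part_le_part (Nat.zero_le i)).trans_lt h, lam.decreasing⟩,
     fun a ha => by
      rcases List.mem_cons.mp ha with rfl | ha
      · omega
      · exact lam.positive a ha⟩
  else lam

theorem parts_cons {p : ℕ} {lam : StrictPartition} (h : lam.part 0 < p) :
    (cons p lam).parts = p :: lam.parts := by rw [cons, dif_pos h]

theorem part_cons_zero {p : ℕ} {lam : StrictPartition} (h : lam.part 0 < p) :
    (cons p lam).part 0 = p := by rw [part, parts_cons h]; rfl

theorem part_cons_succ {p : ℕ} {lam : StrictPartition} (h : lam.part 0 < p) (i : ℕ) :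
    (cons p lam).part (i + 1) = lam.part i := by rw [part, parts_cons h]; rfl

theorem length_cons {p : ℕ} {lam : StrictPartition} (h : lam.part 0 < p) :
    (cons p lam).length = lam.length + 1 := by rw [length, parts_cons h]; rfl

theorem sites_cons {p : ℕ} {lam : StrictPartition} (h : lam.part 0 < p + 1) :
    (cons (p + 1) lam).sites = insert p lam.sites := by
  ext m
  rw [mem_sites_iff_mem_parts, parts_cons h, Finset.mem_insert, mem_sites_iff_mem_parts,
    List.mem_cons, Nat.add_right_cancel_iff]

theorem exists_eq_cons (lam : StrictPartition) (h : lam.parts ≠ []) :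
    ∃ (p : ℕ) (mu : StrictPartition), mu.part 0 < p ∧ lam = cons p mu := by
  obtain ⟨l, h1, h2⟩ := lam
  cases l with
  | nil => exact absurd rfl h
  | cons p l =>
    have h3 := List.pairwise_cons.mp h1
    refine ⟨p, ⟨l, h3.2, fun a ha => h2 a (List.mem_cons_of_mem _ ha)⟩, ?_, ?_⟩
    · cases l with
      | nil => exact h2 p (by simp)
      | cons q l => exact h3.1 q (by simp)
    · rw [cons, dif_pos]
      cases l with
      | nil => exact h2 p (by simp)
      | cons q l => exact h3.1 q (by simp)

theorem isUp_cons {p q : ℕ} {lam mu : StrictPartition} (hl : lam.part 0 < p)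
    (hm : mu.part 0 < q) : IsUp (cons p lam) (cons q mu) ↔ (q = p ∨ q = p + 1) ∧ IsUp lam mu := by
  constructor
  · intro h
    refine ⟨?_, fun i => ?_⟩
    · have := h 0
      rw [part_cons_zero hl, part_cons_zero hm] at this
      omega
    · have := h (i + 1)
      rwa [part_cons_succ hl, part_cons_succ hm] at this
  · rintro ⟨h1, h2⟩ i
    cases i with
    | zero =>
      rw [part_cons_zero hl, part_cons_zero hm]
      omega
    | succ i =>
      rw [part_cons_succ hl, part_cons_succ hm]
      exact h2 i

theorem hops_cons {p q : ℕ} {lam mu : StrictPartition} (hl : lam.part 0 < p)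
    (hm : mu.part 0 < q) (hq : q = p ∨ q = p + 1) (h : IsUp lam mu) :
    hops (cons p lam) (cons q mu) = if q = p then (hops lam mu).image (· + 1)
      else insert 0 ((hops lam mu).image (· + 1)) := by
  have h' : IsUp (cons p lam) (cons q mu) := (isUp_cons hl hm).mpr ⟨hq, h⟩
  ext i
  rw [mem_hops h']
  cases i with
  | zero =>
    rw [part_cons_zero hl, part_cons_zero hm]
    split_ifs with h1
    · simp [h1]
    · simp; omega
  | succ i =>
    rw [part_cons_succ hl, part_cons_succ hm, ← mem_hops h]
    split_ifs with h1 <;> simp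

theorem card_skew_cons {p q : ℕ} {lam mu : StrictPartition} (hl : lam.part 0 < p)
    (hm : mu.part 0 < q) (hq : q = p ∨ q = p + 1) (h : IsUp lam mu) :
    (skew (cons q mu) (cons p lam)).card = (skew mu lam).card + if q = p then 0 else 1 := by
  have h' : IsUp (cons p lam) (cons q mu) := (isUp_cons hl hm).mpr ⟨hq, h⟩
  have hinj : Function.Injective (fun i : ℕ => i + 1) := fun a b h => by simpa using h
  rw [card_skew h', card_skew h, hops_cons hl hm hq h]
  split_ifs
  · rw [Finset.card_image_of_injective _ hinj, add_zero]
  · rw [Finset.card_insert_of_notMem (by simp), Finset.card_image_of_injective _ hinj]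

theorem cols_cons {p q : ℕ} {lam mu : StrictPartition} (hl : lam.part 0 < p)
    (hm : mu.part 0 < q) (hq : q = p ∨ q = p + 1) (h : IsUp lam mu) :
    cols (cons q mu) (cons p lam) = cols mu lam + if q = p ∨ mu.part 0 = p then 0 else 1 := by
  have h' : IsUp (cons p lam) (cons q mu) := (isUp_cons hl hm).mpr ⟨hq, h⟩
  have hinj : Function.Injective (fun i : ℕ => i + 1) := fun a b h => by simpa using h
  have himg : ((hops lam mu).image (· + 1)).image (fun i => i + (cons p lam).part i) =
      ((hops lam mu).image fun i => i + lam.part i).image (· + 1) := by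
    rw [Finset.image_image, Finset.image_image]
    refine Finset.image_congr fun i _ => ?_
    simp only [Function.comp_apply, part_cons_succ hl]
    omega
  rw [cols_eq h', cols_eq h, hops_cons hl hm hq h]
  by_cases h1 : q = p
  · rw [if_pos h1, if_pos (Or.inl h1), himg, Finset.card_image_of_injective _ hinj, add_zero]
  · rw [if_neg h1, Finset.image_insert, himg, part_cons_zero hl, zero_add]
    have hmem : p ∈ ((hops lam mu).image fun i => i + lam.part i).image (· + 1) ↔
        mu.part 0 = p := by
      rw [Finset.image_image, Finset.mem_image]
      constructor
      · rintro ⟨i, h2, h3⟩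
        rw [mem_hops h] at h2
        simp only [Function.comp_apply] at h3
        have h4 := mu.add_part_le (Nat.zero_le i) (by omega)
        rcases h 0 with h5 | h5 <;> omega
      · intro h2
        refine ⟨0, ?_, ?_⟩
        · rw [mem_hops h]
          rcases h 0 with h5 | h5 <;> omega
        · simp only [Function.comp_apply]
          rcases h 0 with h5 | h5 <;> omega
    by_cases h2 : mu.part 0 = p
    · rw [if_pos (Or.inr h2), Finset.insert_eq_of_mem (hmem.mpr h2),
        Finset.card_image_of_injective _ hinj, add_zero]
    · rw [if_neg (by tauto), Finset.card_insert_of_notMem (mt hmem.mp h2),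
        Finset.card_image_of_injective _ hinj]

end StrictPartition

section Evaluation

variable {R : Type*} [CommRing R]

/-- The coefficient `2^ℓ(λ) (-1)^cols(μ/λ) (-β/2)^|μ/λ|`, written without denominators: it is used
for vertical strips with `ℓ(μ) = ℓ(λ)`, where `|μ/λ| ≤ ℓ(λ)`. -/
def stripCoeff (β : R) (lam mu : StrictPartition) : R :=
  (-1) ^ StrictPartition.cols mu lam * 2 ^ (lam.length - (StrictPartition.skew mu lam).card) *
    (-β) ^ (StrictPartition.skew mu lam).card

open StrictPartition in
theorem stripCoeff_cons_self (β : R) {p : ℕ} {lam mu : StrictPartition} (hl : lam.part 0 < p)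
    (hm : mu.part 0 < p) (h : IsUp lam mu) :
    stripCoeff β (cons p lam) (cons p mu) = 2 * stripCoeff β lam mu := by
  rw [stripCoeff, stripCoeff, card_skew_cons hl hm (Or.inl rfl) h, cols_cons hl hm (Or.inl rfl) h,
    if_pos rfl, if_pos (Or.inl rfl), length_cons hl, add_zero, add_zero,
    Nat.sub_add_comm (card_skew_le_length h), pow_succ]
  ring

open StrictPartition in
theorem stripCoeff_cons_succ (β : R) {p : ℕ} {lam mu : StrictPartition} (hl : lam.part 0 < p)
    (hm : mu.part 0 < p + 1) (h : IsUp lam mu) :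
    stripCoeff β (cons p lam) (cons (p + 1) mu) =
      (if mu.part 0 = p then -β else β) * stripCoeff β lam mu := by
  rw [stripCoeff, stripCoeff, card_skew_cons hl hm (Or.inr rfl) h, cols_cons hl hm (Or.inr rfl) h,
    if_neg (c := p + 1 = p) (show ¬ p + 1 = p by omega), length_cons hl, Nat.add_sub_add_right]
  by_cases h1 : mu.part 0 = p
  · rw [if_pos (Or.inr h1), if_pos h1]
    ring
  · rw [if_neg (by omega), if_neg h1]
    ring

theorem sum_ups_cons {M : Type*} [AddCommMonoid M] {p : ℕ} {lam : StrictPartition}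
    (hl : lam.part 0 < p) (F : StrictPartition → M) :
    ∑ mu ∈ (StrictPartition.cons p lam).ups, F mu =
      ∑ mu ∈ lam.ups, ((if mu.part 0 = p then 0 else F (StrictPartition.cons p mu)) +
        F (StrictPartition.cons (p + 1) mu)) := by
  classical
  have hup : ∀ mu ∈ lam.ups, mu.part 0 < p + 1 := by
    intro mu hmu
    rcases (lam.mem_ups mu).mp hmu 0 with h | h <;> omega
  have hset : (StrictPartition.cons p lam).ups =
      (lam.ups.filter fun mu => ¬ mu.part 0 = p).image (StrictPartition.cons p) ∪
        lam.ups.image (StrictPartition.cons (p + 1)) := by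
    ext mu
    simp only [Finset.mem_union, Finset.mem_image, Finset.mem_filter]
    constructor
    · intro h
      rw [StrictPartition.mem_ups] at h
      have hne : mu.parts ≠ [] := by
        intro h0
        have h1 := h 0
        have h2 : mu.part 0 = 0 := by
          unfold StrictPartition.part
          rw [h0]
          rfl
        rw [StrictPartition.part_cons_zero hl] at h1
        omega
      obtain ⟨q, nu, hnu, rfl⟩ := mu.exists_eq_cons hne
      obtain ⟨h1, h2⟩ := (StrictPartition.isUp_cons hl hnu).mp h
      rcases h1 with rfl | rfl
      · exact Or.inl ⟨nu, ⟨(lam.mem_ups nu).mpr h2, by omega⟩, rfl⟩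
      · exact Or.inr ⟨nu, (lam.mem_ups nu).mpr h2, rfl⟩
    · rintro (⟨nu, ⟨h1, h2⟩, rfl⟩ | ⟨nu, h1, rfl⟩)
      · have h3 := hup nu h1
        rw [StrictPartition.mem_ups, StrictPartition.isUp_cons hl (by omega)]
        exact ⟨Or.inl rfl, (lam.mem_ups nu).mp h1⟩
      · rw [StrictPartition.mem_ups, StrictPartition.isUp_cons hl (hup nu h1)]
        exact ⟨Or.inr rfl, (lam.mem_ups nu).mp h1⟩
  have hinj : ∀ (q : ℕ) (mu nu : StrictPartition), mu.part 0 < q → nu.part 0 < q →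
      StrictPartition.cons q mu = StrictPartition.cons q nu → mu = nu := by
    intro q mu nu h1 h2 h
    apply StrictPartition.part_injective
    funext i
    rw [← StrictPartition.part_cons_succ h1, h, StrictPartition.part_cons_succ h2]
  rw [hset, Finset.sum_union, Finset.sum_image, Finset.sum_image, Finset.sum_filter,
    Finset.sum_add_distrib]
  · simp only [ite_not]
  · intro mu hmu nu hnu h
    exact hinj _ mu nu (hup mu hmu) (hup nu hnu) h
  · intro mu hmu nu hnu h
    obtain ⟨h1, h2⟩ := Finset.mem_filter.mp hmu
    obtain ⟨h3, h4⟩ := Finset.mem_filter.mp hnu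
    have h5 := hup mu h1
    have h6 := hup nu h3
    exact hinj _ mu nu (by omega) (by omega) h
  · rw [Finset.disjoint_left]
    intro mu h1 h2
    obtain ⟨nu, h3, rfl⟩ := Finset.mem_image.mp h1
    obtain ⟨nu', h4, h5⟩ := Finset.mem_image.mp h2
    obtain ⟨h6, h7⟩ := Finset.mem_filter.mp h3
    have h8 := hup nu h6
    have h9 := StrictPartition.part_cons_zero (hup nu' h4)
    rw [h5, StrictPartition.part_cons_zero (by omega)] at h9
    omega

theorem hOp_congr (β : R) {c m : ℕ} (x : R) {f g : Finset ℕ → R}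
    (h : ∀ s ⊆ Finset.range m, f s = g s) :
    ∀ s ⊆ Finset.range m, hOp (uOp β) c x f s = hOp (uOp β) c x g s := by
  intro s hs
  rw [hOp_apply, hOp_apply, h s hs]
  split_ifs with hr
  · rw [h]
    intro k hk
    cases c with
    | zero => exact hs (Finset.mem_of_mem_erase hk)
    | succ c =>
      rcases (mem_lower_succ c k s).mp hk with rfl | hk
      · have := Finset.mem_range.mp (hs hr.1)
        rw [Finset.mem_range]
        omega
      · exact hs hk.2
  · rfl

theorem hOp_eq_self (β : R) {c m : ℕ} (hc : m ≤ c) (x : R) (f : Finset ℕ → R) {s : Finset ℕ}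
    (hs : s ⊆ Finset.range m) : hOp (uOp β) c x f s = f s := by
  rw [hOp_apply, if_neg, mul_zero, add_zero]
  intro hr
  have : c ∈ s := by
    cases c with
    | zero => exact hr
    | succ c => exact hr.1
  have := Finset.mem_range.mp (hs this)
  omega

theorem ascProd_congr (β : R) {N m : ℕ} (x : R) {f g : Finset ℕ → R}
    (h : ∀ s ⊆ Finset.range m, f s = g s) :
    ∀ s ⊆ Finset.range m, ascProd (uOp β) N x f s = ascProd (uOp β) N x g s := by
  induction N generalizing f g with
  | zero => exact h
  | succ N ih => exact ih (hOp_congr β x h)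

theorem ascProd_eq_of_le (β : R) {N m : ℕ} (h : m ≤ N) (x : R) (f : Finset ℕ → R)
    {s : Finset ℕ} (hs : s ⊆ Finset.range (m + 1)) :
    ascProd (uOp β) N x f s = ascProd (uOp β) m x f s := by
  induction N, h using Nat.le_induction with
  | base => rfl
  | succ N hN ih =>
    rw [← ih]
    exact ascProd_congr β x (fun t ht => hOp_eq_self β (by omega) x f ht) s hs

theorem hOp_insert (β : R) {c p : ℕ} (hc : c < p) (x : R) (f : Finset ℕ → R) (s : Finset ℕ) :
    hOp (uOp β) c x f (insert p s) = hOp (uOp β) c x (fun t => f (insert p t)) s := by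
  have h1 : Removable c (insert p s) ↔ Removable c s := by
    cases c <;> simp only [removable_zero, removable_succ, Finset.mem_insert] <;> grind
  have h2 : lower c (insert p s) = insert p (lower c s) := by
    cases c <;> ext m <;> simp only [mem_lower_zero, mem_lower_succ, Finset.mem_insert] <;> grind
  rw [hOp_apply, hOp_apply, h2]
  simp only [h1]

theorem ascProd_insert (β : R) {N p : ℕ} (hN : N < p) (x : R) (f : Finset ℕ → R) (s : Finset ℕ) :
    ascProd (uOp β) N x f (insert p s) = ascProd (uOp β) N x (fun t => f (insert p t)) s := by
  induction N generalizing f with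
  | zero => rfl
  | succ N ih =>
    change ascProd (uOp β) N x (hOp (uOp β) (N + 1) x f) (insert p s) = _
    rw [ih (by omega)]
    have : (fun t => hOp (uOp β) (N + 1) x f (insert p t)) =
        hOp (uOp β) (N + 1) x (fun t => f (insert p t)) := by
      funext t
      exact hOp_insert β hN x f t
    rw [this]
    rfl

theorem sites_subset_range (lam : StrictPartition) : lam.sites ⊆ Finset.range (lam.part 0) := by
  intro m hm
  obtain ⟨i, hi⟩ := (lam.mem_sites m).mp hm
  have := lam.part_le_part (Nat.zero_le i)
  rw [Finset.mem_range]
  omega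

theorem shift_insert (p : ℕ) (s : Finset ℕ) : shift (insert p s) = insert (p + 1) (shift s) := by
  rw [shift, Finset.image_insert]
  rfl

theorem shift_subset_range {s : Finset ℕ} {m : ℕ} (h : s ⊆ Finset.range m) :
    shift s ⊆ Finset.range (m + 1) := by
  intro k hk
  cases k with
  | zero => simp
  | succ k =>
    have := Finset.mem_range.mp (h ((succ_mem_shift k s).mp hk))
    rw [Finset.mem_range]
    omega

/-- The intertwiner is given by the signed sum over vertical strips.  The induction removes the
largest part of `λ`: only one factor of the product moves this part, and the relation `βz = -2`
turns its contribution into the two terms of `sum_ups_cons`. -/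
theorem scale_ascProd_shift (β : R) {z : R} (hz : β * z + 2 = 0) (lam : StrictPartition) {N : ℕ}
    (hN : lam.part 0 ≤ N) (f : Finset ℕ → R) :
    (-β) ^ lam.length * ascProd (uOp β) N z f (shift lam.sites) =
      ∑ mu ∈ lam.ups, stripCoeff β lam mu * f mu.sites := by
  generalize hn : lam.length = n
  induction n generalizing lam N f with
  | zero =>
    have hpart : ∀ i, lam.part i = 0 := fun i => by
      have := lam.part_pos_iff i
      omega
    have hups : lam.ups = {lam} := by
      ext mu
      rw [StrictPartition.mem_ups, Finset.mem_singleton]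
      constructor
      · intro h
        apply StrictPartition.part_injective
        funext i
        rcases h i with h1 | h1
        · exact h1
        · have := hpart i
          omega
      · rintro rfl i
        exact Or.inl rfl
    have hs : lam.sites = ∅ := by
      rw [← Finset.card_eq_zero, lam.card_sites, hn]
    have hsk : StrictPartition.skew lam lam = ∅ := by simp [StrictPartition.skew]
    rw [hups, Finset.sum_singleton, ascProd_eq_of_le β (Nat.zero_le N) z f (by simp [hs, shift])]
    simp [stripCoeff, StrictPartition.cols, hsk, hn, hs, shift, ascProd]
  | succ n ih =>
    have hne : lam.parts ≠ [] := by
      intro h0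
      rw [StrictPartition.length, h0] at hn
      simp at hn
    obtain ⟨p, mu, hmu, rfl⟩ := lam.exists_eq_cons hne
    rw [StrictPartition.length_cons hmu] at hn
    rw [StrictPartition.part_cons_zero hmu] at hN
    obtain ⟨p, rfl⟩ : ∃ q, p = q + 1 := ⟨p - 1, by omega⟩
    have hsub : mu.sites ⊆ Finset.range p := (sites_subset_range mu).trans (by
      rw [Finset.range_subset_range]; omega)
    have hsub' : shift (StrictPartition.cons (p + 1) mu).sites ⊆ Finset.range (p + 1 + 1) := by
      refine shift_subset_range ?_
      rw [StrictPartition.sites_cons hmu]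
      refine Finset.insert_subset (by simp) (hsub.trans ?_)
      rw [Finset.range_subset_range]
      omega
    rw [ascProd_eq_of_le β hN z f hsub', StrictPartition.sites_cons hmu, shift_insert]
    change _ * ascProd (uOp β) p z (hOp (uOp β) (p + 1) z f) (insert (p + 1) (shift mu.sites)) = _
    rw [ascProd_insert β (Nat.lt_succ_self p), pow_succ, mul_right_comm,
      ih mu (by omega) _ (by omega), sum_ups_cons hmu, Finset.sum_mul]
    refine Finset.sum_congr rfl fun nu hnu => ?_
    have hup := (mu.mem_ups nu).mp hnu
    have hnu0 : nu.part 0 < p + 1 + 1 := by rcases hup 0 with h | h <;> omega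
    have hns := sites_subset_range nu
    have hp1 : p + 1 ∉ nu.sites := fun h => by
      have := Finset.mem_range.mp (hns h)
      omega
    have hpmem : p ∈ nu.sites ↔ nu.part 0 = p + 1 := by
      constructor
      · intro h
        have := Finset.mem_range.mp (hns h)
        omega
      · intro h
        exact (nu.mem_sites p).mpr ⟨0, h⟩
    rw [hOp_apply, stripCoeff_cons_succ β hmu hnu0 hup, StrictPartition.sites_cons hnu0]
    by_cases h1 : nu.part 0 = p + 1
    · rw [if_pos h1, if_pos h1, if_neg]
      · ring
      · intro hr
        exact hr.2 (Finset.mem_insert_of_mem (hpmem.mpr h1))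
    · have hpn : p ∉ nu.sites := mt hpmem.mp h1
      have hr : Removable (p + 1) (insert (p + 1) nu.sites) := by
        refine ⟨Finset.mem_insert_self _ _, ?_⟩
        rw [Finset.mem_insert]
        rintro (h | h)
        · omega
        · exact hpn h
      have hlow : lower (p + 1) (insert (p + 1) nu.sites) = insert p nu.sites := by
        rw [lower, Finset.erase_insert hp1]
      have hnu1 : nu.part 0 < p + 1 := by omega
      rw [if_neg h1, if_neg h1, if_pos hr, hlow, stripCoeff_cons_self β hmu hnu1 hup,
        StrictPartition.sites_cons hnu1]
      linear_combination (-stripCoeff β mu nu * (f (insert p nu.sites) +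
        β * f (insert (p + 1) nu.sites))) * hz

end Evaluation

/-! ### The expansion of `GQ` in terms of `GP` -/

section Expansion

theorem map_tableauSum {R S : Type*} [CommRing R] [CommRing S] (φ : R →+* S) (β : R) (x : ℕ → R)
    (A : Finset (ℕ × ℕ)) (lam : StrictPartition) :
    φ (tableauSum β x A lam) = tableauSum (φ β) (fun i => φ (x i)) A lam := by
  simp only [tableauSum, tableauWeight, map_sum, map_mul, map_pow, map_prod]

theorem map_stripCoeff {R S : Type*} [CommRing R] [CommRing S] (φ : R →+* S) (β : R)
    (lam mu : StrictPartition) : φ (stripCoeff β lam mu) = stripCoeff (φ β) lam mu := by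
  simp only [stripCoeff, map_mul, map_pow, map_neg, map_one, map_ofNat]

variable {R : Type*} [CommRing R]

/-- The indicator function of the empty partition is fixed by all factors other than `h_0`. -/
theorem hOp_succ_vacuum (β : R) (c : ℕ) (x : R) :
    hOp (uOp β) (c + 1) x (Pi.single ∅ 1) = Pi.single ∅ 1 := by
  funext s
  rw [hOp_apply]
  split_ifs with h
  · have h1 : s ≠ ∅ := by
      rintro rfl
      exact absurd h.1 (by simp)
    have h2 : lower (c + 1) s ≠ ∅ := Finset.insert_ne_empty _ _
    rw [Pi.single_eq_of_ne h1, Pi.single_eq_of_ne h2]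
    ring
  · ring

theorem ascProd_vacuum (β : R) (N : ℕ) (x : R) :
    ascProd (uOp β) N x (Pi.single ∅ 1) = Pi.single ∅ 1 := by
  induction N with
  | zero => rfl
  | succ N ih =>
    change ascProd (uOp β) N x (hOp (uOp β) (N + 1) x (Pi.single ∅ 1)) = _
    rw [hOp_succ_vacuum, ih]

theorem intertwiner_vacuum (β z : R) (N : ℕ) :
    intertwiner β z N (Pi.single ∅ 1) = Pi.single ∅ 1 := by
  change scale β (unshift (ascProd (uOp β) (N + 1) z (Pi.single ∅ 1))) = _
  rw [ascProd_vacuum]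
  funext s
  change (-β) ^ s.card * (Pi.single ∅ 1 : Finset ℕ → R) (shift s) = _
  by_cases h : s = ∅
  · subst h
    simp [shift]
  · rw [Pi.single_eq_of_ne h, Pi.single_eq_of_ne (by simpa [shift] using h), mul_zero]

theorem intertwiner_evolve (β : R) {z : R} (hz : β * z + 2 = 0) (x : ℕ → R)
    (hx : ∀ i, ∃ x', kadd β (x i) x' = 0) (N n : ℕ) :
    evolve (transferQ (uOp β) N) x n =
      intertwiner β z N (evolve (transferP (uOp β) (N + 1)) x n) := by
  induction n with
  | zero => exact (intertwiner_vacuum β z N).symm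
  | succ n ih =>
    obtain ⟨x', hx'⟩ := hx n
    have := intertwiner_mul_transferP β N hx' hz
    calc _ = (transferQ (uOp β) N (x n) * intertwiner β z N)
          (evolve (transferP (uOp β) (N + 1)) x n) := by
          rw [evolve, ih, Module.End.mul_apply]
      _ = _ := by rw [← this]; rfl

theorem tableauSum_expansion_of_inverse (β : R) {z : R} (hz : β * z + 2 = 0) (x : ℕ → R)
    (hx : ∀ i, ∃ x', kadd β (x i) x' = 0) {N : ℕ} (n : ℕ) (lam : StrictPartition)
    (hN : lam.part 0 ≤ N + 1) : tableauSum β x (pairsQ N n) lam =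
      ∑ mu ∈ lam.ups, stripCoeff β lam mu * tableauSum β x (pairsP (N + 1) n) mu := by
  have h := scale_ascProd_shift β hz lam hN (tableauFun β x (pairsP (N + 1) n))
  simp only [tableauFun_sites] at h
  rw [← h, ← tableauFun_sites, tableauFun_pairsQ, tableauFun_pairsP,
    intertwiner_evolve β hz x hx, ← lam.card_sites]
  rfl

/-- The expansion holds for generic `β`, because `-2/β` and the inverses of the `x_i` for `⊕` exist
in the field of fractions. -/
theorem tableauSum_expansion {N : ℕ} (n : ℕ) (lam : StrictPartition) (hN : lam.part 0 ≤ N + 1) :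
    tableauSum (MvPolynomial.C (X : ℤ[X])) (MvPolynomial.X : ℕ → MvPolynomial ℕ ℤ[X])
      (pairsQ N n) lam =
      ∑ mu ∈ lam.ups, stripCoeff (MvPolynomial.C (X : ℤ[X])) lam mu *
        tableauSum (MvPolynomial.C (X : ℤ[X])) MvPolynomial.X (pairsP (N + 1) n) mu := by
  set φ := algebraMap (MvPolynomial ℕ ℤ[X]) (FractionRing (MvPolynomial ℕ ℤ[X])) with hφ
  have hinj : Function.Injective φ := IsFractionRing.injective _ _
  apply hinj
  rw [map_sum]
  simp only [map_mul, map_tableauSum, map_stripCoeff]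
  have hβ : φ (MvPolynomial.C (X : ℤ[X])) ≠ 0 := by
    rw [Ne, map_eq_zero_iff φ hinj, MvPolynomial.C_eq_zero]
    exact X_ne_zero
  refine tableauSum_expansion_of_inverse _ (z := -2 / φ (MvPolynomial.C (X : ℤ[X]))) ?_ _ ?_
    n lam hN
  · field_simp
    ring
  · intro i
    have h1 : 1 + φ (MvPolynomial.C (X : ℤ[X])) * φ (MvPolynomial.X i) ≠ 0 := by
      rw [← map_one φ, ← map_mul, ← map_add, Ne, map_eq_zero_iff φ hinj]
      intro h
      have := congrArg MvPolynomial.constantCoeff h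
      simp at this
    refine ⟨-φ (MvPolynomial.X i) / (1 + φ (MvPolynomial.C (X : ℤ[X])) * φ (MvPolynomial.X i)), ?_⟩
    unfold kadd
    have h2 := div_mul_cancel₀ (φ (MvPolynomial.X i)) h1
    linear_combination -h2

/-- The expansion of `GQ_λ` in terms of `GP`. -/
theorem coeff_GQ_eq_sum (lam : StrictPartition) (d : ℕ →₀ ℕ) :
    MvPowerSeries.coeff d (GQ lam) =
      ∑ mu ∈ lam.ups, stripCoeff (X : ℤ[X]) lam mu * MvPowerSeries.coeff d (GP mu) := by
  obtain ⟨n, hn⟩ : ∃ n, ∀ i, n ≤ i → d i = 0 := by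
    refine ⟨d.support.sup id + 1, fun i hi => ?_⟩
    by_contra h
    have := Finset.le_sup (f := id) (Finsupp.mem_support_iff.mpr h)
    simp only [id] at this
    omega
  rw [coeff_GQ lam (N := lam.part 0) (by omega) hn]
  have h := congrArg (fun p : MvPolynomial ℕ ℤ[X] => MvPowerSeries.coeff d
    (MvPolynomial.coeToMvPowerSeries.ringHom p))
    (tableauSum_expansion n lam (N := lam.part 0) (by omega))
  simp only [map_sum, map_mul, map_tableauSum, map_stripCoeff,
    MvPolynomial.coeToMvPowerSeries.ringHom_apply, MvPolynomial.coe_C, MvPolynomial.coe_X] at h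
  rw [h]
  refine Finset.sum_congr rfl fun mu hmu => ?_
  have hup : mu.part 0 ≤ lam.part 0 + 1 := by
    rcases (lam.mem_ups mu).mp hmu 0 with h | h <;> omega
  rw [coeff_GP mu (N := lam.part 0 + 1) (by omega) hn, ← map_stripCoeff, MvPowerSeries.coeff_C_mul]

end Expansion

/-! ### Triangularity with respect to the monomials `x^λ` -/

/-- The statistic `∑ i · d_i` of an exponent vector. -/
noncomputable def expStat : (ℕ →₀ ℕ) →+ ℕ :=
  Finsupp.liftAddHom fun i => AddMonoidHom.mulLeft i

theorem expStat_single (i a : ℕ) : expStat (Finsupp.single i a) = i * a := by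
  simp [expStat]

namespace StrictPartition

/-- The exponent vector of the monomial `x^λ`. -/
noncomputable def expo (lam : StrictPartition) : ℕ →₀ ℕ :=
  Finsupp.onFinset (Finset.range lam.length) lam.part fun i hi =>
    Finset.mem_range.mpr ((lam.part_pos_iff i).mp (Nat.pos_of_ne_zero hi))

theorem expo_apply (lam : StrictPartition) (i : ℕ) : lam.expo i = lam.part i := rfl

theorem expo_injective : Function.Injective expo := by
  intro lam mu h
  apply part_injective
  funext i
  rw [← expo_apply, h, expo_apply]

theorem expo_eq_sum (lam : StrictPartition) :
    lam.expo = ∑ p ∈ lam.diagram, Finsupp.single p.1 1 := by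
  ext i
  rw [Finsupp.finsetSum_apply, expo_apply]
  simp only [Finsupp.single_apply]
  rw [Finset.sum_boole]
  have : (lam.diagram.filter fun p => p.1 = i) =
      (Finset.Ico i (i + lam.part i)).image fun j => (i, j) := by
    ext ⟨a, b⟩
    simp only [Finset.mem_filter, mem_diagram, Finset.mem_image, Finset.mem_Ico, Prod.mk.injEq]
    constructor
    · rintro ⟨h, rfl⟩
      exact ⟨b, h, rfl, rfl⟩
    · rintro ⟨c, h, rfl, rfl⟩
      exact ⟨h, rfl⟩
  rw [this, Finset.card_image_of_injective]
  · simp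
  · intro a b h
    exact (Prod.mk.inj h).2

theorem degree_expo (lam : StrictPartition) : lam.expo.degree = lam.size := by
  rw [expo_eq_sum, map_sum, size, Finset.card_eq_sum_ones]
  simp

/-- The order in which the monomials `x^λ` are eliminated: by size, then by `∑ i · λ_i`. -/
noncomputable def rank (lam : StrictPartition) : ℕ ×ₗ ℕ := toLex (lam.size, expStat lam.expo)

theorem rank_lt_iff (lam mu : StrictPartition) : lam.rank < mu.rank ↔
    lam.size < mu.size ∨ (lam.size = mu.size ∧ expStat lam.expo < expStat mu.expo) :=
  Prod.Lex.toLex_lt_toLex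

end StrictPartition

theorem degree_exponent (E : Finset ((ℕ × ℕ) × ℕ)) : (exponent E).degree = E.card := by
  rw [exponent, map_sum, Finset.card_eq_sum_ones]
  simp

theorem expStat_exponent (E : Finset ((ℕ × ℕ) × ℕ)) :
    expStat (exponent E) = ∑ e ∈ E, e.2 / 2 := by
  rw [exponent, map_sum]
  simp [expStat_single]

/-- The letters in row `i` of a shifted tableau are at least `i'` (rows are counted from `0`, as are
the letters). -/
theorem row_le_letter {A : Finset (ℕ × ℕ)} {lam : StrictPartition} {E : Finset ((ℕ × ℕ) × ℕ)}
    (hE : E ∈ tableaux A lam) (i j k : ℕ) (he : ((i, j), k) ∈ E) : i ≤ k / 2 := by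
  obtain ⟨h1, h2, _⟩ := mem_tableaux.mp hE
  induction i generalizing j k with
  | zero => exact Nat.zero_le _
  | succ i ih =>
    have hd : (i + 1, j) ∈ lam.diagram := h1 ▸ Finset.mem_image_of_mem Prod.fst he
    have hj := ((lam.mem_diagram _).mp hd).1
    simp only at hj
    have hd2 : (i, j) ∈ lam.diagram := lam.mem_diagram_above hd (Nat.le_succ i)
    have hd1 : (i, j - 1) ∈ lam.diagram := lam.mem_diagram_left hd2 (by omega) (by omega)
    have hletter : ∀ p ∈ lam.diagram, ∃ l, (p, l) ∈ E := by
      intro p hp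
      rw [← h1] at hp
      obtain ⟨⟨q, l⟩, h3, rfl⟩ := Finset.mem_image.mp hp
      exact ⟨l, h3⟩
    obtain ⟨k1, hk1⟩ := hletter _ hd1
    obtain ⟨k2, hk2⟩ := hletter _ hd2
    have h3 := ih _ _ hk1
    have h4 := h2.row_weak _ hk1 _ hk2 rfl (by simp only; omega)
    have h5 := h2.col_weak _ hk2 _ he rfl (by simp)
    simp only at h4 h5
    by_contra h6
    rcases Nat.even_or_odd k2 with h7 | h7
    · have h8 : k1 = k2 := by
        obtain ⟨r, hr⟩ := h7
        omega
      have := h2.row_primed _ hk1 _ hk2 rfl h8 (h8 ▸ h7)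
      simp only [Prod.mk.injEq] at this
      omega
    · have h8 : k2 = k := by
        obtain ⟨r, hr⟩ := h7
        omega
      have := h2.col_unprimed _ hk2 _ he rfl h8 h7
      simp at this

/-- A tableau of shape `μ` and weight `λ` exists only if `μ = λ` or `μ` precedes `λ`; if `μ = λ`,
all letters in row `i` are `i'` or `i`. -/
theorem rank_of_exponent_eq {A : Finset (ℕ × ℕ)} {lam mu : StrictPartition}
    {E : Finset ((ℕ × ℕ) × ℕ)} (hE : E ∈ tableaux A mu) (h : exponent E = lam.expo) :
    mu.rank < lam.rank ∨ (mu = lam ∧ ∀ e ∈ E, e.2 / 2 = e.1.1) := by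
  have hcard : E.card = lam.size := by rw [← degree_exponent, h, lam.degree_expo]
  have hle := size_le_card hE
  obtain ⟨h1, h2, _⟩ := mem_tableaux.mp hE
  rw [StrictPartition.rank_lt_iff]
  rcases (hcard ▸ hle).lt_or_eq with h3 | h3
  · exact Or.inl (Or.inl h3)
  · have hinj : Set.InjOn Prod.fst (E : Set ((ℕ × ℕ) × ℕ)) := by
      rw [← Finset.card_image_iff, h1, hcard, ← h3]
      rfl
    have hrow : mu.expo = ∑ e ∈ E, Finsupp.single e.1.1 1 := by
      rw [StrictPartition.expo_eq_sum, ← h1, Finset.sum_image hinj]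
    have hstat : expStat mu.expo = ∑ e ∈ E, e.1.1 := by
      rw [hrow, map_sum]
      simp [expStat_single]
    have hge : ∀ e ∈ E, e.1.1 ≤ e.2 / 2 := fun e he => row_le_letter hE e.1.1 e.1.2 e.2 he
    have hstat' : expStat lam.expo = ∑ e ∈ E, e.2 / 2 := by rw [← h, expStat_exponent]
    have hle' : expStat mu.expo ≤ expStat lam.expo := by
      rw [hstat, hstat']
      exact Finset.sum_le_sum hge
    rcases hle'.lt_or_eq with h4 | h4
    · exact Or.inl (Or.inr ⟨h3, h4⟩)
    · right
      rw [hstat, hstat', Finset.sum_eq_sum_iff_of_le hge] at h4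
      refine ⟨StrictPartition.expo_injective ?_, fun e he => (h4 e he).symm⟩
      rw [hrow, ← h, exponent]
      exact Finset.sum_congr rfl fun e he => by rw [h4 e he]

theorem coeff_tableauSum (A : Finset (ℕ × ℕ)) (lam : StrictPartition) (d : ℕ →₀ ℕ)
    [DecidablePred fun E => exponent E = d] :
    MvPowerSeries.coeff d
      (tableauSum (MvPowerSeries.C (X : ℤ[X])) MvPowerSeries.X A lam) =
      ∑ E ∈ (tableaux A lam).filter (fun E => exponent E = d), X ^ (E.card - lam.size) := by
  classical
  rw [tableauSum, map_sum, Finset.sum_filter]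
  refine Finset.sum_congr rfl fun E _ => ?_
  have := coeff_tableauWeight id lam E d
  rw [Finsupp.mapDomain_id] at this
  rw [← show (fun i => (MvPowerSeries.X (id i) : BetaSeries)) = MvPowerSeries.X from rfl, this]
  congr

theorem exists_forall_le_eq_zero (d : ℕ →₀ ℕ) : ∃ n, ∀ i, n ≤ i → d i = 0 := by
  refine ⟨d.support.sup id + 1, fun i hi => ?_⟩
  by_contra h
  have := Finset.le_sup (f := id) (Finsupp.mem_support_iff.mpr h)
  simp only [id] at this
  omega

theorem exists_tableau_of_coeff_ne_zero {A : Finset (ℕ × ℕ)} {lam : StrictPartition} {d : ℕ →₀ ℕ}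
    (h : MvPowerSeries.coeff d
      (tableauSum (MvPowerSeries.C (X : ℤ[X])) MvPowerSeries.X A lam) ≠ 0) :
    ∃ E ∈ tableaux A lam, exponent E = d := by
  classical
  rw [coeff_tableauSum] at h
  obtain ⟨E, hE, _⟩ := Finset.exists_ne_zero_of_sum_ne_zero h
  exact ⟨E, Finset.mem_filter.mp hE⟩

/-- A family of series indexed by strict partitions whose coefficients at the monomials `x^λ` form
a triangular matrix with nonzero diagonal. -/
structure IsTriangular (G : StrictPartition → BetaSeries) : Prop where
  size_le : ∀ lam d, MvPowerSeries.coeff d (G lam) ≠ 0 → lam.size ≤ d.degree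
  rank_lt : ∀ lam mu, MvPowerSeries.coeff lam.expo (G mu) ≠ 0 → mu.rank < lam.rank ∨ mu = lam
  diag : ∀ lam, MvPowerSeries.coeff lam.expo (G lam) ≠ 0

theorem exists_tableau_GQ {lam : StrictPartition} {d : ℕ →₀ ℕ}
    (h : MvPowerSeries.coeff d (GQ lam) ≠ 0) : ∃ A, ∃ E ∈ tableaux A lam, exponent E = d := by
  obtain ⟨n, hn⟩ := exists_forall_le_eq_zero d
  rw [coeff_GQ lam (N := lam.part 0) (by omega) hn] at h
  exact ⟨_, exists_tableau_of_coeff_ne_zero h⟩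

theorem exists_tableau_GP {lam : StrictPartition} {d : ℕ →₀ ℕ}
    (h : MvPowerSeries.coeff d (GP lam) ≠ 0) : ∃ A, ∃ E ∈ tableaux A lam, exponent E = d := by
  obtain ⟨n, hn⟩ := exists_forall_le_eq_zero d
  rw [coeff_GP lam (N := lam.part 0) (by omega) hn] at h
  exact ⟨_, exists_tableau_of_coeff_ne_zero h⟩

theorem size_le_degree {A : Finset (ℕ × ℕ)} {lam : StrictPartition} {E : Finset ((ℕ × ℕ) × ℕ)}
    (hE : E ∈ tableaux A lam) : lam.size ≤ (exponent E).degree := by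
  rw [degree_exponent]
  exact size_le_card hE

/-- The only tableau of shape and weight `λ` without primed letters on the diagonal has all letters
in row `i` equal to `i`. -/
theorem coeff_expo_GP (lam : StrictPartition) : MvPowerSeries.coeff lam.expo (GP lam) = 1 := by
  classical
  have hn : ∀ i, lam.length ≤ i → lam.expo i = 0 := by
    intro i hi
    rw [lam.expo_apply]
    have := lam.part_pos_iff i
    omega
  rw [coeff_GP lam (N := lam.part 0) (by omega) hn, coeff_tableauSum]
  set E₀ : Finset ((ℕ × ℕ) × ℕ) := lam.diagram.image fun p => (p, 2 * p.1 + 1) with hE₀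
  have hmem : ∀ p k, (p, k) ∈ E₀ ↔ p ∈ lam.diagram ∧ k = 2 * p.1 + 1 := by
    intro p k
    rw [hE₀, Finset.mem_image]
    constructor
    · rintro ⟨q, hq, h⟩
      obtain ⟨rfl, rfl⟩ := Prod.mk.inj h
      exact ⟨hq, rfl⟩
    · rintro ⟨h, rfl⟩
      exact ⟨p, h, rfl⟩
  have himg : E₀.image Prod.fst = lam.diagram := by
    rw [hE₀, Finset.image_image]
    exact Finset.image_id
  have hcard : E₀.card = lam.size := by
    rw [hE₀, Finset.card_image_of_injective]
    · rfl
    · intro p q h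
      exact (Prod.mk.inj h).1
  have hset : (tableaux (pairsP (lam.part 0) lam.length) lam).filter
      (fun E => exponent E = lam.expo) = {E₀} := by
    ext E
    rw [Finset.mem_filter, Finset.mem_singleton]
    constructor
    · rintro ⟨hE, h⟩
      obtain ⟨h1, h2, h3⟩ := mem_tableaux.mp hE
      have h4 : ∀ e ∈ E, e.2 / 2 = e.1.1 := by
        rcases rank_of_exponent_eq hE h with h5 | h5
        · exact absurd h5 (lt_irrefl _)
        · exact h5.2
      have hdiag : ∀ i j k, ((i, j), k) ∈ E → j = i → Odd k := by
        rintro i j k he rfl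
        have := ((mem_pairsP _ _ _).mp (h3 _ he)).2
        simpa using this
      have hodd : ∀ i j k, ((i, j), k) ∈ E → Odd k := by
        intro i j k he
        by_contra hk
        have hk' := Nat.not_odd_iff_even.mp hk
        have hd : (i, j) ∈ lam.diagram := h1 ▸ Finset.mem_image_of_mem Prod.fst he
        have hij := ((lam.mem_diagram _).mp hd).1
        simp only at hij
        have hd' := lam.mem_diagram_left hd hij le_rfl
        rw [← h1] at hd'
        obtain ⟨⟨q, l⟩, h5, rfl⟩ := Finset.mem_image.mp hd'
        have h6 := hdiag i i l h5 rfl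
        rcases hij.lt_or_eq with h7 | h7
        · have h8 := h2.row_weak _ h5 _ he rfl h7
          have h9 := h4 _ h5
          have h10 := h4 _ he
          simp only at h8 h9 h10
          rw [Nat.odd_iff] at h6
          rw [Nat.even_iff] at hk'
          omega
        · exact hk (hdiag i j k he h7.symm)
      ext ⟨⟨i, j⟩, k⟩
      rw [hmem]
      have hone : ∀ l, ((i, j), l) ∈ E → l = 2 * i + 1 := by
        intro l hl
        have h5 := h4 _ hl
        have h6 := hodd i j l hl
        simp only at h5
        rw [Nat.odd_iff] at h6
        omega
      constructor
      · intro he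
        exact ⟨h1 ▸ Finset.mem_image_of_mem Prod.fst he, hone k he⟩
      · rintro ⟨hd, rfl⟩
        rw [← h1] at hd
        obtain ⟨⟨q, l⟩, h5, rfl⟩ := Finset.mem_image.mp hd
        rw [← hone l h5]
        exact h5
    · rintro rfl
      refine ⟨mem_tableaux.mpr ⟨himg, ⟨?_, ?_, ?_, ?_⟩, ?_⟩, ?_⟩
      · rintro ⟨p, k⟩ he ⟨q, l⟩ hf h1 h2
        rw [hmem] at he hf
        simp only at h1 ⊢
        omega
      · rintro ⟨p, k⟩ he ⟨q, l⟩ hf h1 h2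
        rw [hmem] at he hf
        simp only at h2 ⊢
        omega
      · rintro ⟨⟨a, b⟩, k⟩ he ⟨⟨a', b'⟩, l⟩ hf h1 h2 _
        rw [hmem] at he hf
        simp only at h1 h2 he hf
        have : a = a' := by omega
        rw [this, h1, h2]
      · rintro ⟨⟨a, b⟩, k⟩ he ⟨q, l⟩ hf h1 h2 h3
        rw [hmem] at he
        simp only at h3 he
        rw [he.2, Nat.even_iff] at h3
        omega
      · rintro ⟨⟨a, b⟩, k⟩ he
        rw [hmem] at he
        obtain ⟨h1, rfl⟩ := he
        have h2 : a < lam.length := by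
          rw [← lam.part_pos_iff]
          rw [lam.mem_diagram] at h1
          simp only at h1
          omega
        rw [mem_pairsP]
        exact ⟨⟨by simp only; omega, content_le (by omega) h1⟩, fun _ => by simp⟩
      · rw [exponent, hE₀, Finset.sum_image (fun p _ q _ h => (Prod.mk.inj h).1), lam.expo_eq_sum]
        refine Finset.sum_congr rfl fun p _ => ?_
        congr 1
        simp only
        omega
  rw [hset, Finset.sum_singleton, hcard, Nat.sub_self, pow_zero]

theorem isUp_size {lam mu : StrictPartition} (h : StrictPartition.IsUp lam mu) :
    mu.size = lam.size + (StrictPartition.skew mu lam).card := by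
  have hsub : lam.diagram ⊆ mu.diagram := by
    intro p hp
    rw [StrictPartition.mem_diagram] at hp ⊢
    rcases h p.1 with h1 | h1 <;> omega
  rw [StrictPartition.size, StrictPartition.size, StrictPartition.skew,
    Finset.card_sdiff_of_subset hsub]
  have := Finset.card_le_card hsub
  omega

/-- In the expansion of `GQ_λ` in terms of `GP`, only `GP_λ` contributes to the coefficient at
`x^λ`. -/
theorem coeff_expo_GQ (lam : StrictPartition) :
    MvPowerSeries.coeff lam.expo (GQ lam) = 2 ^ lam.length := by
  have hself : StrictPartition.IsUp lam lam := fun i => Or.inl rfl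
  have hskew : StrictPartition.skew lam lam = ∅ := by simp [StrictPartition.skew]
  rw [coeff_GQ_eq_sum, Finset.sum_eq_single lam, coeff_expo_GP, stripCoeff, StrictPartition.cols,
    hskew]
  · simp
  · intro mu hmu hne
    rw [StrictPartition.mem_ups] at hmu
    have h0 : MvPowerSeries.coeff lam.expo (GP mu) = 0 := by
      by_contra h
      obtain ⟨A, E, hE, hexp⟩ := exists_tableau_GP h
      rcases rank_of_exponent_eq hE hexp with h1 | h1
      · have h2 := isUp_size hmu
        have h4 : ∀ i, lam.part i ≤ mu.part i := fun i => by rcases hmu i with h | h <;> omega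
        have h3 : expStat lam.expo ≤ expStat mu.expo := by
          have h5 : lam.expo ≤ mu.expo := h4
          rw [← add_tsub_cancel_of_le h5, map_add]
          exact Nat.le_add_right _ _
        rw [StrictPartition.rank_lt_iff] at h1
        omega
      · exact hne h1.1
    rw [h0, mul_zero]
  · intro h
    exact absurd ((lam.mem_ups lam).mpr hself) h

theorem isTriangular_GQ : IsTriangular GQ where
  size_le lam d h := by
    obtain ⟨A, E, hE, rfl⟩ := exists_tableau_GQ h
    exact size_le_degree hE
  rank_lt lam mu h := by
    obtain ⟨A, E, hE, h1⟩ := exists_tableau_GQ h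
    exact (rank_of_exponent_eq hE h1).imp_right And.left
  diag lam := by
    rw [coeff_expo_GQ]
    exact pow_ne_zero _ two_ne_zero

theorem isTriangular_GP : IsTriangular GP where
  size_le lam d h := by
    obtain ⟨A, E, hE, rfl⟩ := exists_tableau_GP h
    exact size_le_degree hE
  rank_lt lam mu h := by
    obtain ⟨A, E, hE, h1⟩ := exists_tableau_GP h
    exact (rank_of_exponent_eq hE h1).imp_right And.left
  diag lam := by
    rw [coeff_expo_GP]
    exact one_ne_zero

theorem finite_size_le (D : ℕ) : {lam : StrictPartition | lam.size ≤ D}.Finite := by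
  apply Set.Finite.of_finite_image (f := StrictPartition.sites) _
    StrictPartition.sites_injective.injOn
  apply (Finset.finite_toSet (Finset.range D).powerset).subset
  rintro _ ⟨lam, hlam, rfl⟩
  simp only [Finset.coe_powerset, Set.mem_preimage, Set.mem_powerset_iff, Finset.coe_subset]
  refine (sites_subset_range lam).trans ?_
  rw [Finset.range_subset_range]
  have : lam.expo 0 ≤ lam.expo.degree := Finsupp.le_degree 0 lam.expo
  rw [lam.degree_expo, lam.expo_apply] at this
  exact this.trans hlam

/-- The finite set of strict partitions of size at most `D`. -/
noncomputable def sizeLE (D : ℕ) : Finset StrictPartition := (finite_size_le D).toFinset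

theorem mem_sizeLE (D : ℕ) (lam : StrictPartition) : lam ∈ sizeLE D ↔ lam.size ≤ D := by
  rw [sizeLE, Set.Finite.mem_toFinset]
  rfl

/-! ### Cauchy identities: coefficients, uniqueness, and change of basis -/

theorem coeff_sumElim_inX (f : BetaSeries) (d e : ℕ →₀ ℕ) :
    MvPowerSeries.coeff (d.sumElim e) (inX f) = if e = 0 then MvPowerSeries.coeff d f else 0 := by
  classical
  unfold inX
  split_ifs with h
  · subst h
    have h : d.sumElim (0 : ℕ →₀ ℕ) = Finsupp.embDomain Function.Embedding.inl d := by
      ext (i | i)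
      · exact (Finsupp.embDomain_apply_self (Function.Embedding.inl (β := ℕ)) d i).symm
      · rw [Finsupp.embDomain_of_notMem_range]
        · rfl
        · simp
    rw [h, MvPowerSeries.coeff_embDomain_rename]
  · refine MvPowerSeries.coeff_rename_eq_zero _ _ ?_
    rintro ⟨c, hc⟩
    apply h
    ext i
    rw [← Finsupp.sumElim_inr d e i, ← hc, Finsupp.mapDomain_of_notMem_range]
    · rfl
    · simp

theorem coeff_sumElim_inY (f : BetaSeries) (d e : ℕ →₀ ℕ) :
    MvPowerSeries.coeff (d.sumElim e) (inY f) = if d = 0 then MvPowerSeries.coeff e f else 0 := by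
  classical
  unfold inY
  split_ifs with h
  · subst h
    have h : (0 : ℕ →₀ ℕ).sumElim e = Finsupp.embDomain Function.Embedding.inr e := by
      ext (i | i)
      · rw [Finsupp.embDomain_of_notMem_range]
        · rfl
        · simp
      · exact (Finsupp.embDomain_apply_self (Function.Embedding.inr (α := ℕ)) e i).symm
    rw [h, MvPowerSeries.coeff_embDomain_rename]
  · refine MvPowerSeries.coeff_rename_eq_zero _ _ ?_
    rintro ⟨c, hc⟩
    apply h
    ext i
    rw [← Finsupp.sumElim_inl d e i, ← hc, Finsupp.mapDomain_of_notMem_range]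
    · rfl
    · simp

theorem exists_eq_sumElim (c : ℕ ⊕ ℕ →₀ ℕ) : ∃ d e : ℕ →₀ ℕ, c = d.sumElim e := by
  refine ⟨c.comapDomain Sum.inl Sum.inl_injective.injOn,
    c.comapDomain Sum.inr Sum.inr_injective.injOn, ?_⟩
  ext (i | i) <;> rfl

theorem coeff_mul_inY (F : BetaSeries₂) (g : BetaSeries) (d e : ℕ →₀ ℕ) :
    MvPowerSeries.coeff (d.sumElim e) (F * inY g) = ∑ p ∈ Finset.HasAntidiagonal.antidiagonal e,
      MvPowerSeries.coeff (d.sumElim p.1) F * MvPowerSeries.coeff p.2 g := by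
  classical
  rw [MvPowerSeries.coeff_mul]
  symm
  refine Finset.sum_of_injOn (fun p => (d.sumElim p.1, Finsupp.sumElim 0 p.2)) ?_ ?_ ?_ ?_
  · intro p _ q _ h
    obtain ⟨h1, h2⟩ := Prod.mk.inj h
    ext i
    · exact DFunLike.congr_fun h1 (Sum.inr i)
    · exact DFunLike.congr_fun h2 (Sum.inr i)
  · intro p hp
    rw [Finset.mem_coe, Finset.HasAntidiagonal.mem_antidiagonal] at hp ⊢
    rw [← hp]
    ext (i | i) <;> simp
  · rintro ⟨a, b⟩ hab hn
    obtain ⟨a1, a2, rfl⟩ := exists_eq_sumElim a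
    obtain ⟨b1, b2, rfl⟩ := exists_eq_sumElim b
    rw [coeff_sumElim_inY]
    split_ifs with h
    · exfalso
      apply hn
      subst h
      rw [Finset.HasAntidiagonal.mem_antidiagonal] at hab
      have h1 : a1 = d := by
        ext i
        simpa using DFunLike.congr_fun hab (Sum.inl i)
      subst h1
      refine ⟨(a2, b2), ?_, rfl⟩
      rw [Finset.mem_coe, Finset.HasAntidiagonal.mem_antidiagonal]
      ext i
      simpa using DFunLike.congr_fun hab (Sum.inr i)
    · rw [mul_zero]
  · intro p _
    rw [coeff_sumElim_inY, if_pos rfl]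

theorem coeff_inX_mul_inY (f g : BetaSeries) (d e : ℕ →₀ ℕ) :
    MvPowerSeries.coeff (d.sumElim e) (inX f * inY g) =
      MvPowerSeries.coeff d f * MvPowerSeries.coeff e g := by
  classical
  rw [coeff_mul_inY, Finset.sum_eq_single (0, e)]
  · rw [coeff_sumElim_inX, if_pos rfl]
  · rintro ⟨a, b⟩ hab hne
    rw [coeff_sumElim_inX, if_neg, zero_mul]
    rintro rfl
    rw [Finset.HasAntidiagonal.mem_antidiagonal, zero_add] at hab
    exact hne (congrArg _ hab)
  · intro h
    simp at h

/-- The Cauchy identity in terms of coefficients, which are finite sums. -/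
theorem cauchyIdentity_iff {G g : StrictPartition → BetaSeries}
    (hG : ∀ lam d, MvPowerSeries.coeff d (G lam) ≠ 0 → lam.size ≤ d.degree) :
    letI : TopologicalSpace ℤ[X] := ⊥
    CauchyIdentity G g ↔ ∃ K : BetaSeries₂, HasProd cauchyFactor K ∧ ∀ d e : ℕ →₀ ℕ,
      MvPowerSeries.coeff (d.sumElim e) K = ∑ lam ∈ sizeLE d.degree,
        MvPowerSeries.coeff d (G lam) * MvPowerSeries.coeff e (g lam) := by
  let _ : TopologicalSpace ℤ[X] := ⊥
  have : DiscreteTopology ℤ[X] := ⟨rfl⟩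
  refine exists_congr fun K => and_congr_right fun _ => ?_
  rw [MvPowerSeries.WithPiTopology.hasSum_iff_hasSum_coeff]
  have key : ∀ d e : ℕ →₀ ℕ, HasSum
      (fun lam => MvPowerSeries.coeff (d.sumElim e) (inX (G lam) * inY (g lam)))
      (∑ lam ∈ sizeLE d.degree, MvPowerSeries.coeff d (G lam) * MvPowerSeries.coeff e (g lam)) := by
    intro d e
    simp only [coeff_inX_mul_inY]
    refine hasSum_sum_of_ne_finset_zero fun lam hlam => ?_
    rw [mem_sizeLE] at hlam
    by_cases h : MvPowerSeries.coeff d (G lam) = 0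
    · rw [h, zero_mul]
    · exact absurd (hG lam d h) hlam
  constructor
  · intro h d e
    exact (h (d.sumElim e)).unique (key d e)
  · intro h c
    obtain ⟨d, e, rfl⟩ := exists_eq_sumElim c
    rw [h]
    exact key d e

/-- Comparing coefficients at the monomials `x^λ` determines the dual family by triangularity. -/
theorem CauchyIdentity.unique {G : StrictPartition → BetaSeries} (hG : IsTriangular G)
    {g g' : StrictPartition → BetaSeries} (h : CauchyIdentity G g) (h' : CauchyIdentity G g') :
    g = g' := by
  let _ : TopologicalSpace ℤ[X] := ⊥
  have : DiscreteTopology ℤ[X] := ⟨rfl⟩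
  obtain ⟨K, hK, h1⟩ := (cauchyIdentity_iff hG.size_le).mp h
  obtain ⟨K', hK', h2⟩ := (cauchyIdentity_iff hG.size_le).mp h'
  obtain rfl := hK.unique hK'
  funext lam
  induction hr : lam.rank using WellFoundedLT.induction generalizing lam with
  | _ r ih =>
    subst hr
    ext1 e
    have h3 := (h1 lam.expo e).symm.trans (h2 lam.expo e)
    rw [← sub_eq_zero, ← Finset.sum_sub_distrib, Finset.sum_eq_single lam, ← mul_sub,
      mul_eq_zero, or_iff_right (hG.diag lam), sub_eq_zero] at h3
    · exact h3
    · intro mu _ hne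
      by_cases h4 : MvPowerSeries.coeff lam.expo (G mu) = 0
      · rw [h4, zero_mul, zero_mul, sub_self]
      · rcases hG.rank_lt lam mu h4 with h5 | h5
        · rw [ih _ h5 mu rfl, sub_self]
        · exact absurd h5 hne
    · intro h4
      rw [mem_sizeLE, lam.degree_expo] at h4
      exact absurd le_rfl h4

/-- The combination of the `gp_μ` with the coefficients of `GP_λ` in the expansions of the `GQ_μ`:
the transposed change of basis. -/
noncomputable def dualExpansion (gp : StrictPartition → BetaSeries) (lam : StrictPartition) :
    BetaSeries :=
  ∑ mu ∈ lam.verticalStrips, MvPowerSeries.C (stripCoeff (X : ℤ[X]) mu lam) * gp mu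

/-- Substituting the expansion of `GQ` in terms of `GP` into the Cauchy identity and exchanging the
sums. -/
theorem CauchyIdentity.dualExpansion {gp : StrictPartition → BetaSeries}
    (h : CauchyIdentity GQ gp) : CauchyIdentity GP (dualExpansion gp) := by
  let _ : TopologicalSpace ℤ[X] := ⊥
  obtain ⟨K, hK, h1⟩ := (cauchyIdentity_iff isTriangular_GQ.size_le).mp h
  refine (cauchyIdentity_iff isTriangular_GP.size_le).mpr ⟨K, hK, fun d e => ?_⟩
  rw [h1]
  simp only [_root_.dualExpansion, map_sum, MvPowerSeries.coeff_C_mul, coeff_GQ_eq_sum,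
    Finset.sum_mul, Finset.mul_sum]
  symm
  rw [Finset.sum_comm' (t' := sizeLE d.degree)
    (s' := fun mu => mu.ups.filter fun lam => lam.size ≤ d.degree)]
  · refine Finset.sum_congr rfl fun mu _ => ?_
    rw [Finset.sum_filter]
    refine Finset.sum_congr rfl fun lam _ => ?_
    split_ifs with h2
    · ring
    · have : MvPowerSeries.coeff d (GP lam) = 0 := by
        by_contra h3
        exact h2 (isTriangular_GP.size_le lam d h3)
      rw [this]
      ring
  · intro lam mu
    rw [mem_sizeLE, mem_sizeLE, StrictPartition.mem_verticalStrips, Finset.mem_filter,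
      StrictPartition.mem_ups]
    constructor
    · rintro ⟨h2, h3⟩
      have := isUp_size h3
      exact ⟨⟨h3, h2⟩, by omega⟩
    · rintro ⟨⟨h2, h3⟩, _⟩
      exact ⟨h3, h2⟩

theorem toRat_dualExpansion (gp : StrictPartition → BetaSeries) (lam : StrictPartition) :
    toRat (dualExpansion gp lam) = (2 : ℚ[X]) ^ lam.length •
      ∑ mu ∈ lam.verticalStrips,
        ((-1 : ℚ[X]) ^ StrictPartition.cols lam mu *
          (-(C (1 / 2 : ℚ) * X)) ^ (StrictPartition.skew lam mu).card) • toRat (gp mu) := by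
  rw [dualExpansion, map_sum, Finset.smul_sum]
  refine Finset.sum_congr rfl fun mu hmu => ?_
  rw [StrictPartition.mem_verticalStrips] at hmu
  have hlen : lam.length = mu.length := ((StrictPartition.isUp_iff mu lam).mp hmu).2.1.symm
  have hk := StrictPartition.card_skew_le_length hmu
  rw [map_mul, smul_smul, MvPowerSeries.smul_eq_C_mul]
  congr 1
  rw [toRat, MvPowerSeries.map_C, Polynomial.coe_mapRingHom, stripCoeff, hlen]
  congr 1
  -- `stripCoeff` contains `2 ^ (ℓ(μ) - |λ/μ|)`, where the subtraction does not truncate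
  obtain ⟨m, hm⟩ := Nat.exists_eq_add_of_le hk
  have h2 : (2 : ℚ[X]) * C (1 / 2 : ℚ) = 1 := by
    rw [show (2 : ℚ[X]) = C 2 from rfl, ← C_mul]
    norm_num
  rw [hm, Nat.add_sub_cancel_left]
  simp only [Polynomial.map_mul, Polynomial.map_pow, Polynomial.map_neg, Polynomial.map_one,
    Polynomial.map_ofNat, Polynomial.map_X]
  generalize (StrictPartition.skew lam mu).card = k
  have h3 : (2 : ℚ[X]) ^ k * C (1 / 2 : ℚ) ^ k = 1 := by rw [← mul_pow, h2, one_pow]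
  rw [neg_pow (X : ℚ[X]), neg_pow (C (1 / 2 : ℚ) * X), mul_pow, pow_add]
  linear_combination (-(-1) ^ StrictPartition.cols lam mu * 2 ^ m * (-1) ^ k * X ^ k) * h3

/-! ### Power series divisible by `x ⊕ y` or by `x ⊕ x` -/

section Divisibility

variable {σ R : Type*} [CommRing R]

theorem coeff_add_X_mul (u : σ) (d : σ →₀ ℕ) (g : MvPowerSeries σ R) :
    MvPowerSeries.coeff (d + Finsupp.single u 1) (MvPowerSeries.X u * g) =
      MvPowerSeries.coeff d g := by
  rw [MvPowerSeries.X, add_comm, MvPowerSeries.coeff_add_monomial_mul, one_mul]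

theorem coeff_X_mul_eq_zero {u : σ} {d : σ →₀ ℕ} (hd : d u = 0) (g : MvPowerSeries σ R) :
    MvPowerSeries.coeff d (MvPowerSeries.X u * g) = 0 :=
  MvPowerSeries.X_dvd_iff.mp (Dvd.intro _ rfl) d hd

theorem coeff_add_add_kadd_mul (b : R) (u v : σ) (d : σ →₀ ℕ) (g : MvPowerSeries σ R) :
    MvPowerSeries.coeff (d + Finsupp.single u 1 + Finsupp.single v 1)
        (kadd (MvPowerSeries.C b) (MvPowerSeries.X u) (MvPowerSeries.X v) * g) =
      MvPowerSeries.coeff (d + Finsupp.single v 1) g +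
        MvPowerSeries.coeff (d + Finsupp.single u 1) g + b * MvPowerSeries.coeff d g := by
  have h : kadd (MvPowerSeries.C b) (MvPowerSeries.X u) (MvPowerSeries.X v) * g =
      MvPowerSeries.X u * g + MvPowerSeries.X v * g +
        MvPowerSeries.C b * (MvPowerSeries.X v * (MvPowerSeries.X u * g)) := by
    unfold kadd
    ring
  rw [h, map_add, map_add, MvPowerSeries.coeff_C_mul, coeff_add_X_mul, coeff_add_X_mul,
    coeff_add_X_mul, add_right_comm d, coeff_add_X_mul]

theorem coeff_add_kadd_mul (b : R) {u v : σ} (huv : u ≠ v) {d : σ →₀ ℕ} (hd : d v = 0)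
    (g : MvPowerSeries σ R) :
    MvPowerSeries.coeff (d + Finsupp.single u 1)
        (kadd (MvPowerSeries.C b) (MvPowerSeries.X u) (MvPowerSeries.X v) * g) =
      MvPowerSeries.coeff d g := by
  have h : kadd (MvPowerSeries.C b) (MvPowerSeries.X u) (MvPowerSeries.X v) * g =
      MvPowerSeries.X u * g +
        MvPowerSeries.X v * (g + MvPowerSeries.C b * MvPowerSeries.X u * g) := by
    unfold kadd
    ring
  rw [h, map_add, coeff_add_X_mul, coeff_X_mul_eq_zero, add_zero]
  rw [Finsupp.add_apply, hd, Finsupp.single_eq_of_ne huv.symm, add_zero]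

/-- The coefficients of a quotient by `x_u ⊕ x_v` are determined by recursion on the exponent of
`x_v`. -/
theorem coeff_eq_zero_of_kadd_mul (b : R) {u v : σ} (huv : u ≠ v) {g : MvPowerSeries σ R}
    {G : Set (σ →₀ ℕ)}
    (h0 : ∀ d ∈ G, MvPowerSeries.coeff (d + Finsupp.single u 1)
      (kadd (MvPowerSeries.C b) (MvPowerSeries.X u) (MvPowerSeries.X v) * g) = 0)
    (h1 : ∀ d, d + Finsupp.single v 1 ∈ G → d + Finsupp.single u 1 ∈ G)
    (h2 : ∀ d, d + Finsupp.single v 1 ∈ G → d ∈ G) (d : σ →₀ ℕ) (hd : d ∈ G) :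
    MvPowerSeries.coeff d g = 0 := by
  induction hk : d v generalizing d with
  | zero => rw [← coeff_add_kadd_mul b huv hk, h0 d hd]
  | succ k ih =>
    obtain ⟨c, rfl⟩ : ∃ c, d = c + Finsupp.single v 1 := by
      refine ⟨d - Finsupp.single v 1, (tsub_add_cancel_of_le ?_).symm⟩
      rw [Finsupp.single_le_iff]
      omega
    have hc : c v = k := by simpa using hk
    have h3 := coeff_add_add_kadd_mul b u v c g
    rw [add_right_comm, h0 _ hd, ih _ (h2 c hd) hc, ih _ (h1 c hd)] at h3
    · simpa using h3.symm
    · rw [Finsupp.add_apply, hc, Finsupp.single_eq_of_ne huv.symm, add_zero]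

/-- In lowest degree, multiplication by `∏ (2 + b x_u)` is multiplication by a power of `2`. -/
theorem two_pow_card_dvd_coeff [IsDomain R] [CharZero R] (b : R) (t : Finset σ)
    {S : Set (σ →₀ ℕ)} {wt : (σ →₀ ℕ) → ℕ} (hS : ∀ d, ∀ u ∈ t, d + Finsupp.single u 1 ∈ S → d ∈ S)
    (hwt : ∀ d, ∀ u ∈ t, wt (d + Finsupp.single u 1) = wt d + 1) {D : ℕ} (g : MvPowerSeries σ R)
    (h : ∀ d ∈ S, wt d < D → MvPowerSeries.coeff d
      ((∏ u ∈ t, (2 + MvPowerSeries.C b * MvPowerSeries.X u)) * g) = 0)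
    (d : σ →₀ ℕ) (hd : d ∈ S) (hD : wt d = D) :
    2 ^ t.card ∣ MvPowerSeries.coeff d
      ((∏ u ∈ t, (2 + MvPowerSeries.C b * MvPowerSeries.X u)) * g) := by
  classical
  induction t using Finset.induction_on with
  | empty => simp
  | insert u t hu ih =>
    set P := (∏ u ∈ t, (2 + MvPowerSeries.C b * MvPowerSeries.X u)) * g with hP
    have hmul : (∏ u ∈ insert u t, (2 + MvPowerSeries.C b * MvPowerSeries.X u)) * g =
        MvPowerSeries.C 2 * P + MvPowerSeries.C b * (MvPowerSeries.X u * P) := by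
      rw [Finset.prod_insert hu, hP, map_ofNat]
      ring
    rw [hmul] at h ⊢
    simp only [map_add, MvPowerSeries.coeff_C_mul] at h ⊢
    have hle : ∀ k, ∀ c ∈ S, c u = k → wt c < D → MvPowerSeries.coeff c P = 0 := by
      intro k
      induction k with
      | zero =>
        intro c hc hk hlt
        have := h c hc hlt
        rw [coeff_X_mul_eq_zero hk, mul_zero, add_zero] at this
        exact (mul_eq_zero.mp this).resolve_left two_ne_zero
      | succ k ihk =>
        intro c hc hk hlt
        obtain ⟨c, rfl⟩ : ∃ c', c = c' + Finsupp.single u 1 := by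
          refine ⟨c - Finsupp.single u 1, (tsub_add_cancel_of_le ?_).symm⟩
          rw [Finsupp.single_le_iff]
          omega
        have hmem := Finset.mem_insert_self u t
        have := h _ hc hlt
        rw [coeff_add_X_mul, ihk c (hS c u hmem hc) (by simpa using hk)
          (by rw [hwt c u hmem] at hlt; omega), mul_zero, add_zero] at this
        exact (mul_eq_zero.mp this).resolve_left two_ne_zero
    have hX : MvPowerSeries.coeff d (MvPowerSeries.X u * P) = 0 := by
      by_cases hk : d u = 0
      · exact coeff_X_mul_eq_zero hk P
      · obtain ⟨c, rfl⟩ : ∃ c, d = c + Finsupp.single u 1 := by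
          refine ⟨d - Finsupp.single u 1, (tsub_add_cancel_of_le ?_).symm⟩
          rw [Finsupp.single_le_iff]
          omega
        have hmem := Finset.mem_insert_self u t
        rw [hwt c u hmem] at hD
        rw [coeff_add_X_mul, hle _ c (hS c u hmem hd) rfl (by omega)]
    rw [hX, mul_zero, add_zero, Finset.card_insert_of_notMem hu, pow_succ']
    refine mul_dvd_mul_left _ (ih (fun d v hv => hS d v (Finset.mem_insert_of_mem hv))
      (fun d v hv => hwt d v (Finset.mem_insert_of_mem hv)) fun c hc hlt => hle _ c hc rfl hlt)

/-- The power series without monomials having exponents in `D`. -/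
def vanishingOn (R : Type*) [CommRing R] (D : Set (σ →₀ ℕ)) : Submodule R (MvPowerSeries σ R) where
  carrier := {p | ∀ d ∈ D, MvPowerSeries.coeff d p = 0}
  add_mem' hp hq d hd := by rw [map_add, hp d hd, hq d hd, add_zero]
  zero_mem' d _ := by rw [map_zero]
  smul_mem' a p hp d hd := by rw [MvPowerSeries.coeff_smul, hp d hd, mul_zero]

/-- The subring of power series in which the variables in `V` do not occur. -/
def freeOf (R : Type*) [CommRing R] (V : Set σ) : Subring (MvPowerSeries σ R) where
  carrier := {p | ∀ d : σ →₀ ℕ, (∃ v ∈ V, d v ≠ 0) → MvPowerSeries.coeff d p = 0}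
  add_mem' hp hq d hd := by rw [map_add, hp d hd, hq d hd, add_zero]
  zero_mem' d _ := by rw [map_zero]
  neg_mem' hp d hd := by rw [map_neg, hp d hd, neg_zero]
  one_mem' d hd := by
    classical
    rw [MvPowerSeries.coeff_one, if_neg]
    rintro rfl
    simp at hd
  mul_mem' {p q} hp hq d hd := by
    classical
    obtain ⟨v, hv, hne⟩ := hd
    rw [MvPowerSeries.coeff_mul]
    refine Finset.sum_eq_zero fun c hc => ?_
    rw [Finset.HasAntidiagonal.mem_antidiagonal] at hc
    by_cases h : c.1 v = 0
    · rw [hq c.2 ⟨v, hv, fun h2 => hne (by rw [← hc, Finsupp.add_apply, h, h2])⟩, mul_zero]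
    · rw [hp c.1 ⟨v, hv, h⟩, zero_mul]

theorem mem_vanishingOn {D : Set (σ →₀ ℕ)} {p : MvPowerSeries σ R} :
    p ∈ vanishingOn R D ↔ ∀ d ∈ D, MvPowerSeries.coeff d p = 0 := Iff.rfl

theorem mem_freeOf {V : Set σ} {p : MvPowerSeries σ R} : p ∈ freeOf R V ↔
    ∀ d : σ →₀ ℕ, (∃ v ∈ V, d v ≠ 0) → MvPowerSeries.coeff d p = 0 := Iff.rfl

theorem C_mem_freeOf (V : Set σ) (b : R) : MvPowerSeries.C b ∈ freeOf R V := by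
  classical
  rw [mem_freeOf]
  rintro d ⟨v, _, h⟩
  rw [MvPowerSeries.coeff_C, if_neg]
  rintro rfl
  exact h rfl

theorem X_mem_freeOf {V : Set σ} {u : σ} (hu : u ∉ V) :
    (MvPowerSeries.X u : MvPowerSeries σ R) ∈ freeOf R V := by
  classical
  rw [mem_freeOf]
  rintro d ⟨v, hv, h⟩
  rw [MvPowerSeries.coeff_X, if_neg]
  rintro rfl
  rw [Finsupp.single_apply, ite_ne_right_iff] at h
  exact hu (h.1 ▸ hv)

/-- The monomials divisible by all variables in `V` cannot be produced by multiplication with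
variables outside `V`. -/
theorem mul_mem_vanishingOn {V : Set σ} {a p : MvPowerSeries σ R} (ha : a ∈ freeOf R V)
    (hp : p ∈ vanishingOn R {d | ∀ v ∈ V, d v ≠ 0}) :
    a * p ∈ vanishingOn R {d | ∀ v ∈ V, d v ≠ 0} := by
  classical
  rw [mem_vanishingOn] at hp ⊢
  intro d hd
  rw [MvPowerSeries.coeff_mul]
  refine Finset.sum_eq_zero fun c hc => ?_
  rw [Finset.HasAntidiagonal.mem_antidiagonal] at hc
  by_cases h : ∃ v ∈ V, c.1 v ≠ 0
  · rw [ha c.1 h, zero_mul]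
  · push Not at h
    rw [hp c.2, mul_zero]
    intro v hv
    have := hd v hv
    rwa [← hc, Finsupp.add_apply, h v hv, zero_add] at this

/-- A quotient of series free of `V` is free of `V`. -/
theorem mem_freeOf_of_one_sub_mul {V : Set σ} {a g : MvPowerSeries σ R} (ha : a ∈ freeOf R V)
    (h0 : MvPowerSeries.constantCoeff a = 0) (h : (1 - a) * g ∈ freeOf R V) : g ∈ freeOf R V := by
  classical
  rw [mem_freeOf]
  intro d
  induction hk : d.degree using Nat.strong_induction_on generalizing d with
  | _ k ih =>
    intro hd
    have h1 : g = (1 - a) * g + a * g := by ring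
    rw [h1, map_add, h d hd, zero_add, MvPowerSeries.coeff_mul]
    refine Finset.sum_eq_zero fun c hc => ?_
    rw [Finset.HasAntidiagonal.mem_antidiagonal] at hc
    by_cases h2 : ∃ v ∈ V, c.1 v ≠ 0
    · rw [ha c.1 h2, zero_mul]
    · by_cases h3 : c.1 = 0
      · rw [h3, MvPowerSeries.coeff_zero_eq_constantCoeff_apply, h0, zero_mul]
      · push Not at h2
        obtain ⟨v, hv, hne⟩ := hd
        rw [ih c.2.degree ?_ c.2 rfl ⟨v, hv, ?_⟩, mul_zero]
        · rw [← hk, ← hc, map_add]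
          have := Nat.pos_of_ne_zero (fun h => h3 ((Finsupp.degree_eq_zero_iff c.1).mp h))
          omega
        · rwa [← hc, Finsupp.add_apply, h2 v hv, zero_add] at hne

end Divisibility

/-! ### Series with the `K`-theoretic `Q`-cancellation property -/

/-- The `x`-degree of an exponent vector in two alphabets. -/
noncomputable def xDegree : (ℕ ⊕ ℕ →₀ ℕ) →+ ℕ :=
  Finsupp.liftAddHom (Sum.elim (fun _ => AddMonoidHom.id ℕ) fun _ => 0)

/-- The statistic `∑ i · d_i` of the `x`-part of an exponent vector in two alphabets. -/
noncomputable def xStat : (ℕ ⊕ ℕ →₀ ℕ) →+ ℕ :=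
  Finsupp.liftAddHom (Sum.elim (fun i => AddMonoidHom.mulLeft i) fun _ => 0)

theorem xDegree_single (i a : ℕ) : xDegree (Finsupp.single (Sum.inl i) a) = a := by
  simp [xDegree]

theorem xStat_single (i a : ℕ) : xStat (Finsupp.single (Sum.inl i) a) = i * a := by
  simp [xStat]

theorem xDegree_sumElim (d e : ℕ →₀ ℕ) : xDegree (d.sumElim e) = d.degree := by
  classical
  have h1 : ∀ d : ℕ →₀ ℕ, xDegree (d.sumElim 0) = d.degree := by
    intro d
    induction d using Finsupp.induction_linear with
    | zero =>
      rw [show Finsupp.sumElim (0 : ℕ →₀ ℕ) (0 : ℕ →₀ ℕ) = 0 by ext (i | i) <;> rfl]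
      simp
    | add f g hf hg =>
      rw [show (f + g).sumElim (0 : ℕ →₀ ℕ) = f.sumElim 0 + g.sumElim 0 by ext (i | i) <;> simp,
        map_add, hf, hg, map_add]
    | single i a =>
      rw [show (Finsupp.single i a).sumElim (0 : ℕ →₀ ℕ) = Finsupp.single (Sum.inl i) a by
        ext (j | j) <;> simp [Finsupp.single_apply], xDegree_single, Finsupp.degree_single]
  have h2 : ∀ e : ℕ →₀ ℕ, xDegree (Finsupp.sumElim (0 : ℕ →₀ ℕ) e) = 0 := by
    intro e
    induction e using Finsupp.induction_linear with
    | zero =>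
      rw [show Finsupp.sumElim (0 : ℕ →₀ ℕ) (0 : ℕ →₀ ℕ) = 0 by ext (i | i) <;> rfl]
      simp
    | add f g hf hg =>
      rw [show Finsupp.sumElim (0 : ℕ →₀ ℕ) (f + g) = Finsupp.sumElim 0 f + Finsupp.sumElim 0 g by
        ext (i | i) <;> simp, map_add, hf, hg]
    | single i a =>
      rw [show Finsupp.sumElim (0 : ℕ →₀ ℕ) (Finsupp.single i a) = Finsupp.single (Sum.inr i) a by
        ext (j | j) <;> simp [Finsupp.single_apply], xDegree, Finsupp.liftAddHom_apply_single]
      rfl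
  rw [show d.sumElim e = d.sumElim 0 + Finsupp.sumElim 0 e by ext (i | i) <;> simp, map_add, h1, h2,
    add_zero]

/-- The exponent vectors that only involve the variables `x_i` with `i < n` and `y_j` with
`j < m`. -/
def box (n m : ℕ) : Set (ℕ ⊕ ℕ →₀ ℕ) :=
  {d | (∀ i, n ≤ i → d (Sum.inl i) = 0) ∧ ∀ j, m ≤ j → d (Sum.inr j) = 0}

/-- The parameter `β` as a series. -/
noncomputable def betaConst : BetaSeries₂ := MvPowerSeries.C (X : ℤ[X])

/-- Exchanging the variables `x_i` and `x_{i+1}`. -/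
noncomputable def swapX (i : ℕ) : BetaSeries₂ →ₐ[ℤ[X]] BetaSeries₂ :=
  MvPowerSeries.rename (Equiv.swap (Sum.inl i : ℕ ⊕ ℕ) (Sum.inl (i + 1))).toEmbedding

/-- The `K`-theoretic `Q`-cancellation property in the variables `x_0, …, x_{n-1}`: the series is
symmetric, it does not depend on `t` after the substitution `x_i = t`, `x_{i+1} = ⊖t` (stated as a
divisibility by `x_i ⊕ x_{i+1}` up to a series free of these variables), and the part that involves
all `n` variables is divisible by the product of the `x_i ⊕ x_i`. -/
structure QCancels (n : ℕ) (p : BetaSeries₂) : Prop where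
  swap : ∀ i, i + 1 < n → swapX i p = p
  cancel : ∀ i, i + 1 < n → ∃ p₀ ∈ freeOf ℤ[X] {(Sum.inl i : ℕ ⊕ ℕ), Sum.inl (i + 1)},
    ∃ g, p = p₀ + kadd betaConst (xVar i) (xVar (i + 1)) * g
  full : ∃ g, ∃ m ∈ vanishingOn ℤ[X] {d | ∀ v ∈ (Sum.inl '' Set.Iio n : Set (ℕ ⊕ ℕ)), d v ≠ 0},
    p = (∏ i ∈ Finset.range n, kadd betaConst (xVar i) (xVar i)) * g + m

/-- The series all of whose truncations to finitely many variables extend to series with the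
`K`-theoretic `Q`-cancellation property. -/
def IsQSeries (f : BetaSeries₂) : Prop :=
  ∀ n m, ∃ p, QCancels n p ∧ ∀ d ∈ box n m, MvPowerSeries.coeff d f = MvPowerSeries.coeff d p

/-- Agreement of coefficients in a box is multiplicative. -/
theorem coeff_mul_congr {n m : ℕ} {f f' p p' : BetaSeries₂}
    (hf : ∀ d ∈ box n m, MvPowerSeries.coeff d f = MvPowerSeries.coeff d f')
    (hp : ∀ d ∈ box n m, MvPowerSeries.coeff d p = MvPowerSeries.coeff d p') :
    ∀ d ∈ box n m, MvPowerSeries.coeff d (f * p) = MvPowerSeries.coeff d (f' * p') := by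
  classical
  intro d hd
  rw [MvPowerSeries.coeff_mul, MvPowerSeries.coeff_mul]
  refine Finset.sum_congr rfl fun c hc => ?_
  rw [Finset.HasAntidiagonal.mem_antidiagonal] at hc
  have h : ∀ v, c.1 v + c.2 v = d v := fun v => by rw [← hc, Finsupp.add_apply]
  rw [hf c.1, hp c.2]
  · refine ⟨fun i hi => ?_, fun j hj => ?_⟩
    · have := h (Sum.inl i)
      have := hd.1 i hi
      omega
    · have := h (Sum.inr j)
      have := hd.2 j hj
      omega
  · refine ⟨fun i hi => ?_, fun j hj => ?_⟩
    · have := h (Sum.inl i)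
      have := hd.1 i hi
      omega
    · have := h (Sum.inr j)
      have := hd.2 j hj
      omega

theorem QCancels.sub {n : ℕ} {p q : BetaSeries₂} (hp : QCancels n p) (hq : QCancels n q) :
    QCancels n (p - q) where
  swap i hi := by rw [map_sub, hp.swap i hi, hq.swap i hi]
  cancel i hi := by
    obtain ⟨p₀, hp₀, g, hg⟩ := hp.cancel i hi
    obtain ⟨q₀, hq₀, g', hg'⟩ := hq.cancel i hi
    refine ⟨p₀ - q₀, sub_mem hp₀ hq₀, g - g', ?_⟩
    rw [hg, hg']
    ring
  full := by
    obtain ⟨g, m, hm, hg⟩ := hp.full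
    obtain ⟨g', m', hm', hg'⟩ := hq.full
    refine ⟨g - g', m - m', sub_mem hm hm', ?_⟩
    rw [hg, hg']
    ring

theorem inY_mem_freeOf {V : Set (ℕ ⊕ ℕ)} (hV : V ⊆ Set.range Sum.inl) (c : BetaSeries) :
    inY c ∈ freeOf ℤ[X] V := by
  rw [mem_freeOf]
  rintro d ⟨v, hv, h⟩
  obtain ⟨i, rfl⟩ := hV hv
  obtain ⟨d, e, rfl⟩ := exists_eq_sumElim d
  rw [coeff_sumElim_inY, if_neg]
  rintro rfl
  exact h rfl

theorem swapX_inY (i : ℕ) (c : BetaSeries) : swapX i (inY c) = inY c := by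
  rw [swapX, inY, MvPowerSeries.rename_rename]
  have : (Equiv.swap (Sum.inl i : ℕ ⊕ ℕ) (Sum.inl (i + 1))).toEmbedding ∘
      (Function.Embedding.inr : ℕ ↪ ℕ ⊕ ℕ) = (Function.Embedding.inr : ℕ ↪ ℕ ⊕ ℕ) := by
    funext j
    exact Equiv.swap_apply_of_ne_of_ne Sum.inr_ne_inl Sum.inr_ne_inl
  congr!

theorem QCancels.mul_inY {n : ℕ} {p : BetaSeries₂} (hp : QCancels n p) (c : BetaSeries) :
    QCancels n (p * inY c) where
  swap i hi := by rw [map_mul, hp.swap i hi, swapX_inY]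
  cancel i hi := by
    obtain ⟨p₀, hp₀, g, hg⟩ := hp.cancel i hi
    refine ⟨p₀ * inY c, mul_mem hp₀ (inY_mem_freeOf ?_ c), g * inY c, ?_⟩
    · rintro v (rfl | rfl) <;> exact ⟨_, rfl⟩
    · rw [hg]
      ring
  full := by
    obtain ⟨g, m, hm, hg⟩ := hp.full
    refine ⟨g * inY c, inY c * m, mul_mem_vanishingOn (inY_mem_freeOf ?_ c) hm, ?_⟩
    · rintro v ⟨i, _, rfl⟩
      exact ⟨i, rfl⟩
    · rw [hg]
      ring

theorem IsQSeries.sub {f g : BetaSeries₂} (hf : IsQSeries f) (hg : IsQSeries g) :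
    IsQSeries (f - g) := by
  intro n m
  obtain ⟨p, hp, h1⟩ := hf n m
  obtain ⟨q, hq, h2⟩ := hg n m
  exact ⟨p - q, hp.sub hq, fun d hd => by rw [map_sub, map_sub, h1 d hd, h2 d hd]⟩

theorem IsQSeries.mul_inY {f : BetaSeries₂} (hf : IsQSeries f) (c : BetaSeries) :
    IsQSeries (f * inY c) := by
  intro n m
  obtain ⟨p, hp, h1⟩ := hf n m
  exact ⟨p * inY c, hp.mul_inY c, coeff_mul_congr h1 fun _ _ => rfl⟩

theorem IsQSeries.sub_sum {ι : Type*} (s : Finset ι) {f : BetaSeries₂} {g : ι → BetaSeries₂}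
    (hf : IsQSeries f) (hg : ∀ i, IsQSeries (g i)) : IsQSeries (f - ∑ i ∈ s, g i) := by
  classical
  induction s using Finset.induction_on with
  | empty => simpa using hf
  | insert i s hi ih =>
    rw [Finset.sum_insert hi, sub_add_eq_sub_sub_swap]
    exact ih.sub (hg i)

/-- Exchanging the exponents of `x_i` and `x_{i+1}`. -/
theorem IsQSeries.coeff_swap {f : BetaSeries₂} (hf : IsQSeries f) (i : ℕ) {c d : ℕ ⊕ ℕ →₀ ℕ}
    (h1 : d (Sum.inl i) = c (Sum.inl (i + 1))) (h2 : d (Sum.inl (i + 1)) = c (Sum.inl i))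
    (h3 : ∀ v, v ≠ Sum.inl i → v ≠ Sum.inl (i + 1) → d v = c v) :
    MvPowerSeries.coeff d f = MvPowerSeries.coeff c f := by
  obtain ⟨n, m, hi, hd, hc⟩ : ∃ n m, i + 1 < n ∧ d ∈ box n m ∧ c ∈ box n m := by
    obtain ⟨a, b, rfl⟩ := exists_eq_sumElim c
    obtain ⟨n, hn⟩ := exists_forall_le_eq_zero a
    obtain ⟨m, hm⟩ := exists_forall_le_eq_zero b
    refine ⟨n + i + 2, m, by omega, ⟨fun j hj => ?_, fun j hj => ?_⟩,
      ⟨fun j hj => ?_, fun j hj => ?_⟩⟩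
    · rw [h3 _ (by simp; omega) (by simp; omega)]
      exact hn j (by omega)
    · rw [h3 _ (by simp) (by simp)]
      exact hm j hj
    · exact hn j (by omega)
    · exact hm j hj
  obtain ⟨p, hp, hfp⟩ := hf n m
  rw [hfp d hd, hfp c hc]
  nth_rw 1 [← hp.swap i hi]
  have : d =
      Finsupp.embDomain (Equiv.swap (Sum.inl i : ℕ ⊕ ℕ) (Sum.inl (i + 1))).toEmbedding c := by
    ext v
    obtain ⟨w, rfl⟩ := (Equiv.swap (Sum.inl i : ℕ ⊕ ℕ) (Sum.inl (i + 1))).surjective v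
    refine Eq.trans ?_ (Finsupp.embDomain_apply_self
      (Equiv.swap (Sum.inl i : ℕ ⊕ ℕ) (Sum.inl (i + 1))).toEmbedding c w).symm
    by_cases hw1 : w = Sum.inl i
    · rw [hw1, Equiv.swap_apply_left, h2]
    · by_cases hw2 : w = Sum.inl (i + 1)
      · rw [hw2, Equiv.swap_apply_right, h1]
      · rw [Equiv.swap_apply_of_ne_of_ne hw1 hw2, h3 w hw1 hw2]
  rw [this, swapX]
  exact MvPowerSeries.coeff_embDomain_rename _ _ _

/-! ### A series with the cancellation property is determined by its coefficients at `x^λ` -/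

/-- Moving exponents from `x_{i+1}` to `x_i` preserves the degree and lowers `∑ i · d_i`. -/
theorem xDegree_eq_and_xStat_lt {i t : ℕ} (ht : 0 < t) {c d : ℕ ⊕ ℕ →₀ ℕ}
    (h1 : c (Sum.inl i) = d (Sum.inl i) + t) (h2 : c (Sum.inl (i + 1)) + t = d (Sum.inl (i + 1)))
    (h3 : ∀ v, v ≠ Sum.inl i → v ≠ Sum.inl (i + 1) → c v = d v) :
    xDegree c = xDegree d ∧ xStat c < xStat d := by
  classical
  have h : c + Finsupp.single (Sum.inl (i + 1)) t = d + Finsupp.single (Sum.inl i) t := by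
    ext v
    rw [Finsupp.add_apply, Finsupp.add_apply, Finsupp.single_apply, Finsupp.single_apply]
    by_cases hv1 : v = Sum.inl i
    · subst hv1
      simp [h1]
    · by_cases hv2 : v = Sum.inl (i + 1)
      · subst hv2
        simp [h2]
      · rw [h3 v hv1 hv2, if_neg (Ne.symm hv2), if_neg (Ne.symm hv1)]
  have hD := congrArg xDegree h
  have hS := congrArg xStat h
  rw [map_add, map_add, xDegree_single, xDegree_single] at hD
  rw [map_add, map_add, xStat_single, xStat_single, add_mul] at hS
  omega

/-- The coefficients of a quotient by `x_i ⊕ x_j` in degree below `|d₀| - 1`, and in degree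
`|d₀| - 1` those whose exponents at `x_j` are less than half of the total, vanish together with the
corresponding coefficients of the product. -/
theorem coeff_quotient_eq_zero {n m i j a : ℕ} (hij : i ≠ j) (hi : i < n) {g : BetaSeries₂}
    {d₀ : ℕ ⊕ ℕ →₀ ℕ}
    (hlow : ∀ c ∈ box n m, c (Sum.inl i) ≠ 0 → xDegree c < xDegree d₀ →
      MvPowerSeries.coeff c (kadd betaConst (xVar i) (xVar j) * g) = 0)
    (hsame : ∀ c ∈ box n m, c (Sum.inl i) + c (Sum.inl j) = 2 * a → c (Sum.inl j) < a →
      xDegree c = xDegree d₀ → (∀ v, v ≠ Sum.inl i → v ≠ Sum.inl j → c v = d₀ v) →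
      MvPowerSeries.coeff c (kadd betaConst (xVar i) (xVar j) * g) = 0)
    {d : ℕ ⊕ ℕ →₀ ℕ} (hd : d ∈ box n m)
    (h : xDegree d + 1 < xDegree d₀ ∨ (xDegree d + 1 = xDegree d₀ ∧
      d (Sum.inl i) + d (Sum.inl j) + 1 = 2 * a ∧ d (Sum.inl j) < a ∧
      ∀ v, v ≠ Sum.inl i → v ≠ Sum.inl j → d v = d₀ v)) :
    MvPowerSeries.coeff d g = 0 := by
  classical
  have hne : (Sum.inl i : ℕ ⊕ ℕ) ≠ Sum.inl j := fun h => hij (Sum.inl_injective h)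
  have hbox : ∀ c, c ∈ box n m → c + Finsupp.single (Sum.inl i) 1 ∈ box n m := by
    intro c hc
    refine ⟨fun k hk => ?_, fun k hk => ?_⟩
    · rw [Finsupp.add_apply, hc.1 k hk, Finsupp.single_eq_of_ne (by simp; omega), add_zero]
    · rw [Finsupp.add_apply, hc.2 k hk, Finsupp.single_eq_of_ne (by simp), add_zero]
  have hbox' : ∀ c, c + Finsupp.single (Sum.inl j) 1 ∈ box n m → c ∈ box n m := by
    intro c hc
    refine ⟨fun k hk => ?_, fun k hk => ?_⟩
    · have := hc.1 k hk
      rw [Finsupp.add_apply] at this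
      omega
    · have := hc.2 k hk
      rw [Finsupp.add_apply] at this
      omega
  refine coeff_eq_zero_of_kadd_mul (X : ℤ[X]) hne (G := {d | d ∈ box n m ∧
    (xDegree d + 1 < xDegree d₀ ∨ (xDegree d + 1 = xDegree d₀ ∧
      d (Sum.inl i) + d (Sum.inl j) + 1 = 2 * a ∧ d (Sum.inl j) < a ∧
      ∀ v, v ≠ Sum.inl i → v ≠ Sum.inl j → d v = d₀ v))}) ?_ ?_ ?_ d ⟨hd, h⟩
  · rintro c ⟨hc, h1 | ⟨h1, h2, h3, h4⟩⟩
    · refine hlow _ (hbox c hc) (by simp) ?_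
      rw [map_add, xDegree_single]
      exact h1
    · refine hsame _ (hbox c hc) ?_ ?_ ?_ fun v hv1 hv2 => ?_
      · rw [Finsupp.add_apply, Finsupp.add_apply, Finsupp.single_eq_same,
          Finsupp.single_eq_of_ne hne.symm]
        omega
      · rw [Finsupp.add_apply, Finsupp.single_eq_of_ne hne.symm]
        exact h3
      · rw [map_add, xDegree_single]
        exact h1
      · rw [Finsupp.add_apply, Finsupp.single_eq_of_ne hv1]
        exact h4 v hv1 hv2
  · rintro c ⟨hc, h1⟩
    refine ⟨hbox c (hbox' c hc), ?_⟩
    rw [map_add, xDegree_single] at h1 ⊢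
    refine h1.imp_right ?_
    rintro ⟨h1, h2, h3, h4⟩
    rw [Finsupp.add_apply, Finsupp.single_eq_same] at h3
    rw [Finsupp.add_apply, Finsupp.add_apply, Finsupp.single_eq_same,
      Finsupp.single_eq_of_ne hne] at h2
    refine ⟨h1, ?_, ?_, fun v hv1 hv2 => ?_⟩
    · rw [Finsupp.add_apply, Finsupp.add_apply, Finsupp.single_eq_same,
        Finsupp.single_eq_of_ne hne.symm]
      omega
    · rw [Finsupp.add_apply, Finsupp.single_eq_of_ne hne.symm]
      omega
    · rw [← h4 v hv1 hv2, Finsupp.add_apply, Finsupp.add_apply, Finsupp.single_eq_of_ne hv1,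
        Finsupp.single_eq_of_ne hv2]
  · rintro c ⟨hc, h1⟩
    refine ⟨hbox' c hc, Or.inl ?_⟩
    rw [map_add, xDegree_single] at h1
    omega

/-- A series with the cancellation property is determined in degrees below `D` by its coefficients
at the monomials `x^ν` for strict partitions `ν`.  By symmetry it suffices to consider weakly
decreasing exponents; the monomials with two equal positive exponents are reached from those with
smaller `∑ i · d_i` by cancellation. -/
theorem IsQSeries.coeff_eq_zero {f : BetaSeries₂} (hf : IsQSeries f) {D : ℕ}
    (H : ∀ nu : StrictPartition, nu.size < D → ∀ e : ℕ →₀ ℕ,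
      MvPowerSeries.coeff (nu.expo.sumElim e) f = 0) (d : ℕ ⊕ ℕ →₀ ℕ) (hd : xDegree d < D) :
    MvPowerSeries.coeff d f = 0 := by
  classical
  induction hk : toLex (xDegree d, xStat d) using WellFoundedLT.induction generalizing d with
  | _ k ih =>
  subst hk
  have ih1 : ∀ c, xDegree c < xDegree d → MvPowerSeries.coeff c f = 0 := fun c hc =>
    ih _ (Prod.Lex.toLex_lt_toLex.mpr (Or.inl hc)) c (hc.trans hd) rfl
  have ih2 : ∀ c, xDegree c = xDegree d ∧ xStat c < xStat d → MvPowerSeries.coeff c f = 0 :=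
    fun c hc => ih _ (Prod.Lex.toLex_lt_toLex.mpr (Or.inr hc)) c (hc.1.trans_lt hd) rfl
  have hswap : ∀ (i : ℕ) (c : ℕ ⊕ ℕ →₀ ℕ), ∃ c' : ℕ ⊕ ℕ →₀ ℕ,
      c' (Sum.inl i) = c (Sum.inl (i + 1)) ∧ c' (Sum.inl (i + 1)) = c (Sum.inl i) ∧
      (∀ v, v ≠ Sum.inl i → v ≠ Sum.inl (i + 1) → c' v = c v) ∧
      MvPowerSeries.coeff c' f = MvPowerSeries.coeff c f := by
    intro i c
    have h1 : ((c.update (Sum.inl i) (c (Sum.inl (i + 1)))).update (Sum.inl (i + 1))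
        (c (Sum.inl i))) (Sum.inl i) = c (Sum.inl (i + 1)) := by
      rw [Finsupp.update_apply, if_neg (by simp), Finsupp.update_apply, if_pos rfl]
    have h2 : ((c.update (Sum.inl i) (c (Sum.inl (i + 1)))).update (Sum.inl (i + 1))
        (c (Sum.inl i))) (Sum.inl (i + 1)) = c (Sum.inl i) := by
      rw [Finsupp.update_apply, if_pos rfl]
    have h3 : ∀ v, v ≠ Sum.inl i → v ≠ Sum.inl (i + 1) →
        ((c.update (Sum.inl i) (c (Sum.inl (i + 1)))).update (Sum.inl (i + 1))
        (c (Sum.inl i))) v = c v := by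
      intro v hv1 hv2
      rw [Finsupp.update_apply, if_neg hv2, Finsupp.update_apply, if_neg hv1]
    exact ⟨_, h1, h2, h3, hf.coeff_swap i h1 h2 h3⟩
  by_cases hdec : ∃ i, d (Sum.inl i) < d (Sum.inl (i + 1))
  · obtain ⟨i, hi⟩ := hdec
    obtain ⟨c, h1, h2, h3, h4⟩ := hswap i d
    rw [← h4]
    exact ih2 c (xDegree_eq_and_xStat_lt (t := d (Sum.inl (i + 1)) - d (Sum.inl i)) (by omega)
      (by omega) (by omega) h3)
  push Not at hdec
  by_cases heq : ∃ i, d (Sum.inl i) = d (Sum.inl (i + 1)) ∧ d (Sum.inl i) ≠ 0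
  · obtain ⟨i, hi, hpos⟩ := heq
    set a := d (Sum.inl i) with ha
    have hne : (Sum.inl i : ℕ ⊕ ℕ) ≠ Sum.inl (i + 1) := by simp
    obtain ⟨n, m, hin, hdbox⟩ : ∃ n m, i + 1 < n ∧ d ∈ box n m := by
      obtain ⟨b, e, rfl⟩ := exists_eq_sumElim d
      obtain ⟨n, hn⟩ := exists_forall_le_eq_zero b
      obtain ⟨m, hm⟩ := exists_forall_le_eq_zero e
      exact ⟨n + i + 2, m, by omega, fun j hj => hn j (by omega), hm⟩
    obtain ⟨p, hp, hfp⟩ := hf n m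
    obtain ⟨p₀, hp₀, g, hg⟩ := hp.cancel i hin
    have hcoeff : ∀ c ∈ box n m, (c (Sum.inl i) ≠ 0 ∨ c (Sum.inl (i + 1)) ≠ 0) →
        MvPowerSeries.coeff c (kadd betaConst (xVar i) (xVar (i + 1)) * g) =
          MvPowerSeries.coeff c f := by
      intro c hc h
      rw [hfp c hc, hg, map_add, hp₀ c, zero_add]
      rcases h with h | h
      · exact ⟨_, Or.inl rfl, h⟩
      · exact ⟨_, Or.inr rfl, h⟩
    -- the other monomials with the same total exponent in `x_i` and `x_{i+1}`
    have hother : ∀ c : ℕ ⊕ ℕ →₀ ℕ, c (Sum.inl i) + c (Sum.inl (i + 1)) = 2 * a →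
        c (Sum.inl i) ≠ a → (∀ v, v ≠ Sum.inl i → v ≠ Sum.inl (i + 1) → c v = d v) →
        MvPowerSeries.coeff c f = 0 := by
      intro c h1 h2 h3
      rcases Nat.lt_or_gt_of_ne h2 with h4 | h4
      · obtain ⟨c', h5, h6, h7, h8⟩ := hswap i c
        rw [← h8]
        exact ih2 c' (xDegree_eq_and_xStat_lt (t := a - c (Sum.inl i)) (by omega) (by omega)
          (by omega) fun v hv1 hv2 => (h7 v hv1 hv2).trans (h3 v hv1 hv2))
      · exact ih2 c (xDegree_eq_and_xStat_lt (t := c (Sum.inl i) - a) (by omega) (by omega)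
          (by omega) h3)
    obtain ⟨d₁, hd₁⟩ : ∃ d₁, d = d₁ + Finsupp.single (Sum.inl i) 1 +
        Finsupp.single (Sum.inl (i + 1)) 1 := by
      refine ⟨d - (Finsupp.single (Sum.inl i) 1 + Finsupp.single (Sum.inl (i + 1)) 1), ?_⟩
      rw [add_assoc, tsub_add_cancel_of_le]
      intro v
      rw [Finsupp.add_apply, Finsupp.single_apply, Finsupp.single_apply]
      by_cases hv1 : Sum.inl i = v
      · subst hv1
        rw [if_pos rfl, if_neg hne.symm]
        omega
      · rw [if_neg hv1]
        split_ifs with hv2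
        · subst hv2
          omega
        · omega
    have hv : ∀ v, d v = d₁ v + Finsupp.single (Sum.inl i) 1 v +
        Finsupp.single (Sum.inl (i + 1)) 1 v := fun v => DFunLike.congr_fun hd₁ v
    have hvi : a = d₁ (Sum.inl i) + 1 := by
      rw [ha, hv, Finsupp.single_eq_same, Finsupp.single_eq_of_ne hne, add_zero]
    have hvj : a = d₁ (Sum.inl (i + 1)) + 1 := by
      rw [hi, hv, Finsupp.single_eq_same, Finsupp.single_eq_of_ne hne.symm, add_zero]
    have hdeg : xDegree d = xDegree d₁ + 1 + 1 := by
      rw [hd₁, map_add, map_add, xDegree_single, xDegree_single]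
    have hle : ∀ c : ℕ ⊕ ℕ →₀ ℕ, c ≤ d → c ∈ box n m := fun c hc =>
      ⟨fun j hj => Nat.le_zero.mp ((hc _).trans (hdbox.1 j hj).le),
        fun j hj => Nat.le_zero.mp ((hc _).trans (hdbox.2 j hj).le)⟩
    have hq1 : ∀ c ∈ box n m, xDegree c + 1 < xDegree d ∨ (xDegree c + 1 = xDegree d ∧
        c (Sum.inl i) + c (Sum.inl (i + 1)) + 1 = 2 * a ∧ c (Sum.inl (i + 1)) < a ∧
        ∀ v, v ≠ Sum.inl i → v ≠ Sum.inl (i + 1) → c v = d v) →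
        MvPowerSeries.coeff c g = 0 := by
      intro c hc h
      refine coeff_quotient_eq_zero (i := i) (j := i + 1) (Nat.succ_ne_self i).symm (by omega)
        ?_ ?_ hc h
      · intro c hc h1 h2
        rw [hcoeff c hc (Or.inl h1), ih1 c h2]
      · intro c hc h1 h2 _ h3
        rw [hcoeff c hc (by omega), hother c h1 (by omega) h3]
    have hq2 : ∀ c ∈ box n m, xDegree c + 1 < xDegree d ∨ (xDegree c + 1 = xDegree d ∧
        c (Sum.inl (i + 1)) + c (Sum.inl i) + 1 = 2 * a ∧ c (Sum.inl i) < a ∧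
        ∀ v, v ≠ Sum.inl (i + 1) → v ≠ Sum.inl i → c v = d v) →
        MvPowerSeries.coeff c g = 0 := by
      intro c hc h
      refine coeff_quotient_eq_zero (i := i + 1) (j := i) (Nat.succ_ne_self i) hin ?_ ?_ hc h
      · intro c hc h1 h2
        rw [HeckeRelations.kadd_comm, hcoeff c hc (Or.inr h1), ih1 c h2]
      · intro c hc h1 h2 _ h3
        rw [HeckeRelations.kadd_comm, hcoeff c hc (by omega),
          hother c (by omega) (by omega) fun v hv1 hv2 => h3 v hv2 hv1]
    -- the coefficient of `(x_i ⊕ x_{i+1}) g` at `x^d` is a combination of three coefficients of `g`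
    -- that have been seen to vanish
    have key := coeff_add_add_kadd_mul (X : ℤ[X]) (Sum.inl i) (Sum.inl (i + 1)) d₁ g
    rw [← hd₁] at key
    rw [← hcoeff d hdbox (Or.inl hpos)]
    refine key.trans ?_
    rw [hq1 d₁ (hle _ ?_) (Or.inl (by omega)),
      hq1 (d₁ + Finsupp.single (Sum.inl i) 1) (hle _ ?_) (Or.inr ?_),
      hq2 (d₁ + Finsupp.single (Sum.inl (i + 1)) 1) (hle _ ?_) (Or.inr ?_)]
    · simp
    · rw [hd₁, add_right_comm]
      exact self_le_add_right _ _
    · rw [map_add, xDegree_single, Finsupp.add_apply, Finsupp.add_apply, Finsupp.single_eq_same,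
        Finsupp.single_eq_of_ne hne]
      refine ⟨by omega, by omega, by omega, fun v h1 h2 => ?_⟩
      rw [hv, Finsupp.add_apply, Finsupp.single_eq_of_ne h2, Finsupp.single_eq_of_ne h1]
      simp
    · rw [hd₁]
      exact self_le_add_right _ _
    · rw [map_add, xDegree_single, Finsupp.add_apply, Finsupp.add_apply, Finsupp.single_eq_same,
        Finsupp.single_eq_of_ne hne.symm]
      refine ⟨by omega, by omega, by omega, fun v h1 h2 => ?_⟩
      rw [hv, Finsupp.add_apply, Finsupp.single_eq_of_ne h2, Finsupp.single_eq_of_ne h1]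
      simp
    · rw [hd₁, add_assoc]
      exact self_le_add_right _ _
  · push Not at heq
    obtain ⟨b, e, rfl⟩ := exists_eq_sumElim d
    obtain ⟨n, hn⟩ := exists_forall_le_eq_zero b
    obtain ⟨nu, hnu⟩ := StrictPartition.exists_part_eq b (fun i hi => by
      have h1 := hdec i
      have h2 := heq i
      simp only [Finsupp.sumElim_inl] at h1 h2
      by_contra h3
      have h4 : b i = b (i + 1) := by omega
      have := h2 h4
      omega) ⟨n, hn n le_rfl⟩
    have hb : nu.expo = b := by
      ext i
      rw [nu.expo_apply, hnu]
    rw [← hb] at hd ⊢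
    rw [xDegree_sumElim, nu.degree_expo] at hd
    exact H nu hd e

/-- In lowest degree, the coefficient at `x^λ` of a series with the cancellation property is
divisible by `2 ^ ℓ(λ)`, because the series is divisible by `∏ (x_i ⊕ x_i)` up to monomials that
miss one of the variables `x_i` with `i < ℓ(λ)`. -/
theorem IsQSeries.two_pow_length_dvd {f : BetaSeries₂} (hf : IsQSeries f) {lam : StrictPartition}
    (H : ∀ c, xDegree c < lam.size → MvPowerSeries.coeff c f = 0) (e : ℕ →₀ ℕ) :
    2 ^ lam.length ∣ MvPowerSeries.coeff (lam.expo.sumElim e) f := by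
  classical
  set n := lam.length with hn
  obtain ⟨m, hm⟩ := exists_forall_le_eq_zero e
  obtain ⟨p, hp, hfp⟩ := hf n m
  obtain ⟨g, r, hr, hg⟩ := hp.full
  set t : Finset (ℕ ⊕ ℕ) := (Finset.range n).image Sum.inl with ht
  have hmem : ∀ i, Sum.inl i ∈ t ↔ i < n := by simp [ht]
  have htcard : t.card = n := by
    rw [ht, Finset.card_image_of_injective _ Sum.inl_injective, Finset.card_range]
  set s : ℕ ⊕ ℕ →₀ ℕ := ∑ u ∈ t, Finsupp.single u 1 with hs
  have hsapp : ∀ v, s v = if v ∈ t then 1 else 0 := by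
    intro v
    rw [hs, Finsupp.finsetSum_apply]
    simp [Finsupp.single_apply]
  have hmono : ∏ u ∈ t, (MvPowerSeries.X u : BetaSeries₂) = MvPowerSeries.monomial s 1 := by
    rw [hs]
    generalize t = t
    induction t using Finset.induction_on with
    | empty => rw [Finset.prod_empty, Finset.sum_empty, MvPowerSeries.monomial_zero_one]
    | insert u t hu ih =>
      rw [Finset.prod_insert hu, Finset.sum_insert hu, ih, MvPowerSeries.X,
        MvPowerSeries.monomial_mul_monomial, one_mul]
  have hprod : ∏ i ∈ Finset.range n, kadd betaConst (xVar i) (xVar i) =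
      MvPowerSeries.monomial s 1 *
        ∏ u ∈ t, (2 + MvPowerSeries.C (X : ℤ[X]) * MvPowerSeries.X u) := by
    rw [← hmono, ← Finset.prod_mul_distrib, ht,
      Finset.prod_image (fun a _ b _ h => Sum.inl_injective h)]
    refine Finset.prod_congr rfl fun i _ => ?_
    unfold kadd betaConst xVar
    ring
  have hcoeff : ∀ c ∈ box n m, MvPowerSeries.coeff c
      ((∏ u ∈ t, (2 + MvPowerSeries.C (X : ℤ[X]) * MvPowerSeries.X u)) * g) =
      MvPowerSeries.coeff (s + c) f := by
    intro c hc
    rw [hfp (s + c), hg, hprod, map_add, hr (s + c), add_zero, mul_assoc,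
      MvPowerSeries.coeff_add_monomial_mul, one_mul]
    · rintro v ⟨i, hi, rfl⟩
      rw [Finsupp.add_apply, hsapp, if_pos ((hmem i).mpr hi)]
      omega
    · refine ⟨fun i hi => ?_, fun j hj => ?_⟩
      · rw [Finsupp.add_apply, hsapp, if_neg (by rw [hmem]; omega), hc.1 i hi]
      · rw [Finsupp.add_apply, hsapp, if_neg (by simp [ht]), hc.2 j hj]
  have hsdeg : xDegree s = n := by
    rw [hs, map_sum, ht, Finset.sum_image (fun a _ b _ h => Sum.inl_injective h)]
    simp [xDegree_single]
  obtain ⟨c, hc⟩ : ∃ c, lam.expo.sumElim e = s + c := by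
    refine ⟨lam.expo.sumElim e - s, (add_tsub_cancel_of_le fun v => ?_).symm⟩
    rw [hsapp]
    split_ifs with hv
    · obtain ⟨i, hi, rfl⟩ := Finset.mem_image.mp hv
      rw [Finset.mem_range, ← lam.part_pos_iff] at hi
      rw [Finsupp.sumElim_inl, lam.expo_apply]
      omega
    · exact Nat.zero_le _
  have hcbox : c ∈ box n m := by
    refine ⟨fun i hi => ?_, fun j hj => ?_⟩
    · have h1 := DFunLike.congr_fun hc (Sum.inl i)
      rw [Finsupp.sumElim_inl, lam.expo_apply, Finsupp.add_apply] at h1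
      have := lam.part_pos_iff i
      omega
    · have h1 := DFunLike.congr_fun hc (Sum.inr j)
      rw [Finsupp.sumElim_inr, Finsupp.add_apply, hm j hj] at h1
      omega
  have hcdeg : xDegree c + n = lam.size := by
    have := congrArg xDegree hc
    rw [xDegree_sumElim, lam.degree_expo, map_add, hsdeg] at this
    omega
  rw [hc, ← hcoeff c hcbox, ← htcard]
  refine two_pow_card_dvd_coeff (X : ℤ[X]) t (S := box n m) (wt := xDegree) (D := xDegree c)
    ?_ ?_ g ?_ c hcbox rfl
  · intro d u _ hd
    refine ⟨fun i hi => ?_, fun j hj => ?_⟩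
    · have := hd.1 i hi
      rw [Finsupp.add_apply] at this
      omega
    · have := hd.2 j hj
      rw [Finsupp.add_apply] at this
      omega
  · intro d u hu
    obtain ⟨i, _, rfl⟩ := Finset.mem_image.mp hu
    rw [map_add, xDegree_single]
  · intro d hd hlt
    rw [hcoeff d hd, H]
    rw [map_add, hsdeg]
    omega

/-! ### The cancellation property of `GQ` -/

section Transfer

variable {R : Type*} [CommRing R] {S : Type*} [SetLike S R] [AddSubmonoidClass S R]

theorem hOp_mem {M : S} {β x : R} (hβ : ∀ a ∈ M, β * a ∈ M) (hx : ∀ a ∈ M, x * a ∈ M) (c : ℕ)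
    {f : Finset ℕ → R} (hf : ∀ s, f s ∈ M) (s : Finset ℕ) : hOp (uOp β) c x f s ∈ M := by
  rw [hOp_apply]
  refine add_mem (hf s) (hx _ ?_)
  split_ifs
  · exact add_mem (hf _) (hβ _ (hf _))
  · exact zero_mem M

theorem transferQ_mem {M : S} {β x : R} (hβ : ∀ a ∈ M, β * a ∈ M) (hx : ∀ a ∈ M, x * a ∈ M) (N : ℕ)
    {f : Finset ℕ → R} (hf : ∀ s, f s ∈ M) : ∀ s, transferQ (uOp β) N x f s ∈ M := by
  have hA : ∀ N, ∀ f : Finset ℕ → R, (∀ s, f s ∈ M) → ∀ s, ascProd (uOp β) N x f s ∈ M := by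
    intro N
    induction N with
    | zero => exact fun f hf => hf
    | succ N ih => exact fun f hf => ih _ (hOp_mem hβ hx _ hf)
  have hD : ∀ N, ∀ f : Finset ℕ → R, (∀ s, f s ∈ M) → ∀ s, descProd (uOp β) N x f s ∈ M := by
    intro N
    induction N with
    | zero => exact fun f hf => hf
    | succ N ih => exact fun f hf => hOp_mem hβ hx _ (ih f hf)
  exact hD N _ (hOp_mem hβ hx 0 (hOp_mem hβ hx 0 (hA N f hf)))

theorem evolve_congr (T : R → Module.End R (Finset ℕ → R)) {x y : ℕ → R} {n : ℕ}
    (h : ∀ i, i < n → x i = y i) : evolve T x n = evolve T y n := by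
  induction n with
  | zero => rfl
  | succ n ih => rw [evolve, evolve, h n n.lt_succ_self, ih fun i hi => h i (by omega)]

theorem evolve_swap (T : R → Module.End R (Finset ℕ → R)) (x : ℕ → R) (i : ℕ)
    (h : T (x i) * T (x (i + 1)) = T (x (i + 1)) * T (x i)) (k : ℕ) :
    evolve T (fun j => x (Equiv.swap i (i + 1) j)) (i + 2 + k) = evolve T x (i + 2 + k) := by
  induction k with
  | zero =>
    have h0 : evolve T (fun j => x (Equiv.swap i (i + 1) j)) i = evolve T x i :=
      evolve_congr T fun j hj => by
        rw [Equiv.swap_apply_of_ne_of_ne (by omega) (by omega)]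
    change T (x (Equiv.swap i (i + 1) (i + 1))) (T (x (Equiv.swap i (i + 1) i)) (evolve T _ i)) =
      T _ (T _ (evolve T x i))
    rw [h0, Equiv.swap_apply_left, Equiv.swap_apply_right]
    exact LinearMap.congr_fun h _
  | succ k ih =>
    rw [← add_assoc, evolve, evolve, ih, Equiv.swap_apply_of_ne_of_ne (by omega) (by omega)]

/-- An evolution lies in any subring containing `β` and its variables. -/
theorem evolve_transferQ_mem {M : Subring R} {β : R} {x : ℕ → R} (hβ : β ∈ M) (N : ℕ) {n : ℕ}
    (hx : ∀ i, i < n → x i ∈ M) : ∀ s, evolve (transferQ (uOp β) N) x n s ∈ M := by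
  induction n with
  | zero =>
    intro s
    change (Pi.single ∅ 1 : Finset ℕ → R) s ∈ M
    by_cases hs : s = ∅
    · rw [hs, Pi.single_eq_same]
      exact one_mem M
    · rw [Pi.single_eq_of_ne hs]
      exact zero_mem M
  | succ n ih =>
    exact transferQ_mem (fun a ha => mul_mem hβ ha) (fun a ha => mul_mem (hx n n.lt_succ_self) ha) N
      (ih fun i hi => hx i (by omega))

/-- The part of an evolution that depends on `x_i` and `x_{i+1}` is divisible by
`x_i ⊕ x_{i+1}`. -/
theorem evolve_cancel {M : Subring R} {β : R} {x : ℕ → R} (hβ : β ∈ M) {i : ℕ}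
    (hx : ∀ j, j ≠ i → j ≠ i + 1 → x j ∈ M) (N k : ℕ) : ∃ F G : Finset ℕ → R,
    (∀ s, F s ∈ M) ∧ evolve (transferQ (uOp β) N) x (i + 2 + k) =
      F + kadd β (x i) (x (i + 1)) • G := by
  induction k with
  | zero =>
    obtain ⟨Z, hZ⟩ := (heckeRelations_uOp β).exists_transferQ_mul N (x (i + 1)) (x i)
    refine ⟨evolve (transferQ (uOp β) N) x i, Z (evolve (transferQ (uOp β) N) x i),
      evolve_transferQ_mem hβ N fun j hj => hx j (by omega) (by omega), ?_⟩
    rw [HeckeRelations.kadd_comm]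
    exact LinearMap.congr_fun hZ _
  | succ k ih =>
    obtain ⟨F, G, hF, h⟩ := ih
    refine ⟨transferQ (uOp β) N (x (i + 2 + k)) F, transferQ (uOp β) N (x (i + 2 + k)) G,
      transferQ_mem (fun a ha => mul_mem hβ ha)
        (fun a ha => mul_mem (hx _ (by omega) (by omega)) ha) N hF, ?_⟩
    rw [← add_assoc, evolve, h, map_add, map_smul]

/-- If `M n` consists of the elements that do not involve all of `x_0, …, x_{n-1}`, then the part of
an evolution that involves all of these variables is divisible by the product of the
`x_i ⊕ x_i`. -/
theorem evolve_full {M : ℕ → AddSubgroup R} (hM : ∀ n, M n ≤ M (n + 1)) {β : R} {x : ℕ → R}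
    (hβ : ∀ n, ∀ a ∈ M n, β * a ∈ M n) (hx : ∀ n, ∀ a ∈ M n, x n * a ∈ M n) {N : ℕ}
    (hE : ∀ n s, evolve (transferQ (uOp β) N) x n s ∈ M (n + 1)) (n : ℕ) :
    ∃ G F : Finset ℕ → R, (∀ s, F s ∈ M n) ∧ evolve (transferQ (uOp β) N) x n =
      (∏ i ∈ Finset.range n, kadd β (x i) (x i)) • G + F := by
  induction n with
  | zero =>
    exact ⟨_, 0, fun s => zero_mem _, by rw [Finset.prod_range_zero, one_smul, add_zero]⟩
  | succ n ih =>
    obtain ⟨G, F, hF, h⟩ := ih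
    obtain ⟨W, hW⟩ := (heckeRelations_uOp β).exists_transferQ_eq N (x n)
    have hTF := transferQ_mem (hβ n) (hx n) N hF
    have hEn := hE n
    set E := evolve (transferQ (uOp β) N) x n with hE
    set T := transferQ (uOp β) N (x n) with hT
    refine ⟨W G, E + (T F - F), fun s => add_mem (hEn s) (hM n (sub_mem (hTF s) (hF s))), ?_⟩
    have h1 : ∀ f, T f = f + kadd β (x n) (x n) • W f := by
      intro f
      rw [hW]
      rfl
    have h2 : T E = E + kadd β (x n) (x n) •
        W ((∏ i ∈ Finset.range n, kadd β (x i) (x i)) • G + F) := by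
      rw [← h, h1]
    rw [evolve, ← hE, ← hT, h2, map_add, map_smul, smul_add, smul_smul, Finset.prod_range_succ,
      h1 F, mul_comm (kadd _ _ _)]
    abel

end Transfer

theorem constantCoeff_one_add_betaConst_mul (u : ℕ ⊕ ℕ) :
    MvPowerSeries.constantCoeff (1 + betaConst * MvPowerSeries.X u) = ((1 : ℤ[X]ˣ) : ℤ[X]) := by
  simp

/-- `y = x ⊕ m` is solvable for `m` because `1 + βx` is invertible. -/
theorem transferQ_xVar_comm (N i j : ℕ) :
    transferQ (uOp betaConst) N (xVar i) * transferQ (uOp betaConst) N (xVar j) =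
      transferQ (uOp betaConst) N (xVar j) * transferQ (uOp betaConst) N (xVar i) := by
  have hJ := MvPowerSeries.mul_invOfUnit _ _ (constantCoeff_one_add_betaConst_mul (Sum.inl i))
  set J := MvPowerSeries.invOfUnit (1 + betaConst * MvPowerSeries.X (Sum.inl i)) 1
  have h : xVar j = kadd betaConst (xVar i) ((xVar j - xVar i) * J) := by
    unfold kadd
    unfold xVar
    linear_combination -(MvPowerSeries.X (Sum.inl j) - MvPowerSeries.X (Sum.inl i)) * hJ
  rw [h]
  exact (heckeRelations_uOp betaConst).transferQ_comm N _ _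

theorem betaConst_mem_freeOf (V : Set (ℕ ⊕ ℕ)) : betaConst ∈ freeOf ℤ[X] V := C_mem_freeOf V _

theorem mem_vanishingOn_of_mem_freeOf {V W : Set (ℕ ⊕ ℕ)} {u : ℕ ⊕ ℕ} (hV : u ∈ V) (hW : u ∈ W)
    {p : BetaSeries₂} (hp : p ∈ freeOf ℤ[X] V) : p ∈ vanishingOn ℤ[X] {d | ∀ v ∈ W, d v ≠ 0} :=
  fun d hd => hp d ⟨u, hV, hd u hW⟩

theorem vanishingOn_mono {V W : Set (ℕ ⊕ ℕ)} (h : V ⊆ W) {p : BetaSeries₂}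
    (hp : p ∈ vanishingOn ℤ[X] {d | ∀ v ∈ V, d v ≠ 0}) :
    p ∈ vanishingOn ℤ[X] {d | ∀ v ∈ W, d v ≠ 0} :=
  fun d hd => hp d fun v hv => hd v (h hv)

theorem isQSeries_inX_GQ (lam : StrictPartition) : IsQSeries (inX (GQ lam)) := by
  intro n m
  set N := lam.part 0 with hN
  have hp : ∀ x : ℕ → BetaSeries₂, tableauSum betaConst x (pairsQ N n) lam =
      evolve (transferQ (uOp betaConst) N) x n lam.sites := by
    intro x
    rw [← tableauFun_pairsQ, tableauFun_sites]
  refine ⟨tableauSum betaConst xVar (pairsQ N n) lam, ⟨fun i hi => ?_, fun i hi => ?_, ?_⟩,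
    fun d hd => ?_⟩
  · obtain ⟨k, rfl⟩ := Nat.exists_eq_add_of_le (show i + 2 ≤ n from hi)
    have h1 := map_tableauSum (swapX i).toRingHom betaConst xVar (pairsQ N (i + 2 + k)) lam
    have h2 : (swapX i).toRingHom betaConst = betaConst := MvPowerSeries.rename_C _ _
    have h3 : (fun j => (swapX i).toRingHom (xVar j)) =
        fun j => xVar (Equiv.swap i (i + 1) j) := by
      funext j
      refine (MvPowerSeries.rename_X _ _).trans (congrArg MvPowerSeries.X ?_)
      exact (Function.Embedding.swap_apply (Function.Embedding.inl (β := ℕ)) i (i + 1) j)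
    rw [h2, h3] at h1
    refine h1.trans ?_
    rw [hp, hp, evolve_swap _ _ _ (transferQ_xVar_comm N i (i + 1))]
  · obtain ⟨k, rfl⟩ := Nat.exists_eq_add_of_le (show i + 2 ≤ n from hi)
    obtain ⟨F, G, hF, h⟩ := evolve_cancel (betaConst_mem_freeOf {Sum.inl i, Sum.inl (i + 1)})
      (x := xVar) (i := i) (fun j h1 h2 => X_mem_freeOf (by simp [h1, h2])) N k
    refine ⟨F lam.sites, hF _, G lam.sites, ?_⟩
    rw [hp, h]
    rfl
  · obtain ⟨G, F, hF, h⟩ := evolve_full (β := betaConst) (x := xVar) (N := N)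
      (M := fun n => (vanishingOn ℤ[X]
        {d | ∀ v ∈ (Sum.inl '' Set.Iio n : Set (ℕ ⊕ ℕ)), d v ≠ 0}).toAddSubgroup)
      (fun n p hp => vanishingOn_mono (Set.image_mono (Set.Iio_subset_Iio n.le_succ)) hp)
      (fun n p hp => mul_mem_vanishingOn (betaConst_mem_freeOf _) hp)
      (fun n p hp => mul_mem_vanishingOn (X_mem_freeOf (by simp)) hp)
      (fun n s => mem_vanishingOn_of_mem_freeOf (V := {Sum.inl n}) (u := Sum.inl n) rfl
        (Set.mem_image_of_mem _ (Set.mem_Iio.mpr n.lt_succ_self))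
        (evolve_transferQ_mem (betaConst_mem_freeOf _) N
          (fun j hj => X_mem_freeOf (by simp; omega)) s)) n
    refine ⟨G lam.sites, F lam.sites, hF _, ?_⟩
    rw [hp, h]
    rfl
  · have h1 := map_tableauSum (MvPowerSeries.rename (R := ℤ[X])
      (Function.Embedding.inl : ℕ ↪ ℕ ⊕ ℕ)).toRingHom (MvPowerSeries.C (X : ℤ[X]))
      MvPowerSeries.X (pairsQ N n) lam
    have h2 : inX (tableauSum (MvPowerSeries.C (X : ℤ[X])) MvPowerSeries.X (pairsQ N n) lam) =
        tableauSum betaConst xVar (pairsQ N n) lam := by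
      refine h1.trans ?_
      congr 1
      · exact MvPowerSeries.rename_C _ _
      · funext j
        exact MvPowerSeries.rename_X _ _
    obtain ⟨a, b, rfl⟩ := exists_eq_sumElim d
    rw [← h2, coeff_sumElim_inX, coeff_sumElim_inX,
      coeff_GQ lam (N := N) (by omega) (fun i hi => hd.1 i hi)]

/-! ### The Cauchy kernel -/

/-- `1 / (1 + β x_i)`. -/
noncomputable def xUnitInv (i : ℕ) : BetaSeries₂ :=
  MvPowerSeries.invOfUnit (1 + MvPowerSeries.C (X : ℤ[X]) * xVar i) 1

/-- `1 / (1 - x_i y_j)`. -/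
noncomputable def geomXY (i j : ℕ) : BetaSeries₂ :=
  MvPowerSeries.invOfUnit (1 - xVar i * yVar j) 1

theorem mul_xUnitInv (i : ℕ) : (1 + betaConst * xVar i) * xUnitInv i = 1 :=
  MvPowerSeries.mul_invOfUnit _ _ (constantCoeff_one_add_betaConst_mul (Sum.inl i))

theorem mul_geomXY (i j : ℕ) : (1 - xVar i * yVar j) * geomXY i j = 1 :=
  MvPowerSeries.mul_invOfUnit _ _ (by simp [xVar])

theorem cauchyFactor_eq (i j : ℕ) :
    cauchyFactor (i, j) = (1 + xVar i * xUnitInv i * yVar j) * geomXY i j := by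
  unfold cauchyFactor xBar
  rw [← xUnitInv, ← geomXY]
  ring

theorem cauchyFactor_eq_one_add (i j : ℕ) :
    cauchyFactor (i, j) = 1 + xVar i * (yVar j * ((1 + xUnitInv i) * geomXY i j)) := by
  rw [cauchyFactor_eq]
  linear_combination mul_geomXY i j

theorem kadd_dvd_cauchyFactor_sub_one (i j : ℕ) :
    kadd betaConst (xVar i) (xVar i) ∣ cauchyFactor (i, j) - 1 := by
  refine ⟨xUnitInv i * yVar j * geomXY i j, ?_⟩
  rw [cauchyFactor_eq_one_add, kadd]
  linear_combination -(xVar i * yVar j * geomXY i j) * mul_xUnitInv i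

/-- The product of the factors for `x_i` and `x_k` is `1` when `x_k` is the inverse of `x_i`. -/
theorem kadd_dvd_cauchyFactor_mul_sub_one (i k j : ℕ) :
    kadd betaConst (xVar i) (xVar k) ∣ cauchyFactor (i, j) * cauchyFactor (k, j) - 1 := by
  have h1 : (1 + xVar i * xUnitInv i * yVar j) * geomXY k j =
      1 + kadd betaConst (xVar i) (xVar k) * (xUnitInv i * yVar j * geomXY k j) := by
    unfold kadd
    linear_combination mul_geomXY k j - xVar k * yVar j * geomXY k j * mul_xUnitInv i
  have h2 : (1 + xVar k * xUnitInv k * yVar j) * geomXY i j =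
      1 + kadd betaConst (xVar i) (xVar k) * (xUnitInv k * yVar j * geomXY i j) := by
    unfold kadd
    linear_combination mul_geomXY i j - xVar i * yVar j * geomXY i j * mul_xUnitInv k
  have h3 : cauchyFactor (i, j) * cauchyFactor (k, j) =
      ((1 + xVar i * xUnitInv i * yVar j) * geomXY k j) *
        ((1 + xVar k * xUnitInv k * yVar j) * geomXY i j) := by
    rw [cauchyFactor_eq, cauchyFactor_eq]
    ring
  rw [h3, h1, h2]
  exact ⟨xUnitInv i * yVar j * geomXY k j + xUnitInv k * yVar j * geomXY i j +
    kadd betaConst (xVar i) (xVar k) * (xUnitInv i * yVar j * geomXY k j) *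
      (xUnitInv k * yVar j * geomXY i j), by ring⟩

theorem dvd_prod_sub_one {ι R : Type*} [CommRing R] {k : R} {f : ι → R} (s : Finset ι)
    (h : ∀ i ∈ s, k ∣ f i - 1) : k ∣ ∏ i ∈ s, f i - 1 := by
  classical
  induction s using Finset.induction_on with
  | empty => simp
  | insert i s hi ih =>
    rw [Finset.prod_insert hi, show f i * ∏ j ∈ s, f j - 1 =
      (f i - 1) * ∏ j ∈ s, f j + (∏ j ∈ s, f j - 1) by ring]
    exact dvd_add (dvd_mul_of_dvd_left (h i (Finset.mem_insert_self i s)) _)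
      (ih fun j hj => h j (Finset.mem_insert_of_mem hj))

theorem cauchyFactor_mem_freeOf {V : Set (ℕ ⊕ ℕ)} (hV : V ⊆ Set.range Sum.inl) {i : ℕ}
    (hi : Sum.inl i ∉ V) (j : ℕ) : cauchyFactor (i, j) ∈ freeOf ℤ[X] V := by
  have hx : xVar i ∈ freeOf ℤ[X] V := X_mem_freeOf hi
  have hy : yVar j ∈ freeOf ℤ[X] V := X_mem_freeOf fun h => by
    obtain ⟨k, hk⟩ := hV h
    exact Sum.inl_ne_inr hk
  have hJ : xUnitInv i ∈ freeOf ℤ[X] V := by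
    refine mem_freeOf_of_one_sub_mul (a := -(betaConst * xVar i))
      (neg_mem (mul_mem (betaConst_mem_freeOf V) hx)) (by simp [xVar]) ?_
    rw [sub_neg_eq_add, mul_xUnitInv]
    exact one_mem _
  have hQ : geomXY i j ∈ freeOf ℤ[X] V := by
    refine mem_freeOf_of_one_sub_mul (a := xVar i * yVar j) (mul_mem hx hy) (by simp [xVar]) ?_
    rw [mul_geomXY]
    exact one_mem _
  rw [cauchyFactor_eq]
  exact mul_mem (add_mem (one_mem _) (mul_mem (mul_mem hx hJ) hy)) hQ

theorem swapX_xVar (l i : ℕ) : swapX l (xVar i) = xVar (Equiv.swap l (l + 1) i) := by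
  refine (MvPowerSeries.rename_X _ _).trans (congrArg MvPowerSeries.X ?_)
  exact Function.Embedding.swap_apply (Function.Embedding.inl (β := ℕ)) l (l + 1) i

theorem swapX_betaConst (l : ℕ) : swapX l betaConst = betaConst := MvPowerSeries.rename_C _ _

theorem swapX_yVar (l j : ℕ) : swapX l (yVar j) = yVar j := by
  refine (MvPowerSeries.rename_X _ _).trans (congrArg MvPowerSeries.X ?_)
  exact Equiv.swap_apply_of_ne_of_ne Sum.inr_ne_inl Sum.inr_ne_inl

theorem swapX_cauchyFactor (l i j : ℕ) :
    swapX l (cauchyFactor (i, j)) = cauchyFactor (Equiv.swap l (l + 1) i, j) := by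
  have hJ : swapX l (xUnitInv i) = xUnitInv (Equiv.swap l (l + 1) i) := by
    have h := congrArg (swapX l) (mul_xUnitInv i)
    simp only [map_mul, map_add, map_one, swapX_betaConst, swapX_xVar] at h
    rw [mul_comm] at h
    exact left_inv_eq_right_inv h (mul_xUnitInv _)
  have hQ : swapX l (geomXY i j) = geomXY (Equiv.swap l (l + 1) i) j := by
    have h := congrArg (swapX l) (mul_geomXY i j)
    simp only [map_mul, map_sub, map_one, swapX_yVar, swapX_xVar] at h
    rw [mul_comm] at h
    exact left_inv_eq_right_inv h (mul_geomXY _ _)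
  rw [cauchyFactor_eq, cauchyFactor_eq]
  simp only [map_mul, map_add, map_one, swapX_xVar, swapX_yVar, hJ, hQ]

theorem qCancels_prod_cauchyFactor (n m : ℕ) :
    QCancels n (∏ i ∈ Finset.range n, ∏ j ∈ Finset.range m, cauchyFactor (i, j)) where
  swap l hl := by
    simp only [map_prod, swapX_cauchyFactor]
    refine Finset.prod_equiv (Equiv.swap l (l + 1)) (fun i => ?_) fun i _ => rfl
    rw [Finset.mem_range, Finset.mem_range]
    rcases eq_or_ne i l with rfl | h1
    · rw [Equiv.swap_apply_left]
      omega
    · rcases eq_or_ne i (l + 1) with rfl | h2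
      · rw [Equiv.swap_apply_right]
        omega
      · rw [Equiv.swap_apply_of_ne_of_ne h1 h2]
  cancel l hl := by
    have h1 : l ∈ Finset.range n := Finset.mem_range.mpr (by omega)
    have h2 : l + 1 ∈ (Finset.range n).erase l :=
      Finset.mem_erase.mpr ⟨Nat.succ_ne_self l, Finset.mem_range.mpr hl⟩
    obtain ⟨H, hH⟩ := dvd_prod_sub_one (k := kadd betaConst (xVar l) (xVar (l + 1)))
      (Finset.range m) fun j _ => kadd_dvd_cauchyFactor_mul_sub_one l (l + 1) j
    rw [Finset.prod_mul_distrib, sub_eq_iff_eq_add] at hH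
    set P := ∏ i ∈ ((Finset.range n).erase l).erase (l + 1), ∏ j ∈ Finset.range m,
      cauchyFactor (i, j) with hP
    refine ⟨P, ?_, H * P, ?_⟩
    · refine prod_mem fun i hi => prod_mem fun j _ => cauchyFactor_mem_freeOf ?_ ?_ j
      · rintro v (rfl | rfl) <;> exact ⟨_, rfl⟩
      · rw [Finset.mem_erase, Finset.mem_erase] at hi
        simp [hi.1, hi.2.1]
    · rw [← Finset.mul_prod_erase _ _ h1, ← Finset.mul_prod_erase _ _ h2, ← hP, ← mul_assoc, hH]
      ring
  full := by
    induction n with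
    | zero => exact ⟨_, 0, zero_mem _, by rw [Finset.prod_range_zero, Finset.prod_range_zero,
        one_mul, add_zero]⟩
    | succ n ih =>
      obtain ⟨g, r, hr, hg⟩ := ih
      obtain ⟨H, hH⟩ := dvd_prod_sub_one (k := kadd betaConst (xVar n) (xVar n))
        (Finset.range m) fun j _ => kadd_dvd_cauchyFactor_sub_one n j
      set A := ∏ j ∈ Finset.range m, cauchyFactor (n, j) with hA
      set P := ∏ i ∈ Finset.range n, ∏ j ∈ Finset.range m, cauchyFactor (i, j) with hP
      have hAfree : A - 1 ∈ freeOf ℤ[X] (Sum.inl '' Set.Iio n : Set (ℕ ⊕ ℕ)) := by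
        refine sub_mem (prod_mem fun j _ => cauchyFactor_mem_freeOf ?_ (by simp) j) (one_mem _)
        exact Set.image_subset_range _ _
      have hPfree : P ∈ freeOf ℤ[X] {(Sum.inl n : ℕ ⊕ ℕ)} := by
        refine prod_mem fun i hi => prod_mem fun j _ => cauchyFactor_mem_freeOf ?_ ?_ j
        · rintro v rfl
          exact ⟨n, rfl⟩
        · have := Finset.mem_range.mp hi
          simp
          omega
      refine ⟨H * g, P + (A - 1) * r, add_mem ?_ ?_, ?_⟩
      · exact mem_vanishingOn_of_mem_freeOf (V := {Sum.inl n}) (u := Sum.inl n) rfl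
          (Set.mem_image_of_mem _ (Set.mem_Iio.mpr n.lt_succ_self)) hPfree
      · exact vanishingOn_mono (Set.image_mono (Set.Iio_subset_Iio n.le_succ))
          (mul_mem_vanishingOn hAfree hr)
      · rw [Finset.prod_range_succ, Finset.prod_range_succ, ← hP, ← hA]
        linear_combination (A - 1) * hg +
          (∏ i ∈ Finset.range n, kadd betaConst (xVar i) (xVar i)) * g * hH

/-- The factors of the kernel outside a box do not contribute to the coefficients in this box. -/
theorem coeff_prod_cauchyFactor {n m : ℕ} {d : ℕ ⊕ ℕ →₀ ℕ} (hd : d ∈ box n m)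
    {s : Finset (ℕ × ℕ)} (hs : Finset.range n ×ˢ Finset.range m ⊆ s) :
    MvPowerSeries.coeff d (∏ p ∈ s, cauchyFactor p) =
      MvPowerSeries.coeff d (∏ i ∈ Finset.range n, ∏ j ∈ Finset.range m, cauchyFactor (i, j)) := by
  classical
  have hone : ∀ p, p ∉ Finset.range n ×ˢ Finset.range m → ∀ c ∈ box n m,
      MvPowerSeries.coeff c (cauchyFactor p) = MvPowerSeries.coeff c 1 := by
    rintro ⟨i, j⟩ hp c hc
    rw [cauchyFactor_eq_one_add, map_add, add_eq_left]
    rw [Finset.mem_product, Finset.mem_range, Finset.mem_range] at hp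
    by_cases hi : i < n
    · rw [mul_left_comm]
      exact coeff_X_mul_eq_zero (hc.2 j (by omega)) _
    · exact coeff_X_mul_eq_zero (hc.1 i (by omega)) _
  have hrest : ∀ t : Finset (ℕ × ℕ), (∀ p ∈ t, p ∉ Finset.range n ×ˢ Finset.range m) →
      ∀ c ∈ box n m, MvPowerSeries.coeff c (∏ p ∈ t, cauchyFactor p) =
        MvPowerSeries.coeff c 1 := by
    intro t
    induction t using Finset.induction_on with
    | empty => exact fun _ c _ => by rw [Finset.prod_empty]
    | insert p t hp ih =>
      intro ht c hc
      rw [Finset.prod_insert hp, coeff_mul_congr (hone p (ht p (Finset.mem_insert_self p t)))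
        (ih fun q hq => ht q (Finset.mem_insert_of_mem hq)) c hc, one_mul]
  rw [← Finset.prod_sdiff hs, coeff_mul_congr (f' := 1)
    (p' := ∏ p ∈ Finset.range n ×ˢ Finset.range m, cauchyFactor p)
    (hrest _ fun p hp => (Finset.mem_sdiff.mp hp).2) (fun _ _ => rfl) d hd, one_mul,
    Finset.prod_product]

theorem exists_mem_box (d : ℕ ⊕ ℕ →₀ ℕ) : ∃ N, d ∈ box N N := by
  obtain ⟨a, b, rfl⟩ := exists_eq_sumElim d
  obtain ⟨n, hn⟩ := exists_forall_le_eq_zero a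
  obtain ⟨m, hm⟩ := exists_forall_le_eq_zero b
  exact ⟨n + m, fun i hi => hn i (by omega), fun j hj => hm j (by omega)⟩

/-- The Cauchy kernel converges, and it has the cancellation property. -/
theorem exists_hasProd_cauchyFactor :
    letI : TopologicalSpace ℤ[X] := ⊥
    ∃ K : BetaSeries₂, HasProd cauchyFactor K ∧ IsQSeries K := by
  classical
  let _ : TopologicalSpace ℤ[X] := ⊥
  choose N hN using exists_mem_box
  set K : BetaSeries₂ := fun d => MvPowerSeries.coeff d
    (∏ i ∈ Finset.range (N d), ∏ j ∈ Finset.range (N d), cauchyFactor (i, j)) with hK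
  have hcoeff : ∀ d, MvPowerSeries.coeff d K = MvPowerSeries.coeff d
    (∏ i ∈ Finset.range (N d), ∏ j ∈ Finset.range (N d), cauchyFactor (i, j)) := fun d => rfl
  refine ⟨K, ?_, fun n m => ⟨_, qCancels_prod_cauchyFactor n m, fun d hd => ?_⟩⟩
  · rw [HasProd, MvPowerSeries.WithPiTopology.tendsto_iff_coeff_tendsto]
    intro d
    refine tendsto_nhds_of_eventually_eq ?_
    rw [SummationFilter.unconditional_filter]
    filter_upwards [Filter.eventually_ge_atTop (Finset.range (N d) ×ˢ Finset.range (N d))]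
      with s hs
    rw [hcoeff, coeff_prod_cauchyFactor (hN d) hs]
  · rw [hcoeff, ← coeff_prod_cauchyFactor (hN d) (s := Finset.range (N d) ×ˢ Finset.range (N d) ∪
      Finset.range n ×ˢ Finset.range m) Finset.subset_union_left,
      coeff_prod_cauchyFactor hd Finset.subset_union_right]

/-! ### Expansion of the kernel -/

/-- The exact quotient of `a` by `2 ^ l`, or `0` if `a` is not divisible by `2 ^ l`. -/
noncomputable def divTwoPow (l : ℕ) (a : ℤ[X]) : ℤ[X] :=
  open scoped Classical in if h : 2 ^ l ∣ a then h.choose else 0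

theorem two_pow_mul_divTwoPow {l : ℕ} {a : ℤ[X]} (h : 2 ^ l ∣ a) : 2 ^ l * divTwoPow l a = a := by
  rw [divTwoPow, dif_pos h]
  exact h.choose_spec.symm

/-- The coefficients `c_λ(y)` of the expansion `K = ∑ GQ_λ(x) c_λ(y)`, found by triangular
elimination. -/
noncomputable def kernelDual (K : BetaSeries₂) (lam : StrictPartition) : BetaSeries := fun e =>
  divTwoPow lam.length (MvPowerSeries.coeff (lam.expo.sumElim e) K -
    ∑ mu ∈ ((sizeLE lam.size).filter fun mu => mu.rank < lam.rank).attach,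
      MvPowerSeries.coeff lam.expo (GQ mu.1) * MvPowerSeries.coeff e (kernelDual K mu.1))
termination_by (lam.size, expStat lam.expo)
decreasing_by
  have h := (Finset.mem_filter.mp mu.2).2
  rw [StrictPartition.rank_lt_iff] at h
  exact Prod.lex_iff.mpr h

theorem coeff_kernelDual (K : BetaSeries₂) (lam : StrictPartition) (e : ℕ →₀ ℕ) :
    MvPowerSeries.coeff e (kernelDual K lam) =
      divTwoPow lam.length (MvPowerSeries.coeff (lam.expo.sumElim e) K -
        ∑ mu ∈ (sizeLE lam.size).filter (fun mu => mu.rank < lam.rank),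
          MvPowerSeries.coeff lam.expo (GQ mu) * MvPowerSeries.coeff e (kernelDual K mu)) := by
  rw [← Finset.sum_attach]
  change kernelDual K lam e = _
  rw [kernelDual]

theorem IsQSeries.sub_sum_kernelDual {K : BetaSeries₂} (hK : IsQSeries K)
    (s : Finset StrictPartition) :
    IsQSeries (K - ∑ mu ∈ s, inX (GQ mu) * inY (kernelDual K mu)) :=
  hK.sub_sum s fun mu => (isQSeries_inX_GQ mu).mul_inY _

theorem coeff_sub_sum_kernelDual (K : BetaSeries₂) (s : Finset StrictPartition) (d e : ℕ →₀ ℕ) :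
    MvPowerSeries.coeff (d.sumElim e) (K - ∑ mu ∈ s, inX (GQ mu) * inY (kernelDual K mu)) =
      MvPowerSeries.coeff (d.sumElim e) K -
        ∑ mu ∈ s, MvPowerSeries.coeff d (GQ mu) * MvPowerSeries.coeff e (kernelDual K mu) := by
  rw [map_sub, map_sum]
  simp only [coeff_inX_mul_inY]

/-- If the division by `2 ^ ℓ(ν)` in the definition of `c_ν` is exact, then subtracting the terms
up to `ν` cancels the coefficients at `x^ν`. -/
theorem coeff_expo_sub_sum_kernelDual {K : BetaSeries₂} {nu : StrictPartition}
    {s : Finset StrictPartition} (hnu : nu ∈ s)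
    (hs : (sizeLE nu.size).filter (fun mu => mu.rank < nu.rank) ⊆ s) {e : ℕ →₀ ℕ}
    (h : 2 ^ nu.length ∣ MvPowerSeries.coeff (nu.expo.sumElim e) K -
      ∑ mu ∈ (sizeLE nu.size).filter (fun mu => mu.rank < nu.rank),
        MvPowerSeries.coeff nu.expo (GQ mu) * MvPowerSeries.coeff e (kernelDual K mu)) :
    MvPowerSeries.coeff (nu.expo.sumElim e)
      (K - ∑ mu ∈ s, inX (GQ mu) * inY (kernelDual K mu)) = 0 := by
  classical
  have h1 := two_pow_mul_divTwoPow h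
  rw [← coeff_kernelDual, ← coeff_expo_GQ] at h1
  rw [coeff_sub_sum_kernelDual, ← Finset.add_sum_erase s _ hnu, h1]
  have h2 : (sizeLE nu.size).filter (fun mu => mu.rank < nu.rank) ⊆ s.erase nu := by
    intro mu hmu
    refine Finset.mem_erase.mpr ⟨?_, hs hmu⟩
    rintro rfl
    exact lt_irrefl _ (Finset.mem_filter.mp hmu).2
  rw [← Finset.sum_subset h2]
  · ring
  · intro mu hmu hn
    have h3 : MvPowerSeries.coeff nu.expo (GQ mu) = 0 := by
      by_contra h4
      rcases isTriangular_GQ.rank_lt nu mu h4 with h5 | h5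
      · refine hn (Finset.mem_filter.mpr ⟨(mem_sizeLE _ _).mpr ?_, h5⟩)
        rw [StrictPartition.rank_lt_iff] at h5
        omega
      · exact (Finset.mem_erase.mp hmu).1 h5
    rw [h3, zero_mul]

/-- All divisions in the definition of `kernelDual` are exact: the remainder at `λ` has the
cancellation property, and by induction no terms of degree below `|λ|`. -/
theorem two_pow_dvd_kernelDual {K : BetaSeries₂} (hK : IsQSeries K) (lam : StrictPartition)
    (e : ℕ →₀ ℕ) : 2 ^ lam.length ∣ MvPowerSeries.coeff (lam.expo.sumElim e) K -
      ∑ mu ∈ (sizeLE lam.size).filter (fun mu => mu.rank < lam.rank),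
        MvPowerSeries.coeff lam.expo (GQ mu) * MvPowerSeries.coeff e (kernelDual K mu) := by
  induction hr : lam.rank using WellFoundedLT.induction generalizing lam e with
  | _ r ih =>
    subst hr
    rw [← coeff_sub_sum_kernelDual]
    refine (hK.sub_sum_kernelDual _).two_pow_length_dvd (fun c hc => ?_) e
    refine (hK.sub_sum_kernelDual _).coeff_eq_zero (fun nu hnu e => ?_) c hc
    have hlt : nu.rank < lam.rank := (StrictPartition.rank_lt_iff _ _).mpr (Or.inl hnu)
    refine coeff_expo_sub_sum_kernelDual (Finset.mem_filter.mpr ⟨(mem_sizeLE _ _).mpr hnu.le, hlt⟩)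
      (fun mu hmu => ?_) (ih _ hlt nu e rfl)
    rw [Finset.mem_filter, mem_sizeLE] at hmu ⊢
    exact ⟨hmu.1.trans hnu.le, hmu.2.trans hlt⟩

/-- A series with the cancellation property expands in the functions `GQ`. -/
theorem coeff_eq_sum_kernelDual {K : BetaSeries₂} (hK : IsQSeries K) (d e : ℕ →₀ ℕ) :
    MvPowerSeries.coeff (d.sumElim e) K = ∑ lam ∈ sizeLE d.degree,
      MvPowerSeries.coeff d (GQ lam) * MvPowerSeries.coeff e (kernelDual K lam) := by
  rw [← sub_eq_zero, ← coeff_sub_sum_kernelDual]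
  refine (hK.sub_sum_kernelDual _).coeff_eq_zero (D := d.degree + 1) (fun nu hnu e => ?_) _ ?_
  · refine coeff_expo_sub_sum_kernelDual ((mem_sizeLE _ _).mpr (by omega)) (fun mu hmu => ?_)
      (two_pow_dvd_kernelDual hK nu e)
    rw [Finset.mem_filter, mem_sizeLE] at hmu
    rw [mem_sizeLE]
    omega
  · rw [xDegree_sumElim]
    exact Nat.lt_succ_self _

theorem exists_cauchyIdentity_GQ : ∃ gp, CauchyIdentity GQ gp := by
  obtain ⟨K, hK, hQ⟩ := exists_hasProd_cauchyFactor
  exact ⟨kernelDual K, (cauchyIdentity_iff isTriangular_GQ.size_le).mpr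
    ⟨K, hK, coeff_eq_sum_kernelDual hQ⟩⟩

theorem mainTheorem4 :
    (∃! gp : StrictPartition → BetaSeries, CauchyIdentity GQ gp) ∧
    (∃! gq : StrictPartition → BetaSeries, CauchyIdentity GP gq) ∧
    ∀ gp gq : StrictPartition → BetaSeries, CauchyIdentity GQ gp → CauchyIdentity GP gq →
      ∀ lam : StrictPartition,
        toRat (gq lam) = (2 : ℚ[X]) ^ lam.length •
          ∑ mu ∈ lam.verticalStrips,
            ((-1 : ℚ[X]) ^ StrictPartition.cols lam mu *
              (-(C (1 / 2 : ℚ) * X)) ^ (StrictPartition.skew lam mu).card) • toRat (gp mu) := by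
  obtain ⟨gp, hgp⟩ := exists_cauchyIdentity_GQ
  refine ⟨⟨gp, hgp, fun g hg => hg.unique isTriangular_GQ hgp⟩,
    ⟨dualExpansion gp, hgp.dualExpansion, fun g hg => hg.unique isTriangular_GP hgp.dualExpansion⟩,
    fun gp gq h h' lam => ?_⟩
  rw [h'.unique isTriangular_GP h.dualExpansion, toRat_dualExpansion]
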